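/- Let $n\ge 1$. For $1\le r\le n$ and $l\ge 1$ let $B^{r,l}$ be the Kirillov–Reshetikhin crystal of type $A^{(1)}_n$: the set of semistandard tableaux of rectangular shape with $r$ rows and $l$ columns and letters $1,\dots,n+1$, with Kashiwara operators $e_i,f_i$ ($0\le i\le n$), where $e_0=\mathrm{pr}^{-1}e_1\,\mathrm{pr}$, $f_0=\mathrm{pr}^{-1}f_1\,\mathrm{pr}$ and $\mathrm{pr}$ is the promotion operator. Let $\mathrm{Aff}(B^{r,l})=\{\zeta^d b\mid b\in B^{r,l},\,d\in\mathbb Z\}$ be its affinization. The combinatorial $R$ is the isomorphism of affine crystals $\mathrm{Aff}(B^{r,l})\otimes \mathrm{Aff}(B^{r',l'})\to \mathrm{Aff}(B^{r',l'})\otimes \mathrm{Aff}(B^{r,l})$ of the form $\zeta^d b\otimes\zeta^{e} c\mapsto \zeta^{e+H}\tilde c\otimes\zeta^{d-H}\tilde b$, $H=H(b\otimes c)$, normalized by $H(u\otimes u')=0$ for the classically highest elements $u\in B^{r,l}$, $u'\in B^{r',l'}$. Let $B=B^{r_1,l_1}\otimes\cdots\otimes B^{r_L,l_L}$ and $p=b_1\otimes\cdots\otimes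 b_L\in B$. Given $1\le a\le n$ and $j\ge 1$, consider the elements $v\in B^{a,j}$ such that $$\zeta^0 v\otimes(\zeta^0b_1\otimes\cdots\otimes\zeta^0b_L)\simeq(\zeta^{d_1}b_1'\otimes\cdots\otimes\zeta^{d_L}b_L')\otimes\zeta^{e}v$$ under the successive application of the combinatorial $R$. If such a $v$ exists and $\zeta^{d_1}b_1'\otimes\cdots\otimes\zeta^{d_L}b_L'$ is the same for all such $v$, put $T^{(a)}_j(p)=b_1'\otimes\cdots\otimes b_L'\in B$ and $E^{(a)}_j(p)=e=-d_1-\cdots-d_L$; otherwise put $T^{(a)}_j(p)=0$. Let $\widetilde W(A^{(1)}_n)=\langle \mathrm{pr},S_0,\dots,S_n\rangle$ be the group of operators on $B$ generated by the promotion operator acting on each component and by the Weyl group operators $S_i$ of the tensor product crystal $B$ ($S_i(p)=f_i^{m}(p)$ if $m=\varphi_i(p)-\varepsilon_i(p)\ge 0$, and $S_i(p)=e_i^{-m}(p)$ if $m\le 0$). **Theorem.** Suppose $T^{(a)}_j(p)\ne 0$. Then for every $w\in\widetilde W(A^{(1)}_n)$, $$wT^{(a)}_j(p)=T^{(a)}_j(w(p))\quad\text{and}\quad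 E^{(a)}_j(w(p))=E^{(a)}_j(p).$$ Moreover, let $\pi(b_1\otimes\cdots\otimes b_L)=b_L\otimes b_1\otimes\cdots\otimes b_{L-1}$, let $R_k$ ($1\le k\le L-1$) be the combinatorial $R$ exchanging the $k$-th and $(k+1)$-st components, and $R_0=\pi^{-1}R_1\pi$ (for $L\ge 2$); these operators act on the states for all orderings of the factors of $B$ and generate the action of $\widetilde W(A^{(1)}_{L-1})=\langle\pi,R_0,\dots,R_{L-1}\rangle$. Then the same two relations hold for all $w\in\widetilde W(A^{(1)}_n)\times\widetilde W(A^{(1)}_{L-1})$. -/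

import Mathlib

namespace PeriodicAutomaton

/-! ### Crystals -/

/-- The data of a (regular) crystal on the set `B` with index set `I`: the Kashiwara operators
`e i`, `f i` (with `none` playing the role of `0`) and the functions `ε i`, `φ i`.
The coefficient of the fundamental weight `Λ_i` in the weight of `b` is `φ i b - ε i b`. -/
structure Crystal (I B : Type) where
  e : I → B → Option B
  f : I → B → Option B
  ε : I → B → ℕ
  φ : I → B → ℕ

/-- The tensor product of two crystals, in Kashiwara's convention. -/
def Crystal.tensor {I A B : Type} (C : Crystal I A) (D : Crystal I B) : Crystal I (A × B) where
  e i x := if D.ε i x.2 ≤ C.φ i x.1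
    then (C.e i x.1).map (fun a => (a, x.2)) else (D.e i x.2).map (fun b => (x.1, b))
  f i x := if D.ε i x.2 < C.φ i x.1
    then (C.f i x.1).map (fun a => (a, x.2)) else (D.f i x.2).map (fun b => (x.1, b))
  ε i x := C.ε i x.1 + (D.ε i x.2 - C.φ i x.1)
  φ i x := D.φ i x.2 + (C.φ i x.1 - D.ε i x.2)

/-- `ε` on `b₁ ⊗ (b₂ ⊗ (⋯ ⊗ b_L))`; the empty tensor product is the trivial crystal. -/
def Crystal.listEps {I B : Type} (C : Crystal I B) (i : I) : List B → ℕ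
  | [] => 0
  | b :: w => C.ε i b + (C.listEps i w - C.φ i b)

/-- `φ` on `b₁ ⊗ (b₂ ⊗ (⋯ ⊗ b_L))`. -/
def Crystal.listPhi {I B : Type} (C : Crystal I B) (i : I) : List B → ℕ
  | [] => 0
  | b :: w => C.listPhi i w + (C.φ i b - C.listEps i w)

/-- `e` on `b₁ ⊗ (b₂ ⊗ (⋯ ⊗ b_L))`. -/
def Crystal.listE {I B : Type} (C : Crystal I B) (i : I) : List B → Option (List B)
  | [] => none
  | b :: w => if C.listEps i w ≤ C.φ i b
      then (C.e i b).map (fun b' => b' :: w) else (C.listE i w).map (fun w' => b :: w')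

/-- `f` on `b₁ ⊗ (b₂ ⊗ (⋯ ⊗ b_L))`. -/
def Crystal.listF {I B : Type} (C : Crystal I B) (i : I) : List B → Option (List B)
  | [] => none
  | b :: w => if C.listEps i w < C.φ i b
      then (C.f i b).map (fun b' => b' :: w) else (C.listF i w).map (fun w' => b :: w')

/-- Words `b₁ ⊗ ⋯ ⊗ b_L` in a crystal: the iterated tensor product (of all lengths). -/
def Crystal.words {I B : Type} (C : Crystal I B) : Crystal I (List B) where
  e := C.listE
  f := C.listF
  ε := C.listEps
  φ := C.listPhi

open Classical in
/-- Transport of a partial operator `F` on `B` along an injection `g : A → B`: the value at `a`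
is the `a'` with `g a' = F (g a)`, and `0` if `F (g a) = 0`. -/
noncomputable def pull {A B : Type} (g : A → B) (F : B → Option B) (a : A) : Option A :=
  if h : ∃ a', F (g a) = some (g a') then some h.choose else none

/-- The crystal structure on `A` for which the injection `g : A → B` is an embedding onto a
subset stable under the Kashiwara operators. -/
noncomputable def Crystal.pullback {I A B : Type} (g : A → B) (C : Crystal I B) :
    Crystal I A where
  e i := pull g (C.e i)
  f i := pull g (C.f i)
  ε i a := C.ε i (g a)
  φ i a := C.φ i (g a)

/-- The affinization: `(d, b)` stands for `ζ^d b`; `e₀` raises and `f₀` lowers the degree `d`. -/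
def Crystal.aff {m : ℕ} {B : Type} (C : Crystal (Fin (m + 1)) B) :
    Crystal (Fin (m + 1)) (ℤ × B) where
  e i x := (C.e i x.2).map (fun b => (x.1 + (if i = 0 then 1 else 0), b))
  f i x := (C.f i x.2).map (fun b => (x.1 - (if i = 0 then 1 else 0), b))
  ε i x := C.ε i x.2
  φ i x := C.φ i x.2

/-! ### Rectangular semistandard tableaux -/

/-- A shape `(r, l)` of a Kirillov-Reshetikhin crystal of type `A_n^{(1)}`. -/
structure Shape (n : ℕ) where
  r : ℕ
  l : ℕ
  one_le_r : 1 ≤ r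
  r_le : r ≤ n
  one_le_l : 1 ≤ l

/-- Semistandard tableaux of rectangular shape with `r` rows and `l` columns. The `n + 1` letters
`1, …, n + 1` are represented by `0, …, n : Fin (n + 1)`; the index `0` of a row or column
is the first one. -/
@[ext]
structure Tab {n : ℕ} (s : Shape n) where
  entry : Fin s.r → Fin s.l → Fin (n + 1)
  row_weak : ∀ i c c', c ≤ c' → entry i c ≤ entry i c'
  col_strict : ∀ i i' c, i < i' → entry i c < entry i' c

/-- The classically highest element: all letters in the `i`-th row are equal to `i`. -/
def Tab.highest {n : ℕ} (s : Shape n) : Tab s where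
  entry i _ := ⟨i, by have := s.r_le; omega⟩
  row_weak _ _ _ _ := le_rfl
  col_strict _ _ _ h := h

/-- `T.count i y` is the number of letters `< y` in row `i` (and `0` below the last row). -/
def Tab.count {n : ℕ} {s : Shape n} (T : Tab s) (i y : ℕ) : ℕ :=
  (Finset.univ.filter fun c : Fin s.l => ∃ h : i < s.r, (T.entry ⟨i, h⟩ c : ℕ) < y).card

theorem Tab.lt_count {n : ℕ} {s : Shape n} (T : Tab s) (i : Fin s.r) (c : Fin s.l) (y : ℕ) :
    (c : ℕ) < T.count i y ↔ (T.entry i c : ℕ) < y := by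
  have key : (Finset.univ.filter fun c : Fin s.l =>
      ∃ h : (i : ℕ) < s.r, (T.entry ⟨i, h⟩ c : ℕ) < y) =
      Finset.univ.filter fun c : Fin s.l => (T.entry i c : ℕ) < y := by
    ext c; simp
  unfold Tab.count
  rw [key]
  constructor
  · intro h
    by_contra hc
    have hsub : (Finset.univ.filter fun c : Fin s.l => (T.entry i c : ℕ) < y) ⊆
        Finset.Iio c := by
      intro d hd
      simp only [Finset.mem_filter, Finset.mem_univ, true_and] at hd
      rw [Finset.mem_Iio]
      by_contra hcd
      have := T.row_weak i c d (not_lt.mp hcd)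
      have : (T.entry i c : ℕ) ≤ T.entry i d := this
      omega
    have := Finset.card_le_card hsub
    rw [Fin.card_Iio] at this
    omega
  · intro h
    have hsub : Finset.Iic c ⊆
        (Finset.univ.filter fun c : Fin s.l => (T.entry i c : ℕ) < y) := by
      intro d hd
      rw [Finset.mem_Iic] at hd
      have : (T.entry i d : ℕ) ≤ T.entry i c := T.row_weak i d c hd
      simp only [Finset.mem_filter, Finset.mem_univ, true_and]
      omega
    have := Finset.card_le_card hsub
    rw [Fin.card_Iic] at this
    omega

theorem Tab.count_le {n : ℕ} {s : Shape n} (T : Tab s) (i y : ℕ) : T.count i y ≤ s.l :=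
  (Finset.card_le_univ _).trans (by simp)

theorem Tab.count_mono {n : ℕ} {s : Shape n} (T : Tab s) (i : ℕ) {y z : ℕ} (h : y ≤ z) :
    T.count i y ≤ T.count i z := by
  unfold Tab.count
  apply Finset.card_le_card
  intro c
  simp only [Finset.mem_filter, Finset.mem_univ, true_and]
  rintro ⟨h1, h2⟩
  exact ⟨h1, by omega⟩

theorem Tab.count_succ_le {n : ℕ} {s : Shape n} (T : Tab s) (i y : ℕ) :
    T.count (i + 1) (y + 1) ≤ T.count i y := by
  unfold Tab.count
  apply Finset.card_le_card
  intro c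
  simp only [Finset.mem_filter, Finset.mem_univ, true_and]
  rintro ⟨h1, h2⟩
  refine ⟨by omega, ?_⟩
  have : (T.entry ⟨i, by omega⟩ c : ℕ) < T.entry ⟨i + 1, h1⟩ c :=
    T.col_strict _ _ c (Fin.mk_lt_mk.2 (Nat.lt_succ_self i))
  omega

/-- Row `i` has the letters `x` and `x + 1` in the columns `count i x ≤ c < count i (x + 2)`;
those which do not belong to a vertical pair (`x` directly above `x + 1`) are called free and
occupy the columns `bkLo ≤ c < bkHi`. -/
def Tab.bkLo {n : ℕ} {s : Shape n} (T : Tab s) (x i : ℕ) : ℕ :=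
  max (T.count i x) (T.count (i + 1) (x + 2))

/-- See `Tab.bkLo`. -/
def Tab.bkHi {n : ℕ} {s : Shape n} (T : Tab s) (x i : ℕ) : ℕ :=
  if i = 0 then T.count i (x + 2) else min (T.count i (x + 2)) (T.count (i - 1) x)

/-- The column where the letters `x + 1` of row `i` start after the numbers of free letters `x`
and `x + 1` in the row have been interchanged. -/
def Tab.bkMid {n : ℕ} {s : Shape n} (T : Tab s) (x i : ℕ) : ℕ :=
  T.bkLo x i + T.bkHi x i - T.count i (x + 1)

theorem Tab.bkLo_le {n : ℕ} {s : Shape n} (T : Tab s) (x i : ℕ) :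
    T.bkLo x i ≤ T.count i (x + 1) :=
  max_le (T.count_mono i (by omega)) (T.count_succ_le i (x + 1))

theorem Tab.le_bkHi {n : ℕ} {s : Shape n} (T : Tab s) (x i : ℕ) :
    T.count i (x + 1) ≤ T.bkHi x i := by
  unfold Tab.bkHi
  split_ifs with h
  · exact T.count_mono i (by omega)
  · obtain ⟨k, rfl⟩ : ∃ k, i = k + 1 := ⟨i - 1, by omega⟩
    exact le_min (T.count_mono _ (by omega)) (T.count_succ_le k x)

/-- The Bender-Knuth involution for the letters `x`, `x + 1`: in every row, the free letters
`x^p (x+1)^q` are replaced by `x^q (x+1)^p`. -/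
def Tab.bk {n : ℕ} {s : Shape n} (x : Fin n) (T : Tab s) : Tab s where
  entry i c :=
    if T.entry i c = x.castSucc ∨ T.entry i c = x.succ then
      if (c : ℕ) < T.bkMid x i then x.castSucc else x.succ
    else T.entry i c
  row_weak i c c' h := by
    have h0 : (T.entry i c : ℕ) ≤ T.entry i c' := T.row_weak i c c' h
    have h1 : (c : ℕ) ≤ c' := h
    simp only [Fin.le_def, Fin.ext_iff, Fin.val_castSucc, Fin.val_succ]
    split_ifs <;> (try simp only [Fin.val_castSucc, Fin.val_succ]) <;> omega
  col_strict i i' c h := by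
    have h0 : (T.entry i c : ℕ) < T.entry i' c := T.col_strict i i' c h
    have h1 : (i : ℕ) < i' := h
    simp only [Fin.lt_def, Fin.ext_iff, Fin.val_castSucc, Fin.val_succ]
    by_cases hA : (T.entry i c : ℕ) = x ∨ (T.entry i c : ℕ) = x + 1
    · by_cases hB : (T.entry i' c : ℕ) = x ∨ (T.entry i' c : ℕ) = x + 1
      · have hx : (T.entry i c : ℕ) = x := by omega
        have hx' : (T.entry i' c : ℕ) = x + 1 := by omega
        have hii : (i' : ℕ) = i + 1 := by
          by_contra hne
          have hlt : (i : ℕ) + 1 < s.r := by have := i'.2; omega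
          have a1 : (T.entry i c : ℕ) < T.entry ⟨i + 1, hlt⟩ c :=
            T.col_strict i ⟨i + 1, hlt⟩ c (Nat.lt_succ_self (i : ℕ))
          have a2 : (T.entry ⟨i + 1, hlt⟩ c : ℕ) < T.entry i' c :=
            T.col_strict ⟨i + 1, hlt⟩ i' c (by simp only [Fin.lt_def]; omega)
          omega
        have b1 : (c : ℕ) < T.bkMid x i := by
          have e1 : (c : ℕ) < T.count i' (x + 2) := (T.lt_count i' c _).2 (by omega)
          have e2 : T.count i' (x + 2) ≤ T.bkLo x i := by
            rw [hii]; exact le_max_right _ _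
          have e3 := T.le_bkHi x i
          unfold Tab.bkMid
          omega
        have b2 : ¬ (c : ℕ) < T.bkMid x i' := by
          have e1 : ¬ (c : ℕ) < T.count i x := fun hh => by
            have := (T.lt_count i c _).1 hh
            omega
          have e2 : T.bkHi x i' ≤ T.count i x := by
            unfold Tab.bkHi
            rw [hii, if_neg (by omega)]
            exact min_le_right _ _
          have e3 := T.bkLo_le x i'
          unfold Tab.bkMid
          omega
        rw [if_pos hA, if_pos hB, if_pos b1, if_neg b2]
        simp
      · rw [if_pos hA, if_neg hB]
        split_ifs <;> simp only [Fin.val_castSucc, Fin.val_succ] <;> omega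
    · rw [if_neg hA]
      split_ifs <;> (try simp only [Fin.val_castSucc, Fin.val_succ]) <;> omega

theorem Tab.count_eq {n : ℕ} {s : Shape n} (T : Tab s) (i : Fin s.r) (y m : ℕ) (hm : m ≤ s.l)
    (h : ∀ c : Fin s.l, (c : ℕ) < m ↔ (T.entry i c : ℕ) < y) : T.count i y = m := by
  have h' : ∀ c : Fin s.l, (c : ℕ) < m ↔ (c : ℕ) < T.count i y := fun c =>
    (h c).trans (T.lt_count i c y).symm
  have hl := T.count_le i y
  rcases lt_trichotomy (T.count i y) m with hlt | heq | hlt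
  · have := (h' ⟨T.count i y, by omega⟩).1 hlt
    simp at this
  · exact heq
  · have := (h' ⟨m, by omega⟩).2 hlt
    simp at this

theorem Tab.bkMid_le {n : ℕ} {s : Shape n} (T : Tab s) (x i : ℕ) : T.bkMid x i ≤ T.bkHi x i := by
  have := T.bkLo_le x i
  unfold Tab.bkMid
  omega

theorem Tab.bkLo_le_bkMid {n : ℕ} {s : Shape n} (T : Tab s) (x i : ℕ) :
    T.bkLo x i ≤ T.bkMid x i := by
  have := T.le_bkHi x i
  unfold Tab.bkMid
  omega

theorem Tab.bkHi_le {n : ℕ} {s : Shape n} (T : Tab s) (x i : ℕ) :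
    T.bkHi x i ≤ T.count i (x + 2) := by
  unfold Tab.bkHi
  split_ifs
  · exact le_rfl
  · exact min_le_left _ _

theorem Tab.le_bkLo {n : ℕ} {s : Shape n} (T : Tab s) (x i : ℕ) :
    T.count i x ≤ T.bkLo x i := le_max_left _ _

theorem Tab.bk_entry_val {n : ℕ} {s : Shape n} (x : Fin n) (T : Tab s) (i : Fin s.r)
    (c : Fin s.l) : ((T.bk x).entry i c : ℕ) =
      if (T.entry i c : ℕ) = x ∨ (T.entry i c : ℕ) = x + 1 then
        if (c : ℕ) < T.bkMid x i then (x : ℕ) else x + 1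
      else (T.entry i c : ℕ) := by
  simp only [Tab.bk, Fin.ext_iff, Fin.val_castSucc, Fin.val_succ]
  split_ifs <;> rfl

theorem Tab.count_bk_ne {n : ℕ} {s : Shape n} (x : Fin n) (T : Tab s) (i y : ℕ)
    (hy : y ≠ x + 1) : (T.bk x).count i y = T.count i y := by
  unfold Tab.count
  congr 1
  ext c
  simp only [Finset.mem_filter, Finset.mem_univ, true_and]
  apply exists_congr
  intro h
  rw [Tab.bk_entry_val]
  split_ifs <;> omega

theorem Tab.count_bk_mid {n : ℕ} {s : Shape n} (x : Fin n) (T : Tab s) (i : Fin s.r) :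
    (T.bk x).count i (x + 1) = T.bkMid x i := by
  have h1 := T.bkMid_le x i
  have h2 := T.bkHi_le x i
  have h3 := T.count_le i (x + 2)
  have h4 := T.bkLo_le_bkMid x i
  have h5 := T.le_bkLo x i
  apply Tab.count_eq _ _ _ _ (by omega)
  intro c
  have k1 := T.lt_count i c x
  have k2 := T.lt_count i c (x + 2)
  rw [Tab.bk_entry_val]
  split_ifs <;> omega

theorem Tab.bk_bk {n : ℕ} {s : Shape n} (x : Fin n) (T : Tab s) : (T.bk x).bk x = T := by
  have hlo : ∀ i, (T.bk x).bkLo x i = T.bkLo x i := fun i => by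
    unfold Tab.bkLo
    rw [Tab.count_bk_ne _ _ _ _ (by omega), Tab.count_bk_ne _ _ _ _ (by omega)]
  have hhi : ∀ i, (T.bk x).bkHi x i = T.bkHi x i := fun i => by
    unfold Tab.bkHi
    rw [Tab.count_bk_ne _ _ _ _ (by omega), Tab.count_bk_ne _ _ _ _ (by omega)]
  ext i c
  have hmid : (T.bk x).bkMid x i = T.count i (x + 1) := by
    have h1 := T.bkLo_le x i
    have h2 := T.le_bkHi x i
    unfold Tab.bkMid
    rw [hlo, hhi, Tab.count_bk_mid]
    unfold Tab.bkMid
    omega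
  have k := T.lt_count i c (x + 1)
  rw [Tab.bk_entry_val, hmid, Tab.bk_entry_val]
  split_ifs <;> omega

/-- The Bender-Knuth involution as a permutation. -/
def Tab.bkPerm {n : ℕ} (s : Shape n) (x : Fin n) : Equiv.Perm (Tab s) where
  toFun := Tab.bk x
  invFun := Tab.bk x
  left_inv := Tab.bk_bk x
  right_inv := Tab.bk_bk x

/-- Schützenberger's promotion: the letters `n + 1` are removed, the resulting holes are moved
to the north-west by jeu de taquin, all letters are increased by one and the holes are filled
with `1`. Here the holes are moved past the letters `n`, `n - 1`, …, `1`, one letter at a time: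
moving a horizontal strip of holes (written as `x + 1`) past the letters `x`, writing the holes
as `x` and the letters as `x + 1` afterwards, is the Bender-Knuth involution for `x`, `x + 1`.
So promotion is the composite `t_1 t_2 ⋯ t_n` of these involutions, with `t_n` applied first. -/
def Tab.pr {n : ℕ} (s : Shape n) : Equiv.Perm (Tab s) :=
  ((List.finRange n).map (Tab.bkPerm s)).prod

/-! ### Kirillov-Reshetikhin crystals -/

/-- The crystal of the vector representation: arrows `f_i : i → i + 1`, for `i = 1, …, n`
(that is `i - 1 → i` in terms of `Fin (n + 1)`). -/
def letters (n : ℕ) : Crystal (Fin (n + 1)) (Fin (n + 1)) where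
  e i x := if x = i then some (i - 1) else none
  f i x := if x + 1 = i then some i else none
  ε i x := if x = i then 1 else 0
  φ i x := if x + 1 = i then 1 else 0

/-- The (far-eastern) reading word: the columns are read from right to left, each one
from top to bottom. -/
def Tab.word {n : ℕ} {s : Shape n} (T : Tab s) : List (Fin (n + 1)) :=
  (List.finRange s.l).reverse.flatMap fun c => (List.finRange s.r).map fun i => T.entry i c

/-- The Kashiwara-Nakashima crystal structure on semistandard tableaux, for `i ≠ 0`:
tableaux are embedded into words by the reading word. (Its values at `i = 0` are not used.) -/
noncomputable def classical {n : ℕ} (s : Shape n) : Crystal (Fin (n + 1)) (Tab s) :=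
  (letters n).words.pullback Tab.word

/-- The crystal `B^{r,l}` of type `A_n^{(1)}`: the classical structure for `i ≠ 0`, and
`e₀ = pr⁻¹ e₁ pr`, `f₀ = pr⁻¹ f₁ pr`. -/
noncomputable def kr {n : ℕ} (s : Shape n) : Crystal (Fin (n + 1)) (Tab s) where
  e i T := if i = 0 then ((classical s).e 1 (Tab.pr s T)).map (Tab.pr s).symm
    else (classical s).e i T
  f i T := if i = 0 then ((classical s).f 1 (Tab.pr s T)).map (Tab.pr s).symm
    else (classical s).f i T
  ε i T := if i = 0 then (classical s).ε 1 (Tab.pr s T) else (classical s).ε i T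
  φ i T := if i = 0 then (classical s).φ 1 (Tab.pr s T) else (classical s).φ i T

/-! ### The combinatorial R -/

/-- The map `ζ^d b ⊗ ζ^e c ↦ ζ^(e + H) c̃ ⊗ ζ^(d - H) b̃` where `H = H (b ⊗ c)` and
`σ (b ⊗ c) = c̃ ⊗ b̃`. -/
def affMap {A B : Type} (σ : A × B → B × A) (H : A × B → ℤ)
    (x : (ℤ × A) × (ℤ × B)) : (ℤ × B) × (ℤ × A) :=
  ((x.2.1 + H (x.1.2, x.2.2), (σ (x.1.2, x.2.2)).1),
    (x.1.1 - H (x.1.2, x.2.2), (σ (x.1.2, x.2.2)).2))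

/-- A combinatorial `R` with its energy function: an isomorphism of affine crystals
`Aff(B^{r,l}) ⊗ Aff(B^{r',l'}) → Aff(B^{r',l'}) ⊗ Aff(B^{r,l})` of the form `affMap σ H`, with
`H` normalized to be `0` (which is its maximum) at the tensor product of the
classically highest elements. The weights are preserved as well: the coefficient of `Λ_i` is
`φ_i - ε_i`, and the coefficient of the null root `δ` is the total degree in `ζ`.
Such an isomorphism exists and is unique, since `B^{r,l} ⊗ B^{r',l'}` is connected. -/
structure CombinatorialR {n : ℕ} (s t : Shape n) where
  σ : Tab s × Tab t ≃ Tab t × Tab s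
  H : Tab s × Tab t → ℤ
  map_e : ∀ i x, ((kr t).aff.tensor (kr s).aff).e i (affMap σ H x) =
    (((kr s).aff.tensor (kr t).aff).e i x).map (affMap σ H)
  map_f : ∀ i x, ((kr t).aff.tensor (kr s).aff).f i (affMap σ H x) =
    (((kr s).aff.tensor (kr t).aff).f i x).map (affMap σ H)
  map_ε : ∀ i x, ((kr t).aff.tensor (kr s).aff).ε i (affMap σ H x) =
    ((kr s).aff.tensor (kr t).aff).ε i x
  map_φ : ∀ i x, ((kr t).aff.tensor (kr s).aff).φ i (affMap σ H x) =
    ((kr s).aff.tensor (kr t).aff).φ i x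
  H_highest : H (Tab.highest s, Tab.highest t) = 0

/-- Elements of all the crystals `B^{r,l}`: a shape together with a tableau of this shape. -/
abbrev KR (n : ℕ) : Type := Σ s : Shape n, Tab s

/-- `IsR b c h c' b'` says that `c' ⊗ b'` is the image of `b ⊗ c` under the combinatorial `R`
and that `h = H (b ⊗ c)`. -/
def IsR {n : ℕ} (b c : KR n) (h : ℤ) (c' b' : KR n) : Prop :=
  ∃ R : CombinatorialR b.1 c.1, h = R.H (b.2, c.2) ∧
    c' = ⟨c.1, (R.σ (b.2, c.2)).1⟩ ∧ b' = ⟨b.1, (R.σ (b.2, c.2)).2⟩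

/-! ### States and time evolutions -/

/-- States `p = b₁ ⊗ ⋯ ⊗ b_L` in `B^{r₁,l₁} ⊗ ⋯ ⊗ B^{r_L,l_L}`, for all choices of the shapes
`(r_i, l_i)`. -/
abbrev State (n L : ℕ) : Type := Fin L → KR n

/-- There is `v = v₀ ∈ B^{r,l}`, `(r, l) = s`, such that
`ζ^0 v ⊗ p ≃ (ζ^{d₁} b'₁ ⊗ ⋯ ⊗ ζ^{d_L} b'_L) ⊗ ζ^e v`, where `q i = (d_i, b'_i)`. The isomorphism
is the composite of the combinatorial `R`s
`ζ^a v_{i-1} ⊗ ζ^0 b_i ↦ ζ^{d_i} b'_i ⊗ ζ^{a - d_i} v_i`, `d_i = H (v_{i-1} ⊗ b_i)`, so that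
`e = - d₁ - ⋯ - d_L`. -/
def Evolves {n L : ℕ} (s : Shape n) (p : State n L) (q : Fin L → ℤ × KR n) : Prop :=
  ∃ v : Fin (L + 1) → Tab s, v 0 = v (Fin.last L) ∧
    ∀ i : Fin L, IsR ⟨s, v i.castSucc⟩ (p i) (q i).1 (q i).2 ⟨s, v i.succ⟩

open Classical in
/-- The element `ζ^{d₁} b'₁ ⊗ ⋯ ⊗ ζ^{d_L} b'_L` if it exists and is unique, that is if `p` is
`(r, l)`-evolvable, and `none` otherwise. -/
noncomputable def evolution {n L : ℕ} (s : Shape n) (p : State n L) :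
    Option (Fin L → ℤ × KR n) :=
  if h : ∃! q, Evolves s p q then some h.choose else none

/-- The time evolution `T^{(r)}_l`, `(r, l) = s`; `none` stands for `0`. -/
noncomputable def T {n L : ℕ} (s : Shape n) (p : State n L) : Option (State n L) :=
  (evolution s p).map fun q i => (q i).2

/-- The conserved quantity `E^{(r)}_l = - d₁ - ⋯ - d_L`, `(r, l) = s`, defined (that is,
different from `none`) on the `(r, l)`-evolvable states. -/
noncomputable def E {n L : ℕ} (s : Shape n) (p : State n L) : Option ℤ :=
  (evolution s p).map fun q => -∑ i, (q i).1

/-! ### The extended affine Weyl groups -/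

/-- The crystal `⊔ B^{r,l}` of all elements. -/
noncomputable def krAll (n : ℕ) : Crystal (Fin (n + 1)) (KR n) where
  e i b := ((kr b.1).e i b.2).map (Sigma.mk b.1)
  f i b := ((kr b.1).f i b.2).map (Sigma.mk b.1)
  ε i b := (kr b.1).ε i b.2
  φ i b := (kr b.1).φ i b.2

/-- The crystal of states: the tensor product `b₁ ⊗ ⋯ ⊗ b_L`. -/
noncomputable def states (n L : ℕ) : Crystal (Fin (n + 1)) (State n L) :=
  (krAll n).words.pullback List.ofFn

/-- The Weyl group operator `S_i`: the reflection of the `i`-strings, `S_i b = f_i^m b` if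
`m = φ_i(b) - ε_i(b) ≥ 0` and `S_i b = e_i^{-m} b` if `m ≤ 0`. -/
def Crystal.reflect {I B : Type} (C : Crystal I B) (i : I) (b : B) : Option B :=
  if C.ε i b ≤ C.φ i b
  then (fun x => x.bind (C.f i))^[C.φ i b - C.ε i b] (some b)
  else (fun x => x.bind (C.e i))^[C.ε i b - C.φ i b] (some b)

/-- The promotion operator acting on states component-wise. -/
def prState (n L : ℕ) : Equiv.Perm (State n L) :=
  Equiv.piCongrRight fun _ => Equiv.sigmaCongrRight Tab.pr

/-- The cyclic shift `π (b₁ ⊗ ⋯ ⊗ b_L) = b_L ⊗ b₁ ⊗ ⋯ ⊗ b_{L-1}`. -/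
def cyclicShift (n L : ℕ) : Equiv.Perm (State n L) :=
  (finRotate L).arrowCongr (Equiv.refl (KR n))

/-- `g` is the Weyl group operator `S_i` on states. -/
def IsWeylOperator {n L : ℕ} (i : Fin (n + 1)) (g : Equiv.Perm (State n L)) : Prop :=
  ∀ p, (states n L).reflect i p = some (g p)

/-- `g` is the combinatorial `R` that exchanges the neighbouring components `j`, `k = j + 1`. -/
def IsExchange {n L : ℕ} (j k : Fin L) (g : Equiv.Perm (State n L)) : Prop :=
  (k : ℕ) = j + 1 ∧ ∀ p, (∃ h, IsR (p j) (p k) h (g p j) (g p k)) ∧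
    ∀ i, i ≠ j → i ≠ k → g p i = p i

/-- The group `⟨pr, S_0, …, S_n⟩` of operators on states: the action of `W̃(A_n^{(1)})`. -/
def affineWeyl (n L : ℕ) : Subgroup (Equiv.Perm (State n L)) :=
  Subgroup.closure ({prState n L} ∪ {g | ∃ i, IsWeylOperator i g})

/-- The group `⟨π, R_0, R_1, …, R_{L-1}⟩`, `R_0 = π⁻¹ R_1 π`, of operators on states: the action
of `W̃(A_{L-1}^{(1)})`. -/
def exchangeWeyl (n L : ℕ) : Subgroup (Equiv.Perm (State n L)) :=
  Subgroup.closure ({cyclicShift n L} ∪ {g | ∃ j k, IsExchange j k g} ∪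
    {g | ∃ g₁, ∃ j k : Fin L, (j : ℕ) = 0 ∧ IsExchange j k g₁ ∧
      g = (cyclicShift n L)⁻¹ * g₁ * cyclicShift n L})

end PeriodicAutomaton

/-!
An operator `g` on states commutes with the time evolution and preserves the conserved quantity as
soon as the possible results `q` of the evolution of `p` can be mapped injectively to possible
results for `g p`, by maps which act as `g` on the tableaux and preserve the sum of the degrees,
and the same holds for `g⁻¹` (`Lifts`, `commutes_of_lifts`): then the result is unique for `p` if
and only if it is unique for `g p`. Operators with this property form a group, so it suffices to
treat the generators. Existence and uniqueness of the combinatorial R are never used; only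
inverses, conjugates and the Yang-Baxter equation are needed for the given ones.

* The cyclic shift only renames the components of the closed chain of carriers (`evolves_iff`).
* For an exchange of neighbours, apply the inverse of R and the Yang-Baxter equation to the
  carrier and the two components (`IsExchange.lifts`). Both sides of the Yang-Baxter equation are
  morphisms of crystals which agree above the tensor product of the three highest elements. So
  they agree everywhere, because a triple tensor product of Kirillov-Reshetikhin crystals is
  connected (`conn_highest`).
* Promotion rotates the affine Dynkin diagram (`kr_e_pr`). Conjugating a combinatorial R by it
  gives a combinatorial R, up to a change of degrees by numbers of letters (`isR_pr_iff`). The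
  changes of degree along a closed chain add up to zero (`sum_size_last`).
* For `S_i`, a chain of combinatorial R is a correspondence between `v ⊗ w` and `w' ⊗ v'` which is
  compatible with the Kashiwara operators (`chainR_isSim`). Since the carriers `v` and `v'` at
  both ends are the same tableau, a suitable power of `f_i` or `e_i` acts as `S_i` on `w` and on
  `w'`, and as the same power on both carriers, so that the chain stays closed (`IsSim.reflect`,
  `evolves_reflect`).

The work with tableaux is done in terms of Gelfand-Tsetlin patterns, that is with the numbers
`T.count k y`. The Kashiwara operator `e_{x+1}` changes one entry of the pattern, in the row where
the heights of the bracketing are maximal for the first time (`Step`), and a Bender-Knuth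
involution is a piecewise linear toggle of one row of the pattern. Promotion is a composite of
such toggles, and a computation with pairs of neighbouring toggles gives `pr e_i = e_{i+1} pr` for
`1 ≤ i < n`. The missing relation is `e_1 pr² = pr² e_n` (`kr_e_pr_pr_last`). It follows from two
descriptions of `pr² T`: its letters `≥ 2` depend only on the letters `< n - 1` of `T`, and the
shape of its letters `0`, `1` is the complement of the shape of the letters `< n - 1` of `T`.
Since `pr²` intertwines `e_1, …, e_{n-2}` with `e_3, …, e_n`, and neither of these shapes is
changed by the operators in question, both have to be checked only where `e_1, …, e_{n-2}` vanish
on `T`; such tableaux and their images under `pr²` are determined by few numbers.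

Connectedness comes from sweeps: applying `e_i^max` for the letters `i` of a fixed word takes
every tableau to the highest one (`Tab.eMaxList_eq_highest`). On a tensor product, such a sweep
acts factor by factor as long as `φ_i` of the first factor vanishes whenever `e_i^max` is applied,
which is the case for tableaux of extremal weight such as the lowest one. With the rotations of
the Dynkin diagram by promotion, this takes every element of a triple tensor product to the
product of the highest elements.
-/

namespace PeriodicAutomaton

/-! ### Regular crystals -/

/-- The axioms of a (semi-)regular crystal: `e i` and `f i` are mutually inverse partial maps,
and `ε i`, `φ i` count how often they can be applied. -/
structure Crystal.Regular {I B : Type} (C : Crystal I B) : Prop where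
  e_iff : ∀ i b b', C.e i b = some b' ↔ C.f i b' = some b
  ε_of_e : ∀ i b b', C.e i b = some b' → C.ε i b = C.ε i b' + 1
  φ_of_e : ∀ i b b', C.e i b = some b' → C.φ i b' = C.φ i b + 1
  exists_e : ∀ i b, 0 < C.ε i b → ∃ b', C.e i b = some b'
  exists_f : ∀ i b, 0 < C.φ i b → ∃ b', C.f i b = some b'

theorem map_mk_left {A B : Type} {o : Option A} {y y' : B} {a : A} :
    o.map (fun x => (x, y)) = some (a, y') ↔ o = some a ∧ y = y' := by
  cases o <;> simp

theorem map_mk_right {A B : Type} {o : Option B} {x x' : A} {b : B} :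
    o.map (fun y => (x, y)) = some (x', b) ↔ o = some b ∧ x = x' := by
  cases o <;> simp [and_comm]

theorem map_cons_left {B : Type} {o : Option B} {w w' : List B} {b : B} :
    o.map (fun x => x :: w) = some (b :: w') ↔ o = some b ∧ w = w' := by
  cases o <;> simp

theorem map_cons_right {B : Type} {o : Option (List B)} {w' : List B} {b b' : B} :
    o.map (fun w => b :: w) = some (b' :: w') ↔ o = some w' ∧ b = b' := by
  cases o <;> simp [and_comm]

namespace Crystal

variable {I A B : Type}

theorem Regular.e_none {C : Crystal I B} (h : C.Regular) {i : I} {b : B} :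
    C.e i b = none ↔ C.ε i b = 0 := by
  constructor
  · intro h0
    by_contra h1
    obtain ⟨b', hb⟩ := h.exists_e i b (by omega)
    simp [h0] at hb
  · intro h0
    cases hb : C.e i b with
    | none => rfl
    | some b' => have := h.ε_of_e i b b' hb; omega

theorem Regular.f_none {C : Crystal I B} (h : C.Regular) {i : I} {b : B} :
    C.f i b = none ↔ C.φ i b = 0 := by
  constructor
  · intro h0
    by_contra h1
    obtain ⟨b', hb⟩ := h.exists_f i b (by omega)
    simp [h0] at hb
  · intro h0
    cases hb : C.f i b with
    | none => rfl
    | some b' => have := h.φ_of_e i b' b ((h.e_iff i b' b).2 hb); omega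

theorem Regular.tensor {C : Crystal I A} {D : Crystal I B} (hC : C.Regular) (hD : D.Regular) :
    (C.tensor D).Regular where
  e_iff i b b' := by
    obtain ⟨a, b⟩ := b
    obtain ⟨a', b'⟩ := b'
    have h1 := hC.e_iff i a a'
    have h2 := hD.e_iff i b b'
    have h3 := hC.φ_of_e i a a'
    have h4 := hD.ε_of_e i b b'
    simp only [Crystal.tensor]
    split_ifs with c1 c2 c2 <;>
      simp only [map_mk_left, map_mk_right]
    · constructor
      · rintro ⟨h, rfl⟩; exact ⟨h1.1 h, rfl⟩
      · rintro ⟨h, rfl⟩; exact ⟨h1.2 h, rfl⟩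
    · constructor
      · rintro ⟨h, rfl⟩; have := h3 h; omega
      · rintro ⟨h, rfl⟩; have := h4 (h2.2 h); omega
    · constructor
      · rintro ⟨h, rfl⟩; have := h4 h; omega
      · rintro ⟨h, rfl⟩; have := h3 (h1.2 h); omega
    · constructor
      · rintro ⟨h, rfl⟩; exact ⟨h2.1 h, rfl⟩
      · rintro ⟨h, rfl⟩; exact ⟨h2.2 h, rfl⟩
  ε_of_e i b b' := by
    obtain ⟨a, b⟩ := b
    obtain ⟨a', b'⟩ := b'
    have h1 := hC.ε_of_e i a a'
    have h2 := hD.ε_of_e i b b'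
    have h3 := hC.φ_of_e i a a'
    simp only [Crystal.tensor]
    split_ifs with c1 <;>
      simp only [map_mk_left, map_mk_right]
    · rintro ⟨h, rfl⟩; have := h1 h; have := h3 h; omega
    · rintro ⟨h, rfl⟩; have := h2 h; omega
  φ_of_e i b b' := by
    obtain ⟨a, b⟩ := b
    obtain ⟨a', b'⟩ := b'
    have h1 := hC.φ_of_e i a a'
    have h2 := hD.ε_of_e i b b'
    have h3 := hD.φ_of_e i b b'
    simp only [Crystal.tensor]
    split_ifs with c1 <;>
      simp only [map_mk_left, map_mk_right]
    · rintro ⟨h, rfl⟩; have := h1 h; omega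
    · rintro ⟨h, rfl⟩; have := h2 h; have := h3 h; omega
  exists_e i b hb := by
    obtain ⟨a, b⟩ := b
    simp only [Crystal.tensor] at hb ⊢
    split_ifs with c1
    · obtain ⟨a', h⟩ := hC.exists_e i a (by omega)
      simp [h]
    · obtain ⟨b', h⟩ := hD.exists_e i b (by omega)
      simp [h]
  exists_f i b hb := by
    obtain ⟨a, b⟩ := b
    simp only [Crystal.tensor] at hb ⊢
    split_ifs with c1
    · obtain ⟨a', h⟩ := hC.exists_f i a (by omega)
      simp [h]
    · obtain ⟨b', h⟩ := hD.exists_f i b (by omega)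
      simp [h]

theorem Regular.words {C : Crystal I B} (hC : C.Regular) : C.words.Regular := by
  -- On `b :: w` the operators are those of `C ⊗ C.words`, so this is the tensor product lemma.
  have key : ∀ (i : I) (w : List B),
      (∀ w', C.listE i w = some w' ↔ C.listF i w' = some w) ∧
      (∀ w', C.listE i w = some w' →
        C.listEps i w = C.listEps i w' + 1 ∧ C.listPhi i w' = C.listPhi i w + 1) ∧
      (0 < C.listEps i w → ∃ w', C.listE i w = some w') ∧
      (0 < C.listPhi i w → ∃ w', C.listF i w = some w') := by
    intro i w
    induction w with
    | nil =>
      refine ⟨?_, by simp [listE], by simp [listEps], by simp [listPhi]⟩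
      intro w'
      cases w' with
      | nil => simp [listE, listF]
      | cons b' w' =>
        simp only [listE, listF]
        split_ifs <;> simp
    | cons b w ih =>
      obtain ⟨i1, i2, i3, i4⟩ := ih
      refine ⟨?_, ?_, ?_, ?_⟩
      · intro w'
        cases w' with
        | nil =>
          simp only [listE, listF]
          split_ifs <;> simp
        | cons b' w' =>
          have h1 := hC.e_iff i b b'
          have h2 := i1 w'
          have h3 := hC.φ_of_e i b b'
          have h4 := i2 w'
          simp only [listE, listF]
          split_ifs with c1 c2 c2 <;>
            simp only [map_cons_left, map_cons_right]
          · constructor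
            · rintro ⟨h, rfl⟩; exact ⟨h1.1 h, rfl⟩
            · rintro ⟨h, rfl⟩; exact ⟨h1.2 h, rfl⟩
          · constructor
            · rintro ⟨h, rfl⟩; have := h3 h; omega
            · rintro ⟨h, rfl⟩; have := h4 (h2.2 h); omega
          · constructor
            · rintro ⟨h, rfl⟩; have := h4 h; omega
            · rintro ⟨h, rfl⟩; have := h3 (h1.2 h); omega
          · constructor
            · rintro ⟨h, rfl⟩; exact ⟨h2.1 h, rfl⟩
            · rintro ⟨h, rfl⟩; exact ⟨h2.2 h, rfl⟩
      · intro w'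
        simp only [listE]
        split_ifs with c1 <;> simp only [Option.map_eq_some_iff]
        · rintro ⟨b', h, rfl⟩
          have h1 := hC.ε_of_e i b b' h
          have h2 := hC.φ_of_e i b b' h
          simp only [listEps, listPhi]; omega
        · rintro ⟨b', h, rfl⟩
          have h1 := i2 _ h
          simp only [listEps, listPhi]; omega
      · intro hb
        simp only [listE, listEps] at hb ⊢
        split_ifs with c1
        · obtain ⟨a', h⟩ := hC.exists_e i b (by omega)
          simp [h]
        · obtain ⟨b', h⟩ := i3 (by omega)
          simp [h]
      · intro hb
        simp only [listF, listPhi] at hb ⊢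
        split_ifs with c1
        · obtain ⟨a', h⟩ := hC.exists_f i b (by omega)
          simp [h]
        · obtain ⟨b', h⟩ := i4 (by omega)
          simp [h]
  exact
    { e_iff := fun i b b' => (key i b).1 b'
      ε_of_e := fun i b b' h => ((key i b).2.1 b' h).1
      φ_of_e := fun i b b' h => ((key i b).2.1 b' h).2
      exists_e := fun i b => (key i b).2.2.1
      exists_f := fun i b => (key i b).2.2.2 }

theorem Regular.aff {m : ℕ} {C : Crystal (Fin (m + 1)) B} (hC : C.Regular) : C.aff.Regular where
  e_iff i b b' := by
    obtain ⟨d, b⟩ := b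
    obtain ⟨d', b'⟩ := b'
    simp only [Crystal.aff, Option.map_eq_some_iff, Prod.mk.injEq]
    constructor
    · rintro ⟨a, h, rfl, rfl⟩; exact ⟨b, (hC.e_iff i b a).1 h, by omega, rfl⟩
    · rintro ⟨a, h, rfl, rfl⟩; exact ⟨b', (hC.e_iff i a b').2 h, by omega, rfl⟩
  ε_of_e i b b' := by
    simp only [Crystal.aff, Option.map_eq_some_iff]
    rintro ⟨a, h, rfl⟩
    exact hC.ε_of_e i _ _ h
  φ_of_e i b b' := by
    simp only [Crystal.aff, Option.map_eq_some_iff]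
    rintro ⟨a, h, rfl⟩
    exact hC.φ_of_e i _ _ h
  exists_e i b hb := by
    obtain ⟨b', h⟩ := hC.exists_e i b.2 hb
    simp [Crystal.aff, h]
  exists_f i b hb := by
    obtain ⟨b', h⟩ := hC.exists_f i b.2 hb
    simp [Crystal.aff, h]

theorem pull_eq_some {g : A → B} (hg : Function.Injective g) {F : B → Option B} {a a' : A} :
    pull g F a = some a' ↔ F (g a) = some (g a') := by
  unfold pull
  split_ifs with h
  · have := h.choose_spec
    constructor
    · intro h1
      simp only [Option.some.injEq] at h1
      rw [← h1]; exact this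
    · intro h1
      rw [this, Option.some.injEq] at h1
      rw [hg h1]
  · simp only [false_iff]
    exact fun h1 => h ⟨a', h1⟩

/-- A pulled back crystal is regular if the image is stable under the operators. -/
theorem Regular.pullback {C : Crystal I B} (hC : C.Regular) {g : A → B}
    (hg : Function.Injective g)
    (he : ∀ i a b, C.e i (g a) = some b → b ∈ Set.range g)
    (hf : ∀ i a b, C.f i (g a) = some b → b ∈ Set.range g) :
    (C.pullback g).Regular where
  e_iff i a a' := by
    simp only [Crystal.pullback, pull_eq_some hg]
    exact hC.e_iff i _ _
  ε_of_e i a a' := by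
    simp only [Crystal.pullback, pull_eq_some hg]
    exact hC.ε_of_e i _ _
  φ_of_e i a a' := by
    simp only [Crystal.pullback, pull_eq_some hg]
    exact hC.φ_of_e i _ _
  exists_e i a h := by
    obtain ⟨b, hb⟩ := hC.exists_e i (g a) h
    obtain ⟨a', rfl⟩ := he i a b hb
    exact ⟨a', (pull_eq_some hg).2 hb⟩
  exists_f i a h := by
    obtain ⟨b, hb⟩ := hC.exists_f i (g a) h
    obtain ⟨a', rfl⟩ := hf i a b hb
    exact ⟨a', (pull_eq_some hg).2 hb⟩

theorem listEps_append (C : Crystal I B) (i : I) (u v : List B) :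
    C.listEps i (u ++ v) = C.listEps i u + (C.listEps i v - C.listPhi i u) ∧
    C.listPhi i (u ++ v) = C.listPhi i v + (C.listPhi i u - C.listEps i v) := by
  induction u with
  | nil => simp [listEps, listPhi]
  | cons b u ih =>
    obtain ⟨h1, h2⟩ := ih
    simp only [List.cons_append, listEps, listPhi, h1, h2]
    omega

theorem Regular.listE_append {C : Crystal I B} (hC : C.Regular) (i : I) (u v : List B) :
    C.listE i (u ++ v) = if C.listEps i v ≤ C.listPhi i u then
      (C.listE i u).map (· ++ v) else (C.listE i v).map (u ++ ·) := by
  induction u with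
  | nil =>
    by_cases h : C.listEps i v = 0
    · have h1 : C.listE i v = none := hC.words.e_none.2 h
      simp [listE, listPhi, h, h1]
    · simp [listPhi, h]
  | cons b u ih =>
    have h1 := (C.listEps_append i u v).1
    simp only [List.cons_append, listE, listPhi, ih]
    by_cases c1 : C.listEps i (u ++ v) ≤ C.φ i b <;>
    by_cases c2 : C.listEps i v ≤ C.listPhi i u <;>
    by_cases c3 : C.listEps i v ≤ C.listPhi i u + (C.φ i b - C.listEps i u) <;>
    by_cases c4 : C.listEps i u ≤ C.φ i b <;>
    first
    | omega
    | simp only [c1, c2, c3, c4, if_true, if_false, Option.map_map, Function.comp_def,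
        List.cons_append]

end Crystal

/-! ### Tableaux as Gelfand-Tsetlin patterns -/

namespace Tab

variable {n : ℕ} {s : Shape n}

theorem count_zero (T : Tab s) (i : ℕ) : T.count i 0 = 0 := by
  simp [count]

theorem count_of_le (T : Tab s) {i : ℕ} (hi : s.r ≤ i) (y : ℕ) : T.count i y = 0 := by
  unfold count
  rw [Finset.card_eq_zero, Finset.filter_eq_empty_iff]
  rintro c - ⟨h, -⟩
  omega

theorem count_top (T : Tab s) {i y : ℕ} (hi : i < s.r) (hy : n < y) : T.count i y = s.l := by
  apply T.count_eq ⟨i, hi⟩ y _ le_rfl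
  intro c
  have := (T.entry ⟨i, hi⟩ c).2
  have := c.2
  omega

theorem count_succ_two_le (T : Tab s) (i x : ℕ) : T.count (i + 1) (x + 2) ≤ T.count i (x + 1) :=
  T.count_succ_le i (x + 1)

theorem count_anti_succ (T : Tab s) (i y : ℕ) : T.count (i + 1) y ≤ T.count i y :=
  (T.count_mono (i + 1) (Nat.le_succ y)).trans (T.count_succ_le i y)

theorem count_anti (T : Tab s) {i j : ℕ} (h : i ≤ j) (y : ℕ) : T.count j y ≤ T.count i y := by
  induction j, h using Nat.le_induction with
  | base => exact le_rfl
  | succ j _ ih => exact (T.count_anti_succ j y).trans ih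

theorem count_diag (T : Tab s) (i y j : ℕ) : T.count (i + j) (y + j) ≤ T.count i y := by
  induction j with
  | zero => exact le_rfl
  | succ j ih => exact (T.count_succ_le (i + j) (y + j)).trans ih

theorem count_of_le_row (T : Tab s) {i y : ℕ} (h : y ≤ i) : T.count i y = 0 := by
  have h1 := T.count_diag (i - y) 0 y
  rw [Nat.sub_add_cancel h, T.count_zero, zero_add] at h1
  omega

theorem count_of_top_le (T : Tab s) {i y : ℕ} (hi : i < s.r) (h : n + 2 + i ≤ y + s.r) :
    T.count i y = s.l := by
  have h1 := T.count_diag i y (s.r - 1 - i)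
  rw [T.count_top (by omega) (by omega)] at h1
  exact le_antisymm (T.count_le _ _) h1

theorem ext_count {T T' : Tab s} (h : ∀ i y, i < s.r → T.count i y = T'.count i y) : T = T' := by
  ext i c
  have h1 : ∀ y, (T.entry i c : ℕ) < y ↔ (T'.entry i c : ℕ) < y := fun y => by
    rw [← T.lt_count, ← T'.lt_count, h i y i.2]
  have h2 := h1 (T.entry i c + 1)
  have h3 := h1 (T'.entry i c + 1)
  omega

/-- Every Gelfand-Tsetlin pattern comes from a tableau. -/
theorem exists_of_count (x : ℕ → ℕ → ℕ) (hm : ∀ i y, x i y ≤ x i (y + 1))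
    (hs : ∀ i y, x (i + 1) (y + 1) ≤ x i y) (hl : ∀ i y, x i y ≤ s.l)
    (ht : ∀ i, i < s.r → x i (n + 1) = s.l) (h0 : ∀ i, x i 0 = 0)
    (hr : ∀ i y, s.r ≤ i → x i y = 0) : ∃ T : Tab s, ∀ i y, T.count i y = x i y := by
  have hex : ∀ (i : Fin s.r) (c : Fin s.l), ∃ y, (c : ℕ) < x i (y + 1) := fun i c =>
    ⟨n, by rw [ht i i.2]; exact c.2⟩
  have mono : ∀ i, Monotone (x i) := fun i => monotone_nat_of_le_succ (hm i)
  have hlt : ∀ (i : Fin s.r) (c : Fin s.l) y, Nat.find (hex i c) < y ↔ (c : ℕ) < x i y := by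
    intro i c y
    constructor
    · intro h
      exact (Nat.find_spec (hex i c)).trans_le (mono i h)
    · intro h
      cases y with
      | zero => rw [h0] at h; omega
      | succ y => exact Nat.lt_succ_of_le (Nat.find_min' _ h)
  let T : Tab s :=
    { entry := fun i c => ⟨Nat.find (hex i c), (hlt i c _).2 (by rw [ht i i.2]; exact c.2)⟩
      row_weak := fun i c c' h => by
        apply Nat.find_min'
        exact lt_of_le_of_lt h (Nat.find_spec (hex i c'))
      col_strict := by
        have step : ∀ (i : ℕ) (h : i + 1 < s.r) (c : Fin s.l),
            Nat.find (hex ⟨i, by omega⟩ c) < Nat.find (hex ⟨i + 1, h⟩ c) := by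
          intro i h c
          rw [hlt]
          have h1 := Nat.find_spec (hex ⟨i + 1, h⟩ c)
          exact h1.trans_le (hs i _)
        intro i i' c h
        obtain ⟨i, hi⟩ := i
        obtain ⟨i', hi'⟩ := i'
        simp only [Fin.lt_def] at h ⊢
        induction i', h using Nat.le_induction with
        | base => exact step i hi' c
        | succ j hj ih => exact (ih (by omega)).trans (step j hi' c) }
  refine ⟨T, fun i y => ?_⟩
  by_cases hi : i < s.r
  · apply T.count_eq ⟨i, hi⟩ y _ (hl i y)
    intro c
    exact (hlt ⟨i, hi⟩ c y).symm
  · rw [T.count_of_le (by omega), hr i y (by omega)]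

/-- With `a ≤ b ≤ c` the numbers of letters `< x`, `≤ x`, `≤ x + 1` in a row, the row contributes
`c - b` letters `x + 1`, followed by `b - a` letters `x`, to the signature of the reading word.
`T.height x k` is the excess of letters `x + 1` over letters `x` after the letters `x + 1` of the
row `k` have been read. So `ε` is the maximum of these heights. -/
def height (T : Tab s) (x k : ℕ) : ℤ :=
  ∑ j ∈ Finset.range k,
    ((T.count j (x + 2) : ℤ) + T.count j x - 2 * T.count j (x + 1)) +
    T.count k (x + 2) - T.count k (x + 1)

theorem height_zero (T : Tab s) (x : ℕ) :
    T.height x 0 = T.count 0 (x + 2) - T.count 0 (x + 1) := by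
  simp [height]

theorem height_succ (T : Tab s) (x k : ℕ) :
    T.height x (k + 1) = T.height x k + T.count (k + 1) (x + 2) - T.count (k + 1) (x + 1)
      - T.count k (x + 1) + T.count k x := by
  simp only [height, Finset.sum_range_succ]
  ring

theorem height_congr {T T' : Tab s} {x : ℕ} (h0 : ∀ k, T.count k x = T'.count k x)
    (h1 : ∀ k, T.count k (x + 1) = T'.count k (x + 1))
    (h2 : ∀ k, T.count k (x + 2) = T'.count k (x + 2)) (k : ℕ) :
    T.height x k = T'.height x k := by
  simp only [height, h0, h1, h2]

/-- The total excess of letters `x + 1` over letters `x` in the columns `≥ c`. -/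
def colHeight (T : Tab s) (x c : ℕ) : ℤ :=
  ∑ k ∈ Finset.range (s.r + 2),
    (((T.count k (x + 2) - max (T.count k (x + 1)) c : ℕ) : ℤ) -
      ((T.count k (x + 1) - max (T.count k x) c : ℕ) : ℤ))

theorem colHeight_eq (T : Tab s) (x c K : ℕ) (hK : K ≤ s.r) (h1 : ∀ j < K, c ≤ T.count j x)
    (h2 : T.count (K + 1) (x + 1) ≤ c) :
    T.colHeight x c = T.height x K - (T.count K (x + 2) - T.count K (x + 1)) +
      (((T.count K (x + 2) - max (T.count K (x + 1)) c : ℕ) : ℤ) -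
      ((T.count K (x + 1) - max (T.count K x) c : ℕ) : ℤ)) +
      ((T.count (K + 1) (x + 2) - c : ℕ) : ℤ) := by
  unfold colHeight
  rw [← Finset.sum_subset (Finset.range_subset_range.2 (show K + 2 ≤ s.r + 2 by omega)),
    Finset.sum_range_succ, Finset.sum_range_succ, height]
  · have : ∀ j ∈ Finset.range K,
        (((T.count j (x + 2) - max (T.count j (x + 1)) c : ℕ) : ℤ) -
        ((T.count j (x + 1) - max (T.count j x) c : ℕ) : ℤ)) =
        ((T.count j (x + 2) : ℤ) + T.count j x - 2 * T.count j (x + 1)) := by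
      intro j hj
      have := h1 j (Finset.mem_range.1 hj)
      have := T.count_mono j (show x ≤ x + 1 by omega)
      have := T.count_mono j (show x + 1 ≤ x + 2 by omega)
      omega
    rw [Finset.sum_congr rfl this]
    have := T.count_mono (K + 1) (show x ≤ x + 1 by omega)
    have := T.count_mono (K + 1) (show x + 1 ≤ x + 2 by omega)
    omega
  · intro j _ hj
    rw [Finset.mem_range, not_lt] at hj
    obtain ⟨m, rfl⟩ : ∃ m, j = m + 1 := ⟨j - 1, by omega⟩
    have e1 := T.count_succ_two_le m x
    have e2 := T.count_anti (show K + 1 ≤ m by omega) (x + 1)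
    have e3 := T.count_mono (m + 1) (show x + 1 ≤ x + 2 by omega)
    omega

theorem colHeight_count (T : Tab s) (x k : ℕ) (hk : k ≤ s.r) :
    T.colHeight x (T.count k (x + 1)) = T.height x k := by
  rw [T.colHeight_eq x _ k hk]
  · have e1 := T.count_succ_two_le k x
    have := T.count_mono k (show x + 1 ≤ x + 2 by omega)
    omega
  · intro j hj
    exact (T.count_anti (show j + 1 ≤ k by omega) (x + 1)).trans (T.count_succ_le j x)
  · exact T.count_anti_succ k (x + 1)

theorem exists_colHeight_eq (T : Tab s) (x c : ℕ) : ∃ K ≤ s.r,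
    (∀ j < K, c ≤ T.count j x) ∧ T.count (K + 1) (x + 1) ≤ c ∧ (K < s.r → T.count K x < c) ∧
    T.colHeight x c = T.height x K - (T.count K (x + 2) - T.count K (x + 1)) +
      (((T.count K (x + 2) - max (T.count K (x + 1)) c : ℕ) : ℤ) -
      ((T.count K (x + 1) - max (T.count K x) c : ℕ) : ℤ)) +
      ((T.count (K + 1) (x + 2) - c : ℕ) : ℤ) := by
  classical
  have hex : ∃ K, s.r ≤ K ∨ T.count K x < c := ⟨s.r, Or.inl le_rfl⟩
  have h1 := Nat.find_spec hex
  have h2 : Nat.find hex ≤ s.r := Nat.find_min' hex (Or.inl le_rfl)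
  have h3 : ∀ j < Nat.find hex, c ≤ T.count j x := fun j hj => by
    have := Nat.find_min hex hj
    omega
  generalize Nat.find hex = K at h1 h2 h3
  have h4 : T.count (K + 1) (x + 1) ≤ c := by
    rcases h1 with h | h
    · rw [T.count_of_le (by omega)]; omega
    · have := T.count_succ_le K x; omega
  exact ⟨K, h2, h3, h4, by omega, T.colHeight_eq x c K h2 h3 h4⟩

theorem colHeight_le (T : Tab s) (x c : ℕ) : ∃ K ≤ s.r, T.colHeight x c ≤ T.height x K := by
  obtain ⟨K, h1, h2, h3, h4, h5⟩ := T.exists_colHeight_eq x c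
  refine ⟨K, h1, ?_⟩
  have e1 := T.count_succ_two_le K x
  have := T.count_mono K (show x + 1 ≤ x + 2 by omega)
  have := T.count_mono K (show x ≤ x + 1 by omega)
  have : T.count K x < c ∨ T.count K (x + 1) = 0 ∧ T.count K (x + 2) = 0 := by
    by_cases hK : K < s.r
    · exact Or.inl (h4 hK)
    · exact Or.inr ⟨T.count_of_le (by omega) _, T.count_of_le (by omega) _⟩
  omega

theorem colHeight_lt (T : Tab s) (x c k : ℕ) (hk : ∀ j < k, T.height x j < T.height x k)
    (h0 : 0 < T.height x k) (hc : T.count k (x + 1) < c) :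
    T.colHeight x c < T.height x k := by
  obtain ⟨K, h1, h2, h3, h4, h5⟩ := T.exists_colHeight_eq x c
  have e0 : T.count K x < c ∨ T.count K (x + 1) = 0 ∧ T.count K (x + 2) = 0 := by
    by_cases hK : K < s.r
    · exact Or.inl (h4 hK)
    · exact Or.inr ⟨T.count_of_le (by omega) _, T.count_of_le (by omega) _⟩
  have e1 := T.count_succ_two_le K x
  have e2 := T.count_mono K (show x + 1 ≤ x + 2 by omega)
  have e3 := T.count_mono K (show x ≤ x + 1 by omega)
  rcases lt_trichotomy K k with h | rfl | h
  · have := hk K h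
    omega
  · have : T.count K (x + 1) < T.count K (x + 2) := by
      cases K with
      | zero => rw [T.height_zero] at h0; omega
      | succ m =>
        have := hk m (by omega)
        rw [T.height_succ] at this
        have := T.count_mono m (show x ≤ x + 1 by omega)
        omega
    omega
  · have := h2 k h
    have := T.count_mono k (show x ≤ x + 1 by omega)
    omega

theorem height_of_le (T : Tab s) (x k : ℕ) (hk : s.r ≤ k) : T.height x k = T.height x s.r := by
  induction k, hk using Nat.le_induction with
  | base => rfl
  | succ k hk ih =>
    rw [T.height_succ, ih]
    simp [T.count_of_le hk, T.count_of_le (show s.r ≤ k + 1 by omega)]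

end Tab

/-- `Step x k T T'` says that `k` is the first row where the height for the letters `x`, `x + 1`
is maximal, that this maximum is positive, and that `T'` arises from `T` by replacing the first
letter `x + 1` in the row `k` by `x`. -/
def Step {n : ℕ} {s : Shape n} (x k : ℕ) (T T' : Tab s) : Prop :=
  (∀ j < k, T.height x j < T.height x k) ∧ (∀ j, T.height x j ≤ T.height x k) ∧
  0 < T.height x k ∧
  ∀ j y, T'.count j y = T.count j y + if j = k ∧ y = x + 1 then 1 else 0

namespace Step

variable {n : ℕ} {s : Shape n} {x k : ℕ} {T T' : Tab s}

theorem count_self (h : Step x k T T') : T'.count k (x + 1) = T.count k (x + 1) + 1 := by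
  rw [h.2.2.2]; simp

theorem count_ne (h : Step x k T T') (j : ℕ) {y : ℕ} (hy : y ≠ x + 1) :
    T'.count j y = T.count j y := by
  rw [h.2.2.2]; simp [hy]

end Step

/-- The inequalities which make a step possible. -/
theorem Tab.step_aux {n : ℕ} {s : Shape n} {x k : ℕ} {T : Tab s}
    (h1 : ∀ j < k, T.height x j < T.height x k) (h2 : 0 < T.height x k) :
    T.count k (x + 1) < T.count k (x + 2) ∧
      (∀ j, k = j + 1 → T.count k (x + 1) < T.count j x ∧ T.count k (x + 2) - T.count k (x + 1) >
        T.count j (x + 1) - T.count j x) := by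
  cases k with
  | zero => rw [T.height_zero] at h2; exact ⟨by omega, by omega⟩
  | succ m =>
    have h3 := h1 m (by omega)
    rw [T.height_succ] at h3
    have := T.count_mono m (show x ≤ x + 1 by omega)
    have := T.count_succ_two_le m x
    refine ⟨by omega, ?_⟩
    intro j hj
    obtain rfl : m = j := by omega
    omega

theorem Tab.exists_step {n : ℕ} {s : Shape n} {x : ℕ} (hx : x < n) (T : Tab s)
    (h : ∃ k, 0 < T.height x k) : ∃ k T', Step x k T T' := by
  classical
  -- The heights are eventually constant, so they have a maximum; take its first occurrence.
  have hmax : ∃ k, ∀ j, T.height x j ≤ T.height x k := by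
    obtain ⟨k, -, hk⟩ := Finset.exists_max_image (Finset.range (s.r + 1)) (T.height x) ⟨0, by simp⟩
    refine ⟨k, fun j => ?_⟩
    by_cases hj : j ≤ s.r
    · exact hk j (by simp; omega)
    · rw [T.height_of_le x j (by omega)]
      exact hk s.r (by simp)
  have hk := Nat.find_spec hmax
  have hk' : ∀ j < Nat.find hmax, T.height x j < T.height x (Nat.find hmax) := fun j hj => by
    have := Nat.find_min hmax hj
    push Not at this
    obtain ⟨i, hi⟩ := this
    exact hi.trans_le (hk i)
  generalize Nat.find hmax = k at hk hk'
  have h0 : 0 < T.height x k := by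
    obtain ⟨j, hj⟩ := h
    exact hj.trans_le (hk j)
  obtain ⟨a1, a2⟩ := Tab.step_aux hk' h0
  have hkr : k < s.r := by
    by_contra hc
    have e1 := T.count_of_le (not_lt.1 hc) (x + 1)
    have e2 := T.count_of_le (not_lt.1 hc) (x + 2)
    omega
  suffices hT : ∃ T' : Tab s, ∀ j y,
      T'.count j y = T.count j y + if j = k ∧ y = x + 1 then 1 else 0 by
    obtain ⟨T', hT'⟩ := hT
    exact ⟨k, T', hk', hk, h0, hT'⟩
  apply Tab.exists_of_count
  · intro i y
    have := T.count_mono i (show y ≤ y + 1 by omega)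
    by_cases hy : i = k ∧ y = x + 1
    · obtain ⟨rfl, rfl⟩ := hy
      simp
      omega
    · simp only [hy, if_false]; omega
  · intro i y
    have := T.count_succ_le i y
    by_cases hy : i + 1 = k ∧ y + 1 = x + 1
    · obtain ⟨hy1, hy2⟩ := hy
      obtain rfl : y = x := by omega
      have := (a2 i hy1.symm).1
      rw [← hy1] at this
      simp [hy1.symm]
      omega
    · simp only [hy, if_false]; omega
  · intro i y
    have := T.count_le i y
    by_cases hy : i = k ∧ y = x + 1
    · obtain ⟨rfl, rfl⟩ := hy
      have := T.count_le i (x + 2)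
      simp
      omega
    · simp only [hy, if_false]; omega
  · intro i hi
    have := T.count_top hi (show n < n + 1 by omega)
    simp [this]
    omega
  · intro i
    simp [T.count_zero]
  · intro i y hi
    have : i ≠ k := by omega
    simp [T.count_of_le hi, this]

/-! ### Kashiwara operators on reading words -/

theorem letters_regular {n : ℕ} (hn : 1 ≤ n) : (letters n).Regular where
  e_iff i b b' := by
    simp only [letters]
    constructor
    · intro h
      split_ifs at h with h1
      simp only [Option.some.injEq] at h
      subst h1 h
      simp
    · intro h
      split_ifs at h with h1
      simp only [Option.some.injEq] at h
      subst h1 h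
      simp
  ε_of_e i b b' := by
    simp only [letters]
    intro h
    split_ifs at h with h1
    simp only [Option.some.injEq] at h
    have h2 : b' ≠ i := by
      rintro rfl
      have h3 : (1 : Fin (n + 1)) = 0 := by
        have := sub_eq_iff_eq_add.1 h
        simpa using this
      rw [Fin.ext_iff] at h3
      simp [Nat.mod_eq_of_lt (show 1 < n + 1 by omega)] at h3
    simp [h1, h2]
  φ_of_e i b b' := by
    simp only [letters]
    intro h
    split_ifs at h with h1
    simp only [Option.some.injEq] at h
    have h2 : b + 1 ≠ i := by
      rintro rfl
      have h3 : (1 : Fin (n + 1)) = 0 := by simpa using h1.symm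
      rw [Fin.ext_iff] at h3
      simp [Nat.mod_eq_of_lt (show 1 < n + 1 by omega)] at h3
    simp [h2, ← h]
  exists_e i b h := by
    simp only [letters] at h ⊢
    split_ifs at h with h1
    · simp [h1]
    · simp at h
  exists_f i b h := by
    simp only [letters] at h ⊢
    split_ifs at h with h1
    · simp [h1]
    · simp at h

theorem letters_ε {n : ℕ} (x : Fin n) (y : Fin (n + 1)) :
    (letters n).ε x.succ y = if y = x.succ then 1 else 0 := rfl

theorem add_one_eq_succ {n : ℕ} (x : Fin n) (y : Fin (n + 1)) :
    y + 1 = x.succ ↔ y = x.castSucc := by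
  rw [← Fin.coeSucc_eq_succ, add_left_inj]

theorem letters_φ {n : ℕ} (x : Fin n) (y : Fin (n + 1)) :
    (letters n).φ x.succ y = if y = x.castSucc then 1 else 0 := by
  simp only [letters, add_one_eq_succ]

theorem letters_e {n : ℕ} (x : Fin n) :
    (letters n).e x.succ x.succ = some x.castSucc := by
  simp only [letters, if_true, Option.some.injEq]
  rw [← Fin.coeSucc_eq_succ, add_sub_cancel_right]

/-- `ε`, `φ` and `e` on columns, that is on strictly increasing words. -/
theorem letters_column {n : ℕ} (x : Fin n) (w : List (Fin (n + 1))) (hw : w.Pairwise (· < ·)) :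
    (letters n).listEps x.succ w = (if x.succ ∈ w ∧ x.castSucc ∉ w then 1 else 0) ∧
    (letters n).listPhi x.succ w = (if x.castSucc ∈ w ∧ x.succ ∉ w then 1 else 0) ∧
    (x.succ ∈ w → x.castSucc ∉ w → (letters n).listE x.succ w =
      some (w.map fun y => if y = x.succ then x.castSucc else y)) := by
  induction w with
  | nil => simp [Crystal.listEps, Crystal.listPhi]
  | cons y w ih =>
    rw [List.pairwise_cons] at hw
    obtain ⟨i1, i2, i3⟩ := ih hw.2
    have hlt : x.castSucc < x.succ := Fin.castSucc_lt_succ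
    simp only [Crystal.listEps, Crystal.listPhi, Crystal.listE, letters_ε, letters_φ, i1, i2]
    by_cases h1 : y = x.castSucc
    · subst h1
      have : x.castSucc ∉ w := fun h => lt_irrefl _ (hw.1 _ h)
      by_cases h2 : x.succ ∈ w <;> simp [this, h2, hlt.ne, hlt.ne']
    · by_cases h2 : y = x.succ
      · subst h2
        have e1 : x.succ ∉ w := fun h => lt_irrefl _ (hw.1 _ h)
        have e2 : x.castSucc ∉ w := fun h => lt_asymm hlt (hw.1 _ h)
        simp only [e1, e2, letters_e]
        simp
        refine ⟨⟨hlt.ne, e2⟩, hlt.ne', fun _ _ => ?_⟩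
        symm
        conv_rhs => rw [← List.map_id w]
        apply List.map_congr_left
        intro a ha
        have : a ≠ x.succ := fun h => e1 (h ▸ ha)
        simp [this]
      · by_cases h3 : x.succ ∈ w <;> by_cases h4 : x.castSucc ∈ w <;>
          simp [h1, h2, h3, h4, Ne.symm h1, Ne.symm h2]
        simp [i3 h3 h4]

theorem Crystal.listEps_sub_listPhi {I B : Type} (C : Crystal I B) (i : I) (w : List B) :
    (C.listEps i w : ℤ) - C.listPhi i w = (w.map fun b => (C.ε i b : ℤ) - C.φ i b).sum := by
  induction w with
  | nil => simp [listEps, listPhi]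
  | cons b w ih =>
    simp only [listEps, listPhi, List.map_cons, List.sum_cons, ← ih]
    omega

namespace Tab

variable {n : ℕ} {s : Shape n}

/-- The column `c`, read from top to bottom. -/
def column (T : Tab s) (c : ℕ) : List (Fin (n + 1)) :=
  if h : c < s.l then (List.finRange s.r).map fun i => T.entry i ⟨c, h⟩ else []

/-- The reading word of the first `c` columns. -/
def wordTo (T : Tab s) : ℕ → List (Fin (n + 1))
  | 0 => []
  | c + 1 => T.column c ++ T.wordTo c

theorem word_eq (T : Tab s) : T.word = T.wordTo s.l := by
  have key : ∀ m, ((List.finRange m).reverse.flatMap fun c : Fin m => T.column c) =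
      T.wordTo m := by
    intro m
    induction m with
    | zero => rfl
    | succ m ih =>
      rw [List.finRange_succ_last, List.reverse_append, List.flatMap_append, wordTo, ← ih,
        ← List.map_reverse, List.flatMap_map]
      simp
  rw [← key, word]
  congr 1
  funext c
  simp [column]

theorem column_pairwise (T : Tab s) (c : ℕ) : (T.column c).Pairwise (· < ·) := by
  unfold column
  split_ifs with h
  · rw [List.pairwise_map]
    exact (List.pairwise_lt_finRange s.r).imp fun h1 => T.col_strict _ _ _ h1
  · simp

theorem mem_column (T : Tab s) {c : ℕ} (hc : c < s.l) (y : Fin (n + 1)) :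
    y ∈ T.column c ↔ ∃ i, T.count i y ≤ c ∧ c < T.count i (y + 1) := by
  simp only [column, hc, dif_pos, List.mem_map, List.mem_finRange, true_and]
  constructor
  · rintro ⟨i, rfl⟩
    refine ⟨i, ?_, (T.lt_count i ⟨c, hc⟩ _).2 (by omega)⟩
    by_contra h
    have := (T.lt_count i ⟨c, hc⟩ _).1 (not_le.1 h)
    omega
  · rintro ⟨i, h1, h2⟩
    have hi : i < s.r := by
      by_contra h
      rw [T.count_of_le (not_lt.1 h)] at h2
      omega
    have h3 := (T.lt_count ⟨i, hi⟩ ⟨c, hc⟩ (y + 1)).1 h2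
    have h4 := mt (T.lt_count ⟨i, hi⟩ ⟨c, hc⟩ y).2 (not_lt.2 h1)
    exact ⟨⟨i, hi⟩, Fin.ext (by omega)⟩

theorem word_injective : Function.Injective (Tab.word (s := s)) := by
  intro T T' h
  rw [word_eq, word_eq] at h
  have key : ∀ m, T.wordTo m = T'.wordTo m → ∀ c < m, T.column c = T'.column c := by
    intro m
    induction m with
    | zero => intro _ c hc; omega
    | succ m ih =>
      intro h c hc
      have hl : (T.column m).length = (T'.column m).length := by
        unfold column; split_ifs <;> simp
      obtain ⟨h1, h2⟩ := List.append_inj h hl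
      rcases Nat.lt_succ_iff_lt_or_eq.1 hc with h3 | rfl
      · exact ih h2 c h3
      · exact h1
  ext i c
  have h1 := key _ h c c.2
  simp only [column, c.2, dif_pos] at h1
  rw [List.map_inj_left] at h1
  rw [h1 i (List.mem_finRange i)]

theorem colHeight_sub (T : Tab s) (x : Fin n) {c : ℕ} (hc : c < s.l) :
    T.colHeight x c - T.colHeight x (c + 1) =
      ((letters n).listEps x.succ (T.column c) : ℤ) - (letters n).listPhi x.succ (T.column c) := by
  rw [Crystal.listEps_sub_listPhi]
  simp only [column, hc, dif_pos, List.map_map, Function.comp_def]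
  rw [← List.ofFn_eq_map, List.sum_ofFn, colHeight, colHeight, ← Finset.sum_sub_distrib,
    Finset.sum_range_succ, Finset.sum_range_succ]
  rw [T.count_of_le le_rfl, T.count_of_le le_rfl, T.count_of_le le_rfl,
    T.count_of_le (Nat.le_succ _), T.count_of_le (Nat.le_succ _), T.count_of_le (Nat.le_succ _),
    Finset.sum_range]
  simp only [Nat.zero_sub, Nat.cast_zero, sub_zero, add_zero]
  apply Finset.sum_congr rfl
  intro i _
  have e0 := T.lt_count i ⟨c, hc⟩ x
  have e1 := T.lt_count i ⟨c, hc⟩ (x + 1)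
  have e2 := T.lt_count i ⟨c, hc⟩ (x + 2)
  have m1 := T.count_mono i (show (x : ℕ) ≤ x + 1 by omega)
  have m2 := T.count_mono i (show (x : ℕ) + 1 ≤ x + 2 by omega)
  simp only at e0 e1 e2
  simp only [letters_ε, letters_φ, Fin.ext_iff, Fin.val_succ, Fin.val_castSucc]
  split_ifs <;> push_cast <;> omega

/-- `ε` of the reading word of the first `c` columns is the maximal excess of letters `x + 1`
over letters `x` in columns ending with the column `c - 1`. -/
theorem listEps_wordTo (T : Tab s) (x : Fin n) {c : ℕ} (hc : c ≤ s.l) :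
    (∀ c' ≤ c, T.colHeight x c' - T.colHeight x c ≤ (letters n).listEps x.succ (T.wordTo c)) ∧
    ∃ c' ≤ c, T.colHeight x c' - T.colHeight x c = (letters n).listEps x.succ (T.wordTo c) := by
  induction c with
  | zero =>
    simp [wordTo, Crystal.listEps]
  | succ c ih =>
    obtain ⟨i1, c', hc', i2⟩ := ih (by omega)
    have h := T.colHeight_sub x (show c < s.l by omega)
    obtain ⟨k1, k2, -⟩ := letters_column x _ (T.column_pairwise c)
    have k3 : (letters n).listEps x.succ (T.column c) = 0 ∨
        (letters n).listEps x.succ (T.column c) = 1 ∧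
        (letters n).listPhi x.succ (T.column c) = 0 := by
      rw [k1, k2]; split_ifs <;> simp_all
    simp only [wordTo, ((letters n).listEps_append _ _ _).1]
    constructor
    · intro d hd
      rcases eq_or_lt_of_le hd with rfl | h1
      · omega
      · have := i1 d (by omega); omega
    · by_cases hp : (letters n).listPhi x.succ (T.column c) ≤
        (letters n).listEps x.succ (T.wordTo c)
      · exact ⟨c', by omega, by omega⟩
      · exact ⟨c + 1, le_rfl, by omega⟩

theorem colHeight_l (T : Tab s) (x : ℕ) : T.colHeight x s.l = 0 := by
  apply Finset.sum_eq_zero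
  intro k _
  have := T.count_le k (x + 1)
  have := T.count_le k (x + 2)
  omega

/-- `ε` of the reading word is the maximum of the heights. -/
theorem listEps_word (T : Tab s) (x : Fin n) :
    (∀ k, T.height x k ≤ (letters n).listEps x.succ T.word) ∧
    ∃ k, T.height x k = (letters n).listEps x.succ T.word := by
  obtain ⟨h1, c, hc, h2⟩ := T.listEps_wordTo x le_rfl
  rw [← word_eq, colHeight_l] at h1 h2
  simp only [sub_zero] at h1 h2
  have h3 : ∀ k, T.height x k ≤ (letters n).listEps x.succ T.word := by
    intro k
    rcases le_total k s.r with h | h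
    · rw [← T.colHeight_count x k h]
      exact h1 _ (T.count_le _ _)
    · rw [T.height_of_le x k h, ← T.colHeight_count x _ le_rfl]
      exact h1 _ (T.count_le _ _)
  obtain ⟨k, -, hk⟩ := T.colHeight_le x c
  exact ⟨h3, k, le_antisymm (h3 k) (h2 ▸ hk)⟩

end Tab

/-- A step is the action of the Kashiwara operator on the reading word. -/
theorem Step.listE {n : ℕ} {s : Shape n} {x : Fin n} {k : ℕ} {T T' : Tab s} (h : Step x k T T') :
    (letters n).listE x.succ T.word = some T'.word := by
  have hn : 1 ≤ n := by have := x.2; omega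
  have hmax : ∀ c ≤ s.l, T.colHeight x c ≤ T.height x k := fun c _ => by
    obtain ⟨K, -, hK⟩ := T.colHeight_le x c
    exact hK.trans (h.2.1 K)
  obtain ⟨a1, a2⟩ := Tab.step_aux h.1 h.2.2.1
  have hkr : k < s.r := by
    by_contra hc
    have e1 := T.count_of_le (not_lt.1 hc) (x + 1)
    have e2 := T.count_of_le (not_lt.1 hc) (x + 2)
    omega
  set c := T.count k (x + 1) with hcdef
  have hG : T.colHeight x c = T.height x k := T.colHeight_count x k hkr.le
  have hcl : c < s.l := a1.trans_le (T.count_le _ _)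
  have eps_c : (letters n).listEps x.succ (T.wordTo c) = 0 := by
    obtain ⟨-, d, hd, h2⟩ := T.listEps_wordTo x hcl.le
    have := hmax d (by omega)
    omega
  -- The columns of `T` and `T'` agree, except for the column `c`.
  have hcol : ∀ d, d ≠ c → T'.column d = T.column d := by
    intro d hd
    unfold Tab.column
    split_ifs with hl
    · apply List.map_congr_left
      intro i _
      have : ∀ y, (T'.entry i ⟨d, hl⟩ : ℕ) < y ↔ (T.entry i ⟨d, hl⟩ : ℕ) < y := by
        intro y
        rw [← Tab.lt_count, ← Tab.lt_count, h.2.2.2]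
        by_cases hy : (i : ℕ) = k ∧ y = x + 1
        · obtain ⟨hy, rfl⟩ := hy
          simp only [hy]
          simp
          omega
        · simp [hy]
      have k1 := this (T.entry i ⟨d, hl⟩ + 1)
      have k2 := this (T'.entry i ⟨d, hl⟩ + 1)
      exact Fin.ext (by omega)
    · rfl
  have hword : ∀ d ≤ c, T'.wordTo d = T.wordTo d := by
    intro d hd
    induction d with
    | zero => rfl
    | succ d ih => rw [Tab.wordTo, Tab.wordTo, ih (by omega), hcol d (by omega)]
  have hmem : x.succ ∈ T.column c := by
    rw [T.mem_column hcl]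
    exact ⟨k, by simp [hcdef], by simpa using a1⟩
  have hmem' : x.castSucc ∉ T.column c := by
    rw [T.mem_column hcl]
    rintro ⟨i, h1, h2⟩
    simp only [Fin.val_castSucc] at h1 h2
    rcases lt_or_ge i k with hi | hi
    · have := (a2 (k - 1) (by omega)).1
      have := T.count_anti (show i ≤ k - 1 by omega) x
      omega
    · have := T.count_anti hi (x + 1)
      omega
  have hcolc : T'.column c =
      (T.column c).map fun y => if y = x.succ then x.castSucc else y := by
    simp only [Tab.column, hcl, dif_pos, List.map_map]
    apply List.map_congr_left
    intro i _
    simp only [Function.comp_def]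
    have key : ∀ y, (T'.entry i ⟨c, hcl⟩ : ℕ) < y ↔
        (T.entry i ⟨c, hcl⟩ : ℕ) < y ∨ (i : ℕ) = k ∧ y = x + 1 := by
      intro y
      rw [← Tab.lt_count, ← Tab.lt_count, h.2.2.2]
      by_cases hy : (i : ℕ) = k ∧ y = x + 1
      · obtain ⟨hy, rfl⟩ := hy
        simp only [hy]
        simp
        omega
      · simp [hy]
    have k1 := key (T.entry i ⟨c, hcl⟩ + 1)
    have k2 := key (T'.entry i ⟨c, hcl⟩ + 1)
    have k3 := key (x + 1)
    have k4 := key (x + 2)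
    have k5 := key x
    have k6 := T.lt_count i ⟨c, hcl⟩ (x + 2)
    have k7 := T.lt_count i ⟨c, hcl⟩ (x + 1)
    -- The letter `x + 1` occurs in this column only in the row `k`.
    have k8 : (T.entry i ⟨c, hcl⟩ : ℕ) = x + 1 → (i : ℕ) = k := by
      intro he
      rcases lt_trichotomy (i : ℕ) k with hi | hi | hi
      · have := T.count_anti (show (i : ℕ) + 1 ≤ k by omega) (x + 2)
        have := T.count_succ_two_le i x
        simp only at k6 k7
        omega
      · exact hi
      · have := T.count_anti (show k + 1 ≤ i by omega) (x + 2)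
        have := T.count_succ_two_le k x
        simp only at k6 k7
        omega
    have k9 : (i : ℕ) = k → (T.entry i ⟨c, hcl⟩ : ℕ) = x + 1 := by
      intro hi
      rw [hi] at k6 k7
      simp only at k6 k7
      omega
    simp only [Fin.ext_iff, Fin.val_succ]
    split_ifs with hy
    · simp only [Fin.val_castSucc]
      omega
    · omega
  have hmain : ∀ d, c < d → d ≤ s.l →
      (letters n).listE x.succ (T.wordTo d) = some (T'.wordTo d) := by
    intro d hd
    induction d, hd using Nat.le_induction with
    | base =>
      intro _
      rw [Tab.wordTo, Tab.wordTo, (letters_regular hn).listE_append, eps_c,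
        if_pos (Nat.zero_le _), (letters_column x _ (T.column_pairwise c)).2.2 hmem hmem',
        hword c le_rfl, hcolc]
      rfl
    | succ d hd ih =>
      intro hdl
      have h1 := ih (by omega)
      rw [Tab.wordTo, Tab.wordTo, (letters_regular hn).listE_append, hcol d (by omega), h1]
      have h2 := (T.listEps_wordTo x (show d ≤ s.l by omega)).1 c (by omega)
      have h3 := T.colHeight_sub x (show d < s.l by omega)
      have h4 := T.colHeight_lt x d k h.1 h.2.2.1 (by omega)
      have h5 := T.colHeight_lt x (d + 1) k h.1 h.2.2.1 (by omega)
      obtain ⟨k1, k2, -⟩ := letters_column x _ (T.column_pairwise d)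
      have k3 : (letters n).listPhi x.succ (T.column d) = 0 ∨
          (letters n).listPhi x.succ (T.column d) = 1 ∧
          (letters n).listEps x.succ (T.column d) = 0 := by
        rw [k1, k2]; split_ifs <;> simp_all
      rw [if_neg (by omega)]
      rfl
  rw [Tab.word_eq, Tab.word_eq]
  exact hmain _ hcl le_rfl

/-! ### The crystal structure on tableaux -/

theorem Tab.height_of_count {n : ℕ} {s : Shape n} {x k : ℕ} {T T' : Tab s}
    (h : ∀ j y, T'.count j y = T.count j y + if j = k ∧ y = x + 1 then 1 else 0) (j : ℕ) :
    T'.height x j = T.height x j - if j < k then 0 else if j = k then 1 else 2 := by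
  induction j with
  | zero =>
    simp only [Tab.height_zero, h, Nat.cast_add, Nat.cast_ite, Nat.cast_zero, Nat.cast_one,
      and_true]
    split_ifs <;> omega
  | succ j ih =>
    simp only [Tab.height_succ, ih, h, Nat.cast_add, Nat.cast_ite, Nat.cast_zero,
      Nat.cast_one, and_true]
    split_ifs <;> omega

theorem Tab.listPhi_word {n : ℕ} {s : Shape n} (T : Tab s) (x : Fin n) :
    ((letters n).listPhi x.succ T.word : ℤ) =
      (letters n).listEps x.succ T.word - T.height x s.r := by
  have key : ∀ c ≤ s.l, ((letters n).listEps x.succ (T.wordTo c) : ℤ) -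
      (letters n).listPhi x.succ (T.wordTo c) = T.colHeight x 0 - T.colHeight x c := by
    intro c hc
    induction c with
    | zero => simp [Tab.wordTo, Crystal.listEps, Crystal.listPhi]
    | succ c ih =>
      have h1 := ih (by omega)
      have h2 := T.colHeight_sub x (show c < s.l by omega)
      simp only [Tab.wordTo]
      rw [Crystal.listEps_sub_listPhi] at h1 h2 ⊢
      rw [List.map_append, List.sum_append]
      omega
  have h1 := key _ le_rfl
  have h2 := T.colHeight_count x s.r le_rfl
  rw [T.count_of_le le_rfl] at h2
  rw [← Tab.word_eq, T.colHeight_l, h2] at h1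
  omega

/-- The inverse of a step changes the last row where the height is maximal. -/
theorem Tab.exists_step_to {n : ℕ} {s : Shape n} {x : ℕ} (hx : x < n) (T : Tab s)
    (h : ∃ k, T.height x s.r < T.height x k) : ∃ k T', Step x k T' T := by
  classical
  have hmax : ∃ k, (∀ j, T.height x j ≤ T.height x k) ∧ ∀ j, k < j →
      T.height x j < T.height x k := by
    obtain ⟨k0, -, hk0⟩ := Finset.exists_max_image (Finset.range (s.r + 1)) (T.height x)
      ⟨0, by simp⟩
    have hle : ∀ j, T.height x j ≤ T.height x k0 := fun j => by
      by_cases hj : j ≤ s.r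
      · exact hk0 j (by simp; omega)
      · rw [T.height_of_le x j (by omega)]
        exact hk0 s.r (by simp)
    have hlt : ∀ j, s.r ≤ j → T.height x j < T.height x k0 := fun j hj => by
      obtain ⟨k, hk⟩ := h
      rw [T.height_of_le x j hj]
      exact hk.trans_le (hle k)
    obtain ⟨k, hk, hk'⟩ := Finset.exists_max_image
      ((Finset.range s.r).filter fun k => T.height x k = T.height x k0) id
      ⟨k0, by
        simp only [Finset.mem_filter, Finset.mem_range, and_true]
        by_contra hc
        exact lt_irrefl _ (hlt k0 (not_lt.1 hc))⟩
    simp only [Finset.mem_filter, Finset.mem_range, id, and_imp] at hk hk'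
    refine ⟨k, fun j => hk.2 ▸ hle j, fun j hj => ?_⟩
    rw [hk.2]
    refine lt_of_le_of_ne (hle j) fun he => ?_
    by_cases hjr : j < s.r
    · have := hk' j hjr he; omega
    · have := hlt j (by omega); omega
  obtain ⟨k, hk, hk'⟩ := hmax
  have h1 := hk' (k + 1) (by omega)
  rw [T.height_succ] at h1
  have e1 := T.count_mono (k + 1) (show x + 1 ≤ x + 2 by omega)
  have e2 := T.count_succ_le k x
  have e3 := T.count_mono k (show x ≤ x + 1 by omega)
  have hkr : k < s.r := by
    by_contra hc
    have := T.count_of_le (not_lt.1 hc) (x + 1)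
    have := T.count_of_le (not_lt.1 hc) x
    omega
  have hpos : 0 < T.count k (x + 1) := by omega
  suffices hT : ∃ T' : Tab s, ∀ j y,
      T'.count j y = T.count j y - if j = k ∧ y = x + 1 then 1 else 0 by
    obtain ⟨T', hT'⟩ := hT
    have hc : ∀ j y, T.count j y = T'.count j y + if j = k ∧ y = x + 1 then 1 else 0 := by
      intro j y
      rw [hT']
      split_ifs with h
      · rw [h.1, h.2]; omega
      · rfl
    have hh := Tab.height_of_count hc
    have k1 := hh k
    simp only [lt_irrefl, if_false, if_true] at k1
    have h0 : 0 ≤ T.height x 0 := by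
      rw [T.height_zero]
      have := T.count_mono 0 (show x + 1 ≤ x + 2 by omega)
      omega
    refine ⟨k, T', ?_, ?_, ?_, hc⟩
    · intro j hj
      have := hh j
      have := hk j
      simp only [hj, if_true] at *
      omega
    · intro j
      have := hh j
      have := hk j
      have := hk' j
      split_ifs at * <;> omega
    · have := hk 0
      omega
  apply Tab.exists_of_count
  · intro i y
    have := T.count_mono i (show y ≤ y + 1 by omega)
    by_cases hy : i = k ∧ y + 1 = x + 1
    · obtain ⟨rfl, hy⟩ := hy
      obtain rfl : y = x := by omega
      simp
      omega
    · simp only [hy, if_false]; omega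
  · intro i y
    have := T.count_succ_le i y
    by_cases hy : i = k ∧ y = x + 1
    · obtain ⟨rfl, rfl⟩ := hy
      simp
      have : T.count (i + 1) (x + 1 + 1) = T.count (i + 1) (x + 2) := rfl
      omega
    · simp only [hy, if_false]; omega
  · intro i y
    have := T.count_le i y
    omega
  · intro i hi
    have := T.count_top hi (show n < n + 1 by omega)
    simp [this, show n ≠ x by omega]
  · intro i
    simp [T.count_zero]
  · intro i y hi
    simp [T.count_of_le hi]

theorem classical_e_iff {n : ℕ} {s : Shape n} (x : Fin n) (T T' : Tab s) :
    (classical s).e x.succ T = some T' ↔ ∃ k, Step x k T T' := by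
  have hn : 1 ≤ n := by have := x.2; omega
  have h0 : (classical s).e x.succ T = some T' ↔
      (letters n).listE x.succ T.word = some T'.word :=
    Crystal.pull_eq_some Tab.word_injective
  rw [h0]
  constructor
  · intro h
    have h1 := (letters_regular hn).words.ε_of_e _ _ _ h
    change (letters n).listEps _ _ = _ at h1
    obtain ⟨k, hk⟩ := (T.listEps_word x).2
    obtain ⟨k, T'', hT⟩ := T.exists_step x.2 ⟨k, by omega⟩
    have h2 := hT.listE
    rw [h, Option.some.injEq] at h2
    rw [Tab.word_injective h2]
    exact ⟨k, hT⟩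
  · rintro ⟨k, h⟩
    exact h.listE

/-- A crystal with fewer or renamed colours. -/
def Crystal.reindex {I J B : Type} (g : J → I) (C : Crystal I B) : Crystal J B where
  e j := C.e (g j)
  f j := C.f (g j)
  ε j := C.ε (g j)
  φ j := C.φ (g j)

theorem classical_regular {n : ℕ} (s : Shape n) :
    ((classical s).reindex Fin.succ).Regular := by
  have hn : 1 ≤ n := s.one_le_r.trans s.r_le
  have hL := (letters_regular hn).words
  have hL' : ((letters n).words.reindex (Fin.succ (n := n))).Regular :=
    { e_iff := fun i => hL.e_iff _
      ε_of_e := fun i => hL.ε_of_e _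
      φ_of_e := fun i => hL.φ_of_e _
      exists_e := fun i => hL.exists_e _
      exists_f := fun i => hL.exists_f _ }
  have : (classical s).reindex Fin.succ =
      ((letters n).words.reindex (Fin.succ (n := n))).pullback (Tab.word (s := s)) := rfl
  rw [this]
  apply hL'.pullback Tab.word_injective
  · intro x T w h
    have h1 := hL'.ε_of_e _ _ _ h
    change (letters n).listEps _ _ = _ at h1
    obtain ⟨k, hk⟩ := (T.listEps_word x).2
    obtain ⟨k, T', hT⟩ := T.exists_step x.2 ⟨k, by omega⟩
    have h2 := hT.listE
    change (letters n).listE x.succ T.word = _ at h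
    rw [h, Option.some.injEq] at h2
    exact ⟨T', h2.symm⟩
  · intro x T w h
    have h1 := hL'.φ_of_e _ _ _ ((hL'.e_iff _ _ _).2 h)
    change (letters n).listPhi _ _ = _ at h1
    have h3 := T.listPhi_word x
    obtain ⟨k, hk⟩ := (T.listEps_word x).2
    obtain ⟨k, T', hT⟩ := T.exists_step_to x.2 ⟨k, by omega⟩
    have h2 : (letters n).listF x.succ T.word = some T'.word := (hL.e_iff _ _ _).1 hT.listE
    change (letters n).listF x.succ T.word = _ at h
    rw [h, Option.some.injEq] at h2
    exact ⟨T', h2.symm⟩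

theorem kr_e_succ {n : ℕ} {s : Shape n} (x : Fin n) (T : Tab s) :
    (kr s).e x.succ T = (classical s).e x.succ T := by
  simp [kr]

theorem kr_e_iff {n : ℕ} {s : Shape n} (x : Fin n) (T T' : Tab s) :
    (kr s).e x.succ T = some T' ↔ ∃ k, Step x k T T' := by
  rw [kr_e_succ, classical_e_iff]

theorem one_eq_succ {n : ℕ} (hn : 0 < n) : (1 : Fin (n + 1)) = (⟨0, hn⟩ : Fin n).succ := by
  apply Fin.ext
  simp
  omega

theorem kr_regular {n : ℕ} (s : Shape n) : (kr s).Regular := by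
  have hn : 0 < n := s.one_le_r.trans s.r_le
  obtain ⟨h1, h2, h3, h4, h5⟩ := classical_regular s
  simp only [Crystal.reindex] at h1 h2 h3 h4 h5
  obtain ⟨x₀, h0⟩ : ∃ x₀ : Fin n, (1 : Fin (n + 1)) = x₀.succ := ⟨_, one_eq_succ hn⟩
  constructor
  · intro i b b'
    cases i using Fin.cases with
    | zero =>
      have := h1 x₀ (Tab.pr s b) (Tab.pr s b')
      simp only [kr, if_true, h0, Option.map_eq_some_iff]
      constructor
      · rintro ⟨a, h, rfl⟩
        simp only [Equiv.apply_symm_apply] at this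
        exact ⟨_, by simpa using this.1 h, by simp⟩
      · rintro ⟨a, h, rfl⟩
        simp only [Equiv.apply_symm_apply] at this
        exact ⟨_, by simpa using this.2 h, by simp⟩
    | succ x => simpa [kr] using h1 x b b'
  · intro i b b'
    cases i using Fin.cases with
    | zero =>
      simp only [kr, if_true, h0, Option.map_eq_some_iff]
      rintro ⟨a, h, rfl⟩
      simpa using h2 x₀ _ _ h
    | succ x => simpa [kr] using h2 x b b'
  · intro i b b'
    cases i using Fin.cases with
    | zero =>
      simp only [kr, if_true, h0, Option.map_eq_some_iff]
      rintro ⟨a, h, rfl⟩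
      simpa using h3 x₀ _ _ h
    | succ x => simpa [kr] using h3 x b b'
  · intro i b
    cases i using Fin.cases with
    | zero =>
      simp only [kr, if_true, h0, Option.map_eq_some_iff]
      intro h
      obtain ⟨a, ha⟩ := h4 x₀ _ h
      exact ⟨_, a, ha, rfl⟩
    | succ x => simpa [kr] using h4 x b
  · intro i b
    cases i using Fin.cases with
    | zero =>
      simp only [kr, if_true, h0, Option.map_eq_some_iff]
      intro h
      obtain ⟨a, ha⟩ := h5 x₀ _ h
      exact ⟨_, a, ha, rfl⟩
    | succ x => simpa [kr] using h5 x b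

theorem kr_ε {n : ℕ} {s : Shape n} (x : Fin n) (T : Tab s) :
    (∀ k, T.height x k ≤ (kr s).ε x.succ T) ∧ ∃ k, T.height x k = (kr s).ε x.succ T := by
  have : (kr s).ε x.succ T = (letters n).listEps x.succ T.word := by simp [kr]; rfl
  rw [this]
  exact T.listEps_word x

theorem kr_φ {n : ℕ} {s : Shape n} (x : Fin n) (T : Tab s) :
    ((kr s).φ x.succ T : ℤ) = (kr s).ε x.succ T - T.height x s.r := by
  have : (kr s).ε x.succ T = (letters n).listEps x.succ T.word := by simp [kr]; rfl
  rw [this]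
  have : (kr s).φ x.succ T = (letters n).listPhi x.succ T.word := by simp [kr]; rfl
  rw [this]
  exact T.listPhi_word x

theorem kr_e_zero {n : ℕ} {s : Shape n} (T : Tab s) :
    (kr s).e 0 T = ((kr s).e 1 (Tab.pr s T)).map (Tab.pr s).symm := by
  have hn : 0 < n := s.one_le_r.trans s.r_le
  simp only [kr, one_eq_succ hn, if_true, Fin.succ_ne_zero, if_false]

/-! ### Promotion and the classical Kashiwara operators -/

namespace Tab

variable {n : ℕ} {s : Shape n}

theorem count_bk_self (x : Fin n) (T : Tab s) (k : ℕ) :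
    (T.bk x).count k (x + 1) = T.bkMid x k := by
  by_cases hk : k < s.r
  · exact T.count_bk_mid x ⟨k, hk⟩
  · have h1 := s.one_le_r
    have h2 := T.bkMid_le x k
    have h3 := T.bkHi_le x k
    rw [T.count_of_le (not_lt.1 hk)] at h3
    rw [count_of_le _ (not_lt.1 hk)]
    omega

theorem count_bk_zero (x : Fin n) (T : Tab s) :
    ((T.bk x).count 0 (x + 1) : ℤ) =
      max (T.count 0 x : ℤ) (T.count 1 (x + 2)) + T.count 0 (x + 2) - T.count 0 (x + 1) := by
  rw [count_bk_self]
  have h1 := T.le_bkHi x 0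
  unfold bkMid
  unfold bkHi at *
  unfold bkLo at *
  simp only [if_true, zero_add] at *
  omega

theorem count_bk_succ (x : Fin n) (T : Tab s) (k : ℕ) :
    ((T.bk x).count (k + 1) (x + 1) : ℤ) =
      max (T.count (k + 1) x : ℤ) (T.count (k + 2) (x + 2)) +
        min (T.count (k + 1) (x + 2) : ℤ) (T.count k x) - T.count (k + 1) (x + 1) := by
  rw [count_bk_self]
  have h1 := T.le_bkHi x (k + 1)
  unfold bkMid
  unfold bkHi at *
  unfold bkLo at *
  simp only [Nat.add_eq_zero_iff, one_ne_zero, and_false, if_false, Nat.add_sub_cancel,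
    show k + 1 + 1 = k + 2 by omega] at *
  omega

theorem height_bk_of_far {x y : Fin n} (h : (y : ℕ) + 2 ≤ x ∨ (x : ℕ) + 2 ≤ y) (T : Tab s)
    (k : ℕ) : (T.bk y).height x k = T.height x k := by
  apply height_congr <;> intro k <;> apply count_bk_ne <;> omega

/-- The heights of `t_x t_{x+1} T` for the letters `x + 1`, `x + 2` in terms of the heights of `T`
for the letters `x`, `x + 1`. -/
theorem height_bk_bk {x y : Fin n} (hy : (y : ℕ) = x + 1) (T : Tab s) :
    ((T.bk y).bk x).height y 0 =
      T.height x 0 - max 0 ((T.count 1 (x + 3) : ℤ) - T.count 0 (x + 1)) ∧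
    ∀ k, ((T.bk y).bk x).height y (k + 1) =
      max (T.height x (k + 1) - max 0 ((T.count (k + 2) (x + 3) : ℤ) - T.count (k + 1) (x + 1)))
        (T.height x k - max 0 ((T.count k (x + 1) : ℤ) - T.count (k + 1) (x + 3))) := by
  have cy0 := count_bk_zero y T
  have cyk := count_bk_succ y T
  have cx0 := count_bk_zero x (T.bk y)
  have cxk := count_bk_succ x (T.bk y)
  simp only [hy, show (x : ℕ) + 1 + 1 = x + 2 by omega, show (x : ℕ) + 1 + 2 = x + 3 by omega]
    at cy0 cyk ⊢
  have e0 : ∀ k, (T.bk y).count k x = T.count k x := fun k => T.count_bk_ne y k _ (by omega)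
  have e1 : ∀ k, (T.bk y).count k (x + 1) = T.count k (x + 1) :=
    fun k => T.count_bk_ne y k _ (by omega)
  have e2 : ∀ k, ((T.bk y).bk x).count k (x + 2) = (T.bk y).count k (x + 2) :=
    fun k => count_bk_ne x _ k _ (by omega)
  have e3 : ∀ k, ((T.bk y).bk x).count k (x + 3) = T.count k (x + 3) := fun k => by
    rw [count_bk_ne x _ k _ (by omega), count_bk_ne y _ k _ (by omega)]
  have hz := ((T.bk y).bk x).height_zero (x + 1)
  have hs := ((T.bk y).bk x).height_succ (x + 1)
  have hz' := T.height_zero x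
  have hs' := T.height_succ x
  simp only [show (x : ℕ) + 1 + 1 = x + 2 by omega, show (x : ℕ) + 1 + 2 = x + 3 by omega,
    e0, e1, e2, e3] at hz hs cx0 cxk
  have h0 : ((T.bk y).bk x).height (x + 1) 0 =
      T.height x 0 - max 0 ((T.count 1 (x + 3) : ℤ) - T.count 0 (x + 1)) := by
    omega
  refine ⟨h0, fun k => ?_⟩
  have key : ((T.bk y).bk x).height (x + 1) (k + 1) = T.height x (k + 1) -
      max 0 ((T.count (k + 2) (x + 3) : ℤ) - T.count (k + 1) (x + 1)) +
      max 0 (((T.bk y).count (k + 1) (x + 2) : ℤ) - T.count k x) := by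
    induction k with
    | zero =>
      have a1 := cyk 0
      have a2 := hs 0
      have a3 := hs' 0
      simp only [zero_add] at *
      omega
    | succ k ih =>
      have a1 := cyk k
      have a2 := hs (k + 1)
      have a3 := hs' (k + 1)
      have a4 := cyk (k + 1)
      have a5 := cxk k
      simp only [show k + 1 + 1 = k + 2 by omega, show k + 1 + 2 = k + 3 by omega] at *
      omega
  have a1 := cyk k
  have a2 := hs' k
  omega

end Tab

theorem Step.bk_of_far {n : ℕ} {s : Shape n} {x y : Fin n} {k : ℕ} {T T' : Tab s}
    (h : (y : ℕ) + 2 ≤ x ∨ (x : ℕ) + 2 ≤ y) (hT : Step x k T T') :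
    Step x k (T.bk y) (T'.bk y) := by
  have e : ∀ j z, (z : ℕ) ≠ x + 1 → T'.count j z = T.count j z := fun j z hz =>
    hT.count_ne j hz
  refine ⟨?_, ?_, ?_, ?_⟩
  · simpa only [Tab.height_bk_of_far h] using hT.1
  · simpa only [Tab.height_bk_of_far h] using hT.2.1
  · simpa only [Tab.height_bk_of_far h] using hT.2.2.1
  · intro j z
    by_cases hz : z = y + 1
    · subst hz
      rw [Tab.count_bk_self, Tab.count_bk_self]
      simp only [Tab.bkMid, Tab.bkLo, Tab.bkHi]
      rw [e _ y (by omega), e _ (y + 1) (by omega), e _ (y + 2) (by omega), e _ (y + 2) (by omega),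
        e _ y (by omega), if_neg (show ¬ (j = k ∧ (y : ℕ) + 1 = x + 1) by omega)]
      rfl
    · rw [Tab.count_bk_ne _ _ _ _ hz, Tab.count_bk_ne _ _ _ _ hz, hT.2.2.2]

/-- `b'` is obtained from the row `b` of a Gelfand-Tsetlin pattern by the toggle with respect to
the neighbouring rows `a` and `c`. -/
def IsToggle (a b c b' : ℕ → ℤ) : Prop :=
  b' 0 = max (a 0) (c 1) + c 0 - b 0 ∧
    ∀ k, b' (k + 1) = max (a (k + 1)) (c (k + 2)) + min (c (k + 1)) (a k) - b (k + 1)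

theorem Tab.isToggle_bk {n : ℕ} {s : Shape n} (x : Fin n) (T : Tab s) :
    IsToggle (fun k => T.count k x) (fun k => T.count k (x + 1)) (fun k => T.count k (x + 2))
      (fun k => (T.bk x).count k (x + 1)) :=
  ⟨T.count_bk_zero x, T.count_bk_succ x⟩

namespace IsToggle

variable {a a' b b' c c' p p' : ℕ → ℤ} {k : ℕ}

theorem add_low_of_le (h : IsToggle a b c p) (h' : IsToggle a' b c p')
    (ha : ∀ j, a' j = a j + if j = k then 1 else 0) (hk : c (k + 1) ≤ a k) (j : ℕ) :
    p' j = p j + if j = k then 1 else 0 := by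
  cases j with
  | zero =>
    rw [h.1, h'.1, ha]
    split_ifs with h1
    · subst h1; simp only [zero_add] at hk; omega
    · omega
  | succ j =>
    rw [h.2, h'.2, ha, ha]
    split_ifs with h1 h2 h2
    · omega
    · subst h1; simp only [show j + 1 + 1 = j + 2 by omega] at hk; omega
    · subst h2; omega
    · omega

theorem add_low_of_lt (h : IsToggle a b c p) (h' : IsToggle a' b c p')
    (ha : ∀ j, a' j = a j + if j = k then 1 else 0) (hk : a k < c (k + 1)) (j : ℕ) :
    p' j = p j + if j = k + 1 then 1 else 0 := by
  cases j with
  | zero =>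
    rw [h.1, h'.1, ha, if_neg (show ¬ (0 = k + 1) by omega)]
    split_ifs with h1
    · subst h1; simp only [zero_add] at hk; omega
    · omega
  | succ j =>
    rw [h.2, h'.2, ha, ha]
    simp only [Nat.add_right_cancel_iff]
    split_ifs with h1 h2 h2
    · omega
    · subst h1; simp only [show j + 1 + 1 = j + 2 by omega] at hk; omega
    · subst h2; omega
    · omega

theorem add_mid_of_lt (h : IsToggle a b c p) (h' : IsToggle a b' c' p')
    (hb : ∀ j, b' j = b j + if j = k then 1 else 0)
    (hc : ∀ j, c' j = c j + if j = k then 1 else 0) (hk : ∀ j, k = j + 1 → c k < a j) (j : ℕ) :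
    p' j = p j := by
  cases j with
  | zero =>
    rw [h.1, h'.1, hb, hc, hc]
    split_ifs with h1 h2 h2
    · omega
    · subst h1; have := hk 0 rfl; omega
    · subst h2; omega
    · omega
  | succ j =>
    rw [h.2, h'.2, hb, hc, hc]
    have h3 := hk j
    have h4 := hk (j + 1)
    split_ifs with h1 h2 h2
    · omega
    · subst h1; have := h4 rfl; simp only [show j + 1 + 1 = j + 2 by omega] at *; omega
    · subst h2; have := h3 rfl; omega
    · omega

theorem add_mid_of_le (h : IsToggle a b c p) (h' : IsToggle a b' c' p')
    (hb : ∀ j, b' j = b j + if j = k then 1 else 0)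
    (hc : ∀ j, c' j = c j + if j = k + 1 then 1 else 0) (hk : a k ≤ c (k + 1)) (j : ℕ) :
    p' j = p j := by
  cases j with
  | zero =>
    rw [h.1, h'.1, hb, hc, hc, if_neg (show ¬ (0 = k + 1) by omega)]
    simp only [show (1 = k + 1) ↔ (0 = k) by omega]
    split_ifs with h1
    · subst h1; simp only [zero_add] at hk; omega
    · omega
  | succ j =>
    rw [h.2, h'.2, hb, hc, hc]
    simp only [show (j + 2 = k + 1) ↔ (j + 1 = k) by omega, Nat.add_right_cancel_iff]
    split_ifs with h1 h2 h2
    · omega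
    · subst h1; simp only [show j + 1 + 1 = j + 2 by omega] at hk; omega
    · subst h2; omega
    · omega

end IsToggle

theorem Step.bk_bk {n : ℕ} {s : Shape n} {x y : Fin n} {k : ℕ} {T T' : Tab s}
    (hy : (y : ℕ) = x + 1) (hT : Step x k T T') :
    ∃ k', Step y k' ((T.bk y).bk x) ((T'.bk y).bk x) := by
  obtain ⟨h0, hk⟩ := Tab.height_bk_bk hy T
  obtain ⟨s1, s2, s3, s4⟩ := hT
  have b1 : ∀ j, ((T.bk y).bk x).height y j ≤ T.height x k := by
    intro j
    cases j with
    | zero => have := s2 0; omega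
    | succ j => have := s2 j; have := s2 (j + 1); have := hk j; omega
  have b2 : ∀ j < k, ((T.bk y).bk x).height y j < T.height x k := by
    intro j hj
    cases j with
    | zero => have := s1 0 hj; omega
    | succ j => have := s1 j (by omega); have := s1 (j + 1) hj; have := hk j; omega
  have ne2 : ∀ j z, z ≠ (x : ℕ) + 1 → z ≠ (x : ℕ) + 2 →
      ((T'.bk y).bk x).count j z = ((T.bk y).bk x).count j z := by
    intro j z h1 h2
    rw [Tab.count_bk_ne x _ _ _ h1, Tab.count_bk_ne x _ _ _ h1,
      Tab.count_bk_ne y _ _ _ (by omega), Tab.count_bk_ne y _ _ _ (by omega), s4]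
    simp [h1]
  have ca : ∀ j, T'.count j x = T.count j x := fun j => by rw [s4]; simp
  have cb : ∀ j, T'.count j (x + 1) = T.count j (x + 1) + if j = k then 1 else 0 := fun j => by
    rw [s4]; simp
  have cc : ∀ j, T'.count j (x + 2) = T.count j (x + 2) := fun j => by rw [s4]; simp
  have cd : ∀ j, T'.count j (x + 3) = T.count j (x + 3) := fun j => by rw [s4]; simp
  have e0 : ∀ (T : Tab s) k, (T.bk y).count k x = T.count k x :=
    fun T k => T.count_bk_ne y k _ (by omega)
  have e1 : ∀ (T : Tab s) k, (T.bk y).count k (x + 1) = T.count k (x + 1) :=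
    fun T k => T.count_bk_ne y k _ (by omega)
  have e2 : ∀ (T : Tab s) k, ((T.bk y).bk x).count k (x + 2) = (T.bk y).count k (x + 2) :=
    fun T k => Tab.count_bk_ne x _ k _ (by omega)
  have ty := T.isToggle_bk y
  have ty' := T'.isToggle_bk y
  have tx := (T.bk y).isToggle_bk x
  have tx' := (T'.bk y).isToggle_bk x
  simp only [hy, show (x : ℕ) + 1 + 1 = x + 2 by omega, show (x : ℕ) + 1 + 2 = x + 3 by omega,
    e0, e1, ca, cc, cd] at ty ty' tx tx' h0 hk b1 b2
  -- The new step is in the row `k` or `k + 1`, according to which of the two terms depending on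
  -- the changed letter is active in the formula for `t_{x+1}`.
  by_cases hc : T.count (k + 1) (x + 3) ≤ T.count k (x + 1)
  · have hmax : ((T.bk y).bk x).height (x + 1) k = T.height x k := by
      cases k with
      | zero => simp only [zero_add] at *; omega
      | succ k =>
        have := s1 k (by omega)
        have := hk k
        simp only [show k + 1 + 1 = k + 2 by omega] at *
        omega
    refine ⟨k, ?_, ?_, ?_, ?_⟩
    · intro j hj; rw [hy, hmax]; exact b2 j hj
    · intro j; rw [hy, hmax]; exact b1 j
    · rw [hy, hmax]; exact s3
    · -- Here `γ'_k < α_{k-1}`, so that the row changed by `t_x` stays the same.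
      have hlt : ∀ j, k = j + 1 → ((T.bk y).count k (x + 2) : ℤ) < T.count j x := by
        rintro j rfl
        have := s1 j (by omega)
        have := T.height_succ x j
        have := ty.2 j
        simp only [show j + 1 + 1 = j + 2 by omega] at *
        omega
      have cb' : ∀ j, (T'.count j (x + 1) : ℤ) = T.count j (x + 1) + if j = k then 1 else 0 :=
        fun j => by rw [cb]; push_cast; rfl
      have hg := IsToggle.add_low_of_le ty ty' cb' (by exact_mod_cast hc)
      have hp := IsToggle.add_mid_of_lt tx tx' cb' hg hlt
      intro j z
      rw [hy]
      by_cases hz2 : z = x + 2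
      · subst hz2
        have := hg j
        rw [e2, e2]
        simp only [show (x : ℕ) + 1 + 1 = x + 2 by omega, and_true]
        split_ifs at this ⊢ <;> omega
      by_cases hz1 : z = x + 1
      · subst hz1
        rw [if_neg (by omega)]
        exact_mod_cast hp j
      · rw [ne2 j z hz1 hz2, if_neg (by omega)]; rfl
  · have hmax : ((T.bk y).bk x).height (x + 1) (k + 1) = T.height x k := by
      have := hk k
      have := s2 (k + 1)
      omega
    refine ⟨k + 1, ?_, ?_, ?_, ?_⟩
    · intro j hj
      rw [hy, hmax]
      rcases Nat.lt_succ_iff_lt_or_eq.1 hj with h | rfl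
      · exact b2 j h
      · cases j with
        | zero => simp only [zero_add] at *; omega
        | succ j =>
          have := s1 j (by omega)
          have := hk j
          simp only [show j + 1 + 1 = j + 2 by omega] at *
          omega
    · intro j; rw [hy, hmax]; exact b1 j
    · rw [hy, hmax]; exact s3
    · -- Here `γ'_{k+1} ≥ α_k`, so that the row changed by `t_x` stays the same.
      have hle : (T.count k x : ℤ) ≤ (T.bk y).count (k + 1) (x + 2) := by
        have := s2 (k + 1)
        have := T.height_succ x k
        have := ty.2 k
        simp only at this
        omega
      have cb' : ∀ j, (T'.count j (x + 1) : ℤ) = T.count j (x + 1) + if j = k then 1 else 0 :=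
        fun j => by rw [cb]; push_cast; rfl
      have hg := IsToggle.add_low_of_lt ty ty' cb' (by exact_mod_cast not_le.1 hc)
      have hp := IsToggle.add_mid_of_le tx tx' cb' hg hle
      intro j z
      rw [hy]
      by_cases hz2 : z = x + 2
      · subst hz2
        have := hg j
        rw [e2, e2]
        simp only [show (x : ℕ) + 1 + 1 = x + 2 by omega, and_true]
        split_ifs at this ⊢ <;> omega
      by_cases hz1 : z = x + 1
      · subst hz1
        rw [if_neg (by omega)]
        exact_mod_cast hp j
      · rw [ne2 j z hz1 hz2, if_neg (by omega)]; rfl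

/-- The composite `t_{j+1} t_{j+2} ⋯ t_n` of Bender-Knuth involutions. -/
def Tab.prTail {n : ℕ} (s : Shape n) (j : ℕ) : Equiv.Perm (Tab s) :=
  (((List.finRange n).drop j).map (Tab.bkPerm s)).prod

namespace Tab

variable {n : ℕ} {s : Shape n}

theorem prTail_zero : prTail s 0 = pr s := rfl

theorem prTail_of_le {j : ℕ} (hj : n ≤ j) (T : Tab s) : prTail s j T = T := by
  simp [prTail, List.drop_eq_nil_of_le, hj]

theorem prTail_eq {j : ℕ} (hj : j < n) (T : Tab s) :
    prTail s j T = (prTail s (j + 1) T).bk ⟨j, hj⟩ := by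
  unfold prTail
  rw [List.drop_eq_getElem_cons (by simpa using hj)]
  simp only [List.map_cons, List.prod_cons, Equiv.Perm.mul_apply, List.getElem_finRange]
  rfl

theorem count_prTail_of_le {j y : ℕ} (hy : y ≤ j) (T : Tab s) (k : ℕ) :
    (prTail s j T).count k y = T.count k y := by
  by_cases hj : j ≤ n
  · induction hj using Nat.decreasingInduction with
    | self => rw [prTail_of_le le_rfl]
    | of_succ j hj ih =>
      rw [prTail_eq hj, count_bk_ne _ _ _ _ (by simp; omega), ih (by omega)]
  · rw [prTail_of_le (by omega)]

/-- The number of all letters `< y` in a tableau. -/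
def size (T : Tab s) (y : ℕ) : ℕ := ∑ k ∈ Finset.range s.r, T.count k y

theorem size_top (T : Tab s) {y : ℕ} (hy : n < y) : T.size y = s.r * s.l := by
  unfold size
  rw [Finset.sum_congr rfl fun k hk => T.count_top (Finset.mem_range.1 hk) hy]
  simp

theorem size_zero (T : Tab s) : T.size 0 = 0 := by
  simp [size, count_zero]

theorem size_mono (T : Tab s) {y z : ℕ} (h : y ≤ z) : T.size y ≤ T.size z :=
  Finset.sum_le_sum fun k _ => T.count_mono k h

theorem size_bk_ne (x : Fin n) (T : Tab s) {y : ℕ} (hy : y ≠ x + 1) :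
    (T.bk x).size y = T.size y := by
  unfold size
  exact Finset.sum_congr rfl fun k _ => T.count_bk_ne x k y hy

theorem size_bk_self (x : Fin n) (T : Tab s) :
    (T.bk x).size (x + 1) + T.size (x + 1) = T.size x + T.size (x + 2) := by
  -- The letters `x + 1` of the row `k + 1` which are below a letter `x` are counted once in the
  -- row `k` and once in the row `k + 1`.
  have key : ∀ m, ((∑ k ∈ Finset.range (m + 1), (T.bk x).count k (x + 1) : ℕ) : ℤ) +
      (∑ k ∈ Finset.range (m + 1), T.count k (x + 1) : ℕ) =
      (∑ k ∈ Finset.range (m + 1), T.count k x : ℕ) +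
      (∑ k ∈ Finset.range (m + 1), T.count k (x + 2) : ℕ) +
      max 0 ((T.count (m + 1) (x + 2) : ℤ) - T.count m x) := by
    intro m
    induction m with
    | zero =>
      have := T.count_bk_zero x
      simp
      omega
    | succ m ih =>
      have := T.count_bk_succ x m
      rw [Finset.sum_range_succ, Finset.sum_range_succ _ (m + 1), Finset.sum_range_succ _ (m + 1),
        Finset.sum_range_succ _ (m + 1)]
      push_cast at ih ⊢
      simp only [show m + 1 + 1 = m + 2 by omega] at *
      omega
  have h1 := s.one_le_r
  have h2 := key (s.r - 1)
  rw [Nat.sub_add_cancel h1, T.count_of_le le_rfl] at h2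
  unfold size
  omega

theorem size_prTail {j y : ℕ} (hj : j ≤ n) (hy : j < y) (hyn : y ≤ n + 1) (T : Tab s) :
    (prTail s j T).size y + T.size n = T.size (y - 1) + T.size (n + 1) := by
  induction hj using Nat.decreasingInduction generalizing y with
  | self =>
    rw [prTail_of_le le_rfl]
    obtain rfl : y = n + 1 := by omega
    simp [add_comm]
  | of_succ j hj ih =>
    rw [prTail_eq hj]
    by_cases h : y = j + 1
    · subst h
      have h1 := (prTail s (j + 1) T).size_bk_self ⟨j, hj⟩
      have h2 : (prTail s (j + 1) T).size (j + 1) = T.size (j + 1) :=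
        Finset.sum_congr rfl fun k _ => count_prTail_of_le le_rfl T k
      have h3 : (prTail s (j + 1) T).size j = T.size j :=
        Finset.sum_congr rfl fun k _ => count_prTail_of_le (by omega) T k
      have h4 := ih (y := j + 2) (by omega) (by omega)
      simp only [show j + 2 - 1 = j + 1 by omega] at h4
      simp only at h1
      simp only [Nat.add_sub_cancel]
      omega
    · rw [size_bk_ne _ _ (by simpa using h)]
      exact ih (by omega) hyn

/-- Promotion rotates the content. -/
theorem size_pr {y : ℕ} (hy : y ≤ n) (T : Tab s) :
    (pr s T).size (y + 1) + T.size n = T.size y + T.size (n + 1) :=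
  size_prTail (Nat.zero_le n) (Nat.succ_pos y) (by omega) T

end Tab

/-- A map which preserves steps up to renaming the letters intertwines Kashiwara operators. -/
theorem kr_e_map {n : ℕ} {s : Shape n} {x y : Fin n} (g : Tab s → Tab s)
    (h1 : ∀ k T T', Step x k T T' → ∃ k', Step y k' (g T) (g T'))
    (h2 : ∀ T, (∀ k, T.height x k ≤ 0) → ∀ k, (g T).height y k ≤ 0) (T : Tab s) :
    (kr s).e y.succ (g T) = ((kr s).e x.succ T).map g := by
  cases hT : (kr s).e x.succ T with
  | some T' =>
    obtain ⟨k, hk⟩ := (kr_e_iff x T T').1 hT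
    obtain ⟨k', hk'⟩ := h1 k T T' hk
    exact (kr_e_iff y _ _).2 ⟨k', hk'⟩
  | none =>
    rw [(kr_regular s).e_none] at hT
    rw [Option.map_none, (kr_regular s).e_none]
    obtain ⟨k, hk⟩ := (kr_ε y (g T)).2
    have := h2 T (fun k => by have := (kr_ε x T).1 k; omega) k
    omega

theorem kr_e_bk_of_far {n : ℕ} {s : Shape n} {x y : Fin n}
    (h : (y : ℕ) + 2 ≤ x ∨ (x : ℕ) + 2 ≤ y) (T : Tab s) :
    (kr s).e x.succ (T.bk y) = ((kr s).e x.succ T).map (Tab.bk y) :=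
  kr_e_map (Tab.bk y) (fun k _ _ hT => ⟨k, hT.bk_of_far h⟩)
    (fun T hT k => by rw [Tab.height_bk_of_far h]; exact hT k) T

theorem kr_e_bk_bk {n : ℕ} {s : Shape n} {x y : Fin n} (h : (y : ℕ) = x + 1) (T : Tab s) :
    (kr s).e y.succ ((T.bk y).bk x) = ((kr s).e x.succ T).map fun T => (T.bk y).bk x := by
  refine kr_e_map (fun T => (T.bk y).bk x) (fun k _ _ hT => hT.bk_bk h) (fun T hT k => ?_) T
  obtain ⟨h0, hk⟩ := Tab.height_bk_bk h T
  cases k with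
  | zero => have := hT 0; omega
  | succ k => have := hT k; have := hT (k + 1); have := hk k; omega

theorem kr_e_prTail_of_lt {n : ℕ} {s : Shape n} {x : Fin n} {j : ℕ} (h : (x : ℕ) + 2 ≤ j)
    (T : Tab s) :
    (kr s).e x.succ (Tab.prTail s j T) = ((kr s).e x.succ T).map (Tab.prTail s j) := by
  by_cases hj : j ≤ n
  · induction hj using Nat.decreasingInduction with
    | self =>
      have : (⇑(Tab.prTail s n)) = id := funext fun T => Tab.prTail_of_le le_rfl T
      rw [this]; simp
    | of_succ j hj ih =>
      have : (⇑(Tab.prTail s j)) = Tab.bk ⟨j, hj⟩ ∘ Tab.prTail s (j + 1) :=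
        funext fun T => Tab.prTail_eq hj T
      rw [this, Function.comp_apply, kr_e_bk_of_far (Or.inr h), ih (by omega), Option.map_map]
  · have : (⇑(Tab.prTail s j)) = id := funext fun T => Tab.prTail_of_le (by omega) T
    rw [this]; simp

theorem kr_e_prTail {n : ℕ} {s : Shape n} {x y : Fin n} (hy : (y : ℕ) = x + 1) {j : ℕ}
    (h : j ≤ x) (T : Tab s) :
    (kr s).e y.succ (Tab.prTail s j T) = ((kr s).e x.succ T).map (Tab.prTail s j) := by
  obtain ⟨y, hyn⟩ := y
  obtain rfl : y = x + 1 := hy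
  induction h using Nat.decreasingInduction with
  | self =>
    have : (⇑(Tab.prTail s x)) =
        (fun T => (T.bk ⟨x + 1, hyn⟩).bk x) ∘ Tab.prTail s (x + 2) := by
      funext T
      rw [Tab.prTail_eq x.2, Function.comp_apply, Tab.prTail_eq hyn]
    rw [this, Function.comp_apply, kr_e_bk_bk rfl, kr_e_prTail_of_lt le_rfl, Option.map_map]
  | of_succ j hj ih =>
    have hjn : j < n := hj.trans x.2
    have : (⇑(Tab.prTail s j)) = Tab.bk ⟨j, hjn⟩ ∘ Tab.prTail s (j + 1) :=
      funext fun T => Tab.prTail_eq hjn T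
    rw [this, Function.comp_apply, kr_e_bk_of_far (Or.inl (by simp only; omega)), ih,
      Option.map_map]

theorem kr_e_pr_succ {n : ℕ} {s : Shape n} {x y : Fin n} (hy : (y : ℕ) = x + 1) (T : Tab s) :
    (kr s).e y.succ (Tab.pr s T) = ((kr s).e x.succ T).map (Tab.pr s) :=
  kr_e_prTail hy (Nat.zero_le _) T

/-! ### The square of the promotion operator -/

section Steps

variable {n : ℕ} {s : Shape n} {x k : ℕ} {T T' : Tab s}

/-- The row of a step is the last row where the height of the result is maximal. -/
theorem Step.height_lt (h : Step x k T T') {j : ℕ} (hj : k < j) :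
    T'.height x j < T'.height x k := by
  have h1 := Tab.height_of_count h.2.2.2 j
  have h2 := Tab.height_of_count h.2.2.2 k
  have h3 := h.2.1 j
  simp only [show ¬ j < k by omega, show ¬ j = k by omega, lt_irrefl, if_false, if_true] at h1 h2
  omega

theorem Step.height_le (h : Step x k T T') (j : ℕ) : T'.height x j ≤ T'.height x k := by
  rcases lt_trichotomy j k with hj | rfl | hj
  · have h1 := Tab.height_of_count h.2.2.2 j
    have h2 := Tab.height_of_count h.2.2.2 k
    have h3 := h.1 j hj
    simp only [hj, lt_irrefl, if_false, if_true] at h1 h2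
    omega
  · exact le_rfl
  · exact (h.height_lt hj).le

theorem Step.lt_r (h : Step x k T T') : k < s.r := by
  by_contra hc
  have e1 := h.count_self
  rw [T.count_of_le (not_lt.1 hc), T'.count_of_le (not_lt.1 hc)] at e1
  omega

theorem Step.size_self (h : Step x k T T') : T'.size (x + 1) = T.size (x + 1) + 1 := by
  unfold Tab.size
  rw [Finset.sum_congr rfl fun j _ => h.2.2.2 j (x + 1), Finset.sum_add_distrib]
  simp [h.lt_r]

theorem Step.size_ne (h : Step x k T T') {y : ℕ} (hy : y ≠ x + 1) : T'.size y = T.size y :=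
  Finset.sum_congr rfl fun _ _ => h.count_ne _ hy

/-- Induction along steps with letters from a given set, which end at tableaux of highest weight
with respect to these letters. -/
theorem Step.induction {P : Tab s → Prop} (q : Fin n → Prop)
    (h0 : ∀ T : Tab s, (∀ x, q x → ∀ k, T.height x k ≤ 0) → P T)
    (h1 : ∀ (x : Fin n) k (T T' : Tab s), q x → Step x k T T' → P T' → P T) (T : Tab s) :
    P T := by
  have key : ∀ N (T : Tab s), (n + 1) * (s.r * s.l) ≤ N + ∑ y ∈ Finset.range (n + 1), T.size y →
      P T := by
    intro N
    induction N with
    | zero =>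
      intro T hT
      apply h0
      intro x _
      by_contra hc
      push Not at hc
      obtain ⟨k, T', hk⟩ := T.exists_step x.2 hc
      have h2 : ∑ y ∈ Finset.range (n + 1), T.size y < ∑ y ∈ Finset.range (n + 1), T'.size y := by
        apply Finset.sum_lt_sum
        · intro y _
          by_cases hy : y = x + 1
          · subst hy; rw [hk.size_self]; omega
          · rw [hk.size_ne hy]
        · exact ⟨x + 1, by simp, by rw [hk.size_self]; omega⟩
      have h3 : ∑ y ∈ Finset.range (n + 1), T'.size y ≤ (n + 1) * (s.r * s.l) := by
        refine (Finset.sum_le_card_nsmul _ _ (s.r * s.l) fun y hy => ?_).trans (by simp)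
        rw [← T'.size_top (Nat.lt_succ_self n)]
        exact T'.size_mono (Finset.mem_range.1 hy).le
      omega
    | succ N ih =>
      intro T hT
      by_cases hc : ∀ x, q x → ∀ k, T.height x k ≤ 0
      · exact h0 T hc
      · push Not at hc
        obtain ⟨x, hx, hc⟩ := hc
        obtain ⟨k, T', hk⟩ := T.exists_step x.2 hc
        refine h1 x k T T' hx hk (ih T' ?_)
        have h2 : ∑ y ∈ Finset.range (n + 1), T.size y <
            ∑ y ∈ Finset.range (n + 1), T'.size y := by
          apply Finset.sum_lt_sum
          · intro y _
            by_cases hy : y = x + 1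
            · subst hy; rw [hk.size_self]; omega
            · rw [hk.size_ne hy]
          · exact ⟨x + 1, by simp, by rw [hk.size_self]; omega⟩
        omega
  exact key _ T (Nat.le_add_right _ _)

end Steps

namespace Tab

variable {n : ℕ} {s : Shape n}

/-- If the letters `< N` of a tableau form a tableau of highest weight, then each row `k` of the
latter consists of letters `k`. -/
theorem count_of_height_le {N : ℕ} (T : Tab s)
    (h : ∀ x, x + 2 ≤ N → ∀ k, T.height x k ≤ 0) {k y : ℕ} (hky : k < y) (hy : y ≤ N) :
    T.count k y = T.count k N := by
  have step : ∀ y, y + 1 ≤ N → ∀ k < y, T.count k y = T.count k (y + 1) := by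
    intro y
    induction y with
    | zero => intro _ k hk; omega
    | succ y ih =>
      intro hy
      have ih := ih (by omega)
      have hh := h y hy
      have hc : ∀ k, k < y + 1 → T.count k (y + 1) = T.count k (y + 2) ∧ 0 ≤ T.height y k := by
        intro k
        have := T.count_mono k (show y + 1 ≤ y + 2 by omega)
        induction k with
        | zero =>
          intro _
          have := hh 0
          rw [T.height_zero] at this ⊢
          omega
        | succ k ihk =>
          intro hk
          have h1 := ihk (T.count_mono k (show y + 1 ≤ y + 2 by omega)) (by omega)
          have h2 := hh (k + 1)
          have h3 := ih k (by omega)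
          rw [T.height_succ] at h2 ⊢
          omega
      exact fun k hk => (hc k hk).1
  induction N, hy using Nat.le_induction with
  | base => rfl
  | succ N hN ih =>
    rw [ih (fun x hx => h x (by omega)) (fun y hy => step y (by omega)), step N le_rfl k (by omega)]

/-- If the letters `≥ 2` of a tableau form a skew tableau of highest weight, then the tableau is
determined by the shape formed by its letters `0`, `1`. -/
theorem count_of_height_le_above (T : Tab s)
    (h : ∀ x, 2 ≤ x → x < n → ∀ k, T.height x k ≤ 0) :
    (∀ y, 3 ≤ y → T.count 0 y = s.l) ∧
    ∀ k y, k + 1 < s.r → 2 ≤ y → T.count (k + 1) (y + 1) = T.count k y := by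
  have h1 : ∀ y, 3 ≤ y → T.count 0 y = s.l := by
    intro y hy
    rcases le_total y (n + 1) with hn | hn
    · induction hn using Nat.decreasingInduction with
      | self => exact T.count_top s.one_le_r (by omega)
      | of_succ y hyn ih =>
        have ih := ih (by omega)
        have h2 := h (y - 1) (by omega) (by omega) 0
        rw [T.height_zero, show y - 1 + 2 = y + 1 by omega, show y - 1 + 1 = y by omega] at h2
        have := T.count_le 0 y
        omega
    · exact T.count_top s.one_le_r (by omega)
  refine ⟨h1, fun k y hk hy => ?_⟩
  rcases le_total y n with hn | hn
  · induction hn using Nat.decreasingInduction generalizing k with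
    | self =>
      rw [T.count_top hk (by omega), T.count_of_top_le (by omega) (by omega)]
    | of_succ y hyn ih =>
      have ih := fun k hk => ih k hk (by omega)
      have hh := h y hy hyn
      have hc : ∀ k, k + 1 < s.r → T.count (k + 1) (y + 1) = T.count k y ∧ T.height y k = 0 := by
        intro k
        induction k with
        | zero =>
          intro hk
          have e1 := hh 1
          have e2 := T.height_zero y
          have e3 := T.height_succ y 0
          have e4 := ih 0 hk
          have e5 := h1 (y + 1) (by omega)
          have e6 := h1 (y + 2) (by omega)
          have e7 := T.count_succ_le 0 y
          simp only [zero_add, show y + 1 + 1 = y + 2 by omega] at *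
          omega
        | succ k ihk =>
          intro hk
          have e1 := hh (k + 2)
          have e2 := T.height_succ y k
          have e3 := T.height_succ y (k + 1)
          have e4 := ih (k + 1) hk
          have e5 := ih k (by omega)
          have e7 := T.count_succ_le (k + 1) y
          have e8 := ihk (by omega)
          simp only [show y + 1 + 1 = y + 2 by omega, show k + 1 + 1 = k + 2 by omega] at *
          omega
      exact (hc k hk).1
  · rw [T.count_top hk (by omega), T.count_of_top_le (by omega) (by omega)]

theorem size_pr_pr {y : ℕ} (hy : y + 1 ≤ n) (T : Tab s) :
    (pr s (pr s T)).size (y + 2) + T.size (n - 1) = T.size y + T.size (n + 1) := by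
  have h1 := size_pr (y := y + 1) hy (pr s T)
  have h2 := size_pr (y := y) (by omega) T
  have h3 := size_pr (y := n - 1) (by omega) T
  rw [Nat.sub_add_cancel (by omega)] at h3
  have h4 := T.size_top (show n < n + 1 by omega)
  have h5 := (pr s T).size_top (show n < n + 1 by omega)
  simp only [show y + 1 + 1 = y + 2 by omega] at h1
  omega

theorem size_pr_pr_one (hn : 1 ≤ n) (T : Tab s) :
    (pr s (pr s T)).size 1 + T.size (n - 1) = T.size n := by
  have h1 := size_pr (y := 0) (by omega) (pr s T)
  have h3 := size_pr (y := n - 1) (by omega) T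
  rw [Nat.sub_add_cancel (by omega)] at h3
  have h4 := T.size_top (show n < n + 1 by omega)
  have h5 := (pr s T).size_top (show n < n + 1 by omega)
  have h6 := (pr s T).size_zero
  simp only [zero_add] at h1
  omega

end Tab

theorem kr_e_eq_none_iff {n : ℕ} {s : Shape n} (x : Fin n) (T : Tab s) :
    (kr s).e x.succ T = none ↔ ∀ k, T.height x k ≤ 0 := by
  rw [(kr_regular s).e_none]
  obtain ⟨h1, k, h2⟩ := kr_ε x T
  constructor
  · intro h k
    have := h1 k
    omega
  · intro h
    have := h k
    omega

theorem kr_e_pr_pr {n : ℕ} {s : Shape n} {x z : Fin n} (hz : (z : ℕ) = x + 2) (T : Tab s) :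
    (kr s).e z.succ (Tab.pr s (Tab.pr s T)) =
      ((kr s).e x.succ T).map fun T => Tab.pr s (Tab.pr s T) := by
  have hz' := z.2
  rw [kr_e_pr_succ (x := ⟨x + 1, by omega⟩) (y := z) hz,
    kr_e_pr_succ (x := x) (y := ⟨x + 1, by omega⟩) rfl, Option.map_map]
  rfl

namespace Tab

variable {n : ℕ} {s : Shape n}

/-- The square of promotion replaces the shape formed by the letters `< n - 1` by the shape
complementary to it in the rectangle: this is the shape formed by the first two letters of
`pr (pr T)`. -/
theorem count_pr_pr_two (hn : 2 ≤ n) (T : Tab s) :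
    (pr s (pr s T)).count 0 2 + T.count (s.r - 1) (n - 1) = s.l ∧
    ∀ m, s.r = m + 2 → (pr s (pr s T)).count 1 2 + T.count m (n - 1) = s.l := by
  induction T using Step.induction (fun x : Fin n => (x : ℕ) + 3 ≤ n) with
  | h0 T hT =>
    have hU : ∀ x, 2 ≤ x → x < n → ∀ k, (pr s (pr s T)).height x k ≤ 0 := by
      intro x hx hxn
      have h1 := kr_e_pr_pr (x := ⟨x - 2, by omega⟩) (z := ⟨x, hxn⟩)
        (by simp only; omega) T
      rw [(kr_e_eq_none_iff ⟨x - 2, by omega⟩ T).2 (hT ⟨x - 2, by omega⟩ (by simp only; omega)),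
        Option.map_none, kr_e_eq_none_iff] at h1
      exact h1
    have hT' : ∀ x, x + 2 ≤ n - 1 → ∀ k, T.height x k ≤ 0 := fun x hx =>
      hT ⟨x, by omega⟩ (by simp only; omega)
    generalize hUdef : pr s (pr s T) = U at hU
    obtain ⟨u1, u2⟩ := U.count_of_height_le_above hU
    have hsz := T.size_pr_pr (y := 0) (by omega)
    rw [hUdef, T.size_zero, T.size_top (show n < n + 1 by omega)] at hsz
    simp only [zero_add] at hsz
    by_cases hr : s.r = 1
    · refine ⟨?_, by omega⟩
      simp only [size, hr, Finset.sum_range_one] at hsz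
      simp only [hr, Nat.sub_self]
      omega
    · obtain ⟨m, hm⟩ : ∃ m, s.r = m + 2 := ⟨s.r - 2, by have := s.one_le_r; omega⟩
      have hrn := s.r_le
      -- Compare the numbers of letters `m` in `T` and of letters `m + 2` in `pr (pr T)`.
      have d1 := T.size_pr_pr (y := m) (by omega)
      have d2 := T.size_pr_pr (y := m + 1) (by omega)
      rw [hUdef] at d1 d2
      have t1 : ∑ k ∈ Finset.range m, T.count k (m + 1) = ∑ k ∈ Finset.range m, T.count k m := by
        apply Finset.sum_congr rfl
        intro k hk
        rw [Finset.mem_range] at hk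
        rw [T.count_of_height_le hT' (show k < m + 1 by omega) (by omega),
          T.count_of_height_le hT' (show k < m by omega) (by omega)]
      have t2 : T.count m (m + 1) = T.count m (n - 1) :=
        T.count_of_height_le hT' (by omega) (by omega)
      have t3 : ∑ k ∈ Finset.range m, U.count k (m + 3) = ∑ k ∈ Finset.range m, U.count k (m + 2) := by
        have : ∀ k y, k < s.r → k + 3 ≤ y → U.count k y = s.l := by
          intro k
          induction k with
          | zero => intro y _ hy; exact u1 y (by omega)
          | succ k ih =>
            intro y hk hy
            obtain ⟨y, rfl⟩ : ∃ y', y = y' + 1 := ⟨y - 1, by omega⟩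
            rw [u2 k y hk (by omega)]
            exact ih y (by omega) (by omega)
        apply Finset.sum_congr rfl
        intro k hk
        rw [Finset.mem_range] at hk
        rw [this k _ (by omega) (by omega), this k _ (by omega) (by omega)]
      have diag : ∀ k, k < s.r → U.count k (k + 2) = U.count 0 2 ∧ U.count k (k + 3) = s.l ∧
          (1 ≤ k → U.count k (k + 1) = U.count 1 2) := by
        intro k
        induction k with
        | zero => intro _; exact ⟨rfl, u1 _ le_rfl, by omega⟩
        | succ k ih =>
          intro hk
          obtain ⟨i1, i2, i3⟩ := ih (by omega)
          refine ⟨by rw [← i1]; exact u2 k _ hk (by omega),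
            by rw [← i2]; exact u2 k _ hk (by omega), fun _ => ?_⟩
          cases k with
          | zero => rfl
          | succ k =>
            rw [← i3 (by omega)]
            exact u2 (k + 1) _ hk (by omega)
      obtain ⟨a1, a2, -⟩ := diag m (by omega)
      obtain ⟨b1, -, b3⟩ := diag (m + 1) (by omega)
      have b3 := b3 (by omega)
      have z1 : T.count m m = 0 := T.count_of_le_row le_rfl
      have z2 : T.count (m + 1) (m + 1) = 0 := T.count_of_le_row le_rfl
      have z3 : T.count (m + 1) m = 0 := T.count_of_le_row (by omega)
      have z4 : ∑ k ∈ Finset.range m, T.count k (n - 1) = m * s.l := by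
        rw [Finset.sum_congr rfl fun k hk => T.count_of_top_le (i := k) (y := n - 1)
          (by have := Finset.mem_range.1 hk; omega) (by have := Finset.mem_range.1 hk; omega)]
        simp
      have z5 : ∑ k ∈ Finset.range m, U.count k 2 ≤ m * s.l := by
        refine (Finset.sum_le_card_nsmul _ _ s.l fun k _ => U.count_le k 2).trans (by simp)
      have z6 : ∀ k, 2 ≤ k → U.count k 2 = 0 := fun k hk => U.count_of_le_row hk
      have z7 : U.size 2 = U.count 0 2 + U.count 1 2 := by
        rw [size, hm, Finset.sum_range_succ', Finset.sum_range_succ',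
          Finset.sum_eq_zero (fun k _ => z6 _ (by omega))]
        simp; ring
      simp only [size, hm, Finset.sum_range_succ] at d1 d2
      rw [z7, size, hm, Finset.sum_range_succ, Finset.sum_range_succ, z4,
        show (m + 2) * s.l = m * s.l + 2 * s.l by ring] at hsz
      simp only [show m + 1 + 2 = m + 3 by omega] at d1 d2 b1
      rw [hm]
      simp only [show m + 2 - 1 = m + 1 by omega]
      have b1' : U.count (m + 1) (m + 3) = U.count 0 2 := b1
      have b3' : U.count (m + 1) (m + 2) = U.count 1 2 := b3
      refine ⟨by omega, ?_⟩
      intro m' hm'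
      obtain rfl : m' = m := by omega
      omega
  | h1 x k T T' hx hk ih =>
    obtain ⟨k', hk'⟩ := (kr_e_iff ⟨x + 2, by omega⟩ _ _).1
      ((kr_e_pr_pr (x := x) (z := ⟨x + 2, by omega⟩) rfl T).trans
        (by rw [(kr_e_iff x T T').2 ⟨k, hk⟩]; rfl))
    have e1 : ∀ j, (pr s (pr s T')).count j 2 = (pr s (pr s T)).count j 2 := fun j =>
      hk'.count_ne j (by simp only; omega)
    have e2 : ∀ j, T'.count j (n - 1) = T.count j (n - 1) := fun j =>
      hk.count_ne j (by omega)
    simpa only [e1, e2] using ih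

/-- The letters `≥ 2` of `pr (pr T)` depend only on the letters `< n - 1` of `T`. -/
theorem count_pr_pr_congr (hn : 2 ≤ n) (T : Tab s) : ∀ T₁ : Tab s,
    (∀ k y, y ≤ n - 1 → T.count k y = T₁.count k y) →
    ∀ k y, 2 ≤ y → (pr s (pr s T)).count k y = (pr s (pr s T₁)).count k y := by
  induction T using Step.induction (fun x : Fin n => (x : ℕ) + 3 ≤ n) with
  | h0 T hT =>
    have hU : ∀ T : Tab s, (∀ x : Fin n, (x : ℕ) + 3 ≤ n → ∀ k, T.height x k ≤ 0) →
        ∀ x, 2 ≤ x → x < n → ∀ k, (pr s (pr s T)).height x k ≤ 0 := by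
      intro T hT x hx hxn
      have h1 := kr_e_pr_pr (x := ⟨x - 2, by omega⟩) (z := ⟨x, hxn⟩)
        (by simp only; omega) T
      rw [(kr_e_eq_none_iff ⟨x - 2, by omega⟩ T).2 (hT ⟨x - 2, by omega⟩ (by simp only; omega)),
        Option.map_none, kr_e_eq_none_iff] at h1
      exact h1
    intro T₁ h1
    have hT₁ : ∀ x : Fin n, (x : ℕ) + 3 ≤ n → ∀ k, T₁.height x k ≤ 0 := fun x hx k => by
      rw [← height_congr (T := T) (fun k => h1 k _ (by omega)) (fun k => h1 k _ (by omega))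
        (fun k => h1 k _ (by omega))]
      exact hT x hx k
    obtain ⟨u1, u2⟩ := (pr s (pr s T)).count_of_height_le_above (hU T hT)
    obtain ⟨v1, v2⟩ := (pr s (pr s T₁)).count_of_height_le_above (hU T₁ hT₁)
    obtain ⟨w1, w2⟩ := T.count_pr_pr_two hn
    obtain ⟨w1', w2'⟩ := T₁.count_pr_pr_two hn
    have e0 : (pr s (pr s T)).count 0 2 = (pr s (pr s T₁)).count 0 2 := by
      rw [h1 _ _ le_rfl] at w1; omega
    have e1 : (pr s (pr s T)).count 1 2 = (pr s (pr s T₁)).count 1 2 := by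
      by_cases hr : s.r = 1
      · rw [count_of_le _ hr.le, count_of_le _ hr.le]
      · have := s.one_le_r
        have a1 := w2 (s.r - 2) (by omega)
        have a2 := w2' (s.r - 2) (by omega)
        rw [h1 _ _ le_rfl] at a1
        omega
    intro k
    induction k with
    | zero =>
      intro y hy
      rcases eq_or_lt_of_le hy with rfl | hy
      · exact e0
      · rw [u1 y hy, v1 y hy]
    | succ k ih =>
      intro y hy
      by_cases hk : k + 1 < s.r
      · rcases eq_or_lt_of_le hy with rfl | hy
        · cases k with
          | zero => exact e1
          | succ k => rw [count_of_le_row _ (by omega), count_of_le_row _ (by omega)]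
        · obtain ⟨y, rfl⟩ : ∃ y', y = y' + 1 := ⟨y - 1, by omega⟩
          rw [u2 k y hk (by omega), v2 k y hk (by omega), ih y (by omega)]
      · rw [count_of_le _ (by omega), count_of_le _ (by omega)]
  | h1 x k T T' hx hk ih =>
    intro T₁ h1
    have hh : ∀ k, T.height x k = T₁.height x k := height_congr
      (fun k => h1 k _ (by omega)) (fun k => h1 k _ (by omega)) (fun k => h1 k _ (by omega))
    obtain ⟨k₁, T₁', hk₁⟩ := T₁.exists_step x.2 ⟨k, by rw [← hh]; exact hk.2.2.1⟩
    obtain rfl : k = k₁ := by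
      rcases lt_trichotomy k k₁ with h | h | h
      · have := hk₁.1 k h; rw [← hh, ← hh] at this; exact absurd this (not_lt.2 (hk.2.1 _))
      · exact h
      · have := hk.1 k₁ h; rw [hh, hh] at this; exact absurd this (not_lt.2 (hk₁.2.1 _))
    have ih := ih T₁' (fun j y hy => by rw [hk.2.2.2, hk₁.2.2.2, h1 j y hy])
    have key : ∀ T T' : Tab s, Step x k T T' →
        ∃ k', Step (x + 2) k' (pr s (pr s T)) (pr s (pr s T')) := fun T T' hk =>
      (kr_e_iff ⟨x + 2, by omega⟩ _ _).1
        ((kr_e_pr_pr (x := x) (z := ⟨x + 2, by omega⟩) rfl T).trans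
          (by rw [(kr_e_iff x T T').2 ⟨k, hk⟩]; rfl))
    obtain ⟨a, ha⟩ := key T T' hk
    obtain ⟨b, hb⟩ := key T₁ T₁' hk₁
    have hh' := height_congr (x := x + 2) (fun k => ih k _ (by omega))
      (fun k => ih k _ (by omega)) (fun k => ih k _ (by omega))
    obtain rfl : a = b := by
      rcases lt_trichotomy a b with h | h | h
      · have := ha.height_lt h; rw [hh', hh'] at this
        exact absurd this (not_lt.2 (hb.height_le _))
      · exact h
      · have := hb.height_lt h; rw [← hh', ← hh'] at this
        exact absurd this (not_lt.2 (ha.height_le _))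
    intro j y hy
    have e1 := ih j y hy
    rw [ha.2.2.2, hb.2.2.2] at e1
    omega

end Tab

/-- `e_1 pr² = pr² e_n`. -/
theorem kr_e_pr_pr_last {n : ℕ} {s : Shape n} {x z : Fin n} (hx : (x : ℕ) + 1 = n)
    (hz : (z : ℕ) = 0) (T : Tab s) :
    (kr s).e z.succ (Tab.pr s (Tab.pr s T)) =
      ((kr s).e x.succ T).map fun T => Tab.pr s (Tab.pr s T) := by
  by_cases hn : n = 1
  · subst hn
    have hpr : ∀ T : Tab s, Tab.pr s T = T.bk 0 := fun T => by
      rw [← Tab.prTail_zero, Tab.prTail_eq Nat.zero_lt_one, Tab.prTail_of_le (by omega)]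
      rfl
    have h2 : ∀ T : Tab s, Tab.pr s (Tab.pr s T) = T := fun T => by
      rw [hpr, hpr, Tab.bk_bk]
    obtain rfl : x = z := Subsingleton.elim _ _
    simp [h2]
  have hn : 2 ≤ n := by omega
  have zero_rows : ∀ (T : Tab s) k, T.count (k + 1) 1 = 0 := fun T k =>
    T.count_of_le_row (by omega)
  have size_one : ∀ T : Tab s, T.size 1 = T.count 0 1 := fun T => by
    obtain ⟨m, hm⟩ : ∃ m, s.r = m + 1 := ⟨s.r - 1, by have := s.one_le_r; omega⟩
    rw [Tab.size, hm, Finset.sum_range_succ', Finset.sum_eq_zero fun k _ => zero_rows T k, zero_add]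
  have hmax : ∀ (T : Tab s) k, T.height 0 k ≤ T.height 0 0 := by
    intro T k
    induction k with
    | zero => exact le_rfl
    | succ k ih =>
      refine le_trans ?_ ih
      have h1 := T.height_succ 0 k
      simp only [zero_add, zero_rows, T.count_zero] at h1
      have : T.count (k + 1) 2 ≤ T.count k 1 := T.count_succ_le k 1
      omega
  refine kr_e_map (fun T => Tab.pr s (Tab.pr s T)) ?_ ?_ T
  · intro k T T' h
    have h2 := T.count_pr_pr_congr hn T' (fun j y hy => (h.count_ne j (by omega)).symm)
    have h3 := T.size_pr_pr_one (by omega)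
    have h4 := T'.size_pr_pr_one (by omega)
    have h5 := h.size_self
    rw [hx] at h5
    rw [h.size_ne (show n - 1 ≠ x + 1 by omega), size_one] at h4
    rw [size_one] at h3
    have h6 : 0 < (Tab.pr s (Tab.pr s T)).height 0 0 := by
      rw [Tab.height_zero]
      have := (Tab.pr s (Tab.pr s T')).count_mono 0 (show 1 ≤ 2 by omega)
      rw [← h2 0 2 le_rfl] at this
      simp only [zero_add]
      omega
    refine ⟨0, by omega, ?_, ?_, ?_⟩
    · rw [hz]; exact hmax _
    · rw [hz]; exact h6
    · intro j y
      rw [hz]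
      by_cases hy : 2 ≤ y
      · rw [h2 j y hy, if_neg (by omega), add_zero]
      · obtain rfl | rfl : y = 0 ∨ y = 1 := by omega
        · simp [Tab.count_zero]
        · cases j with
          | zero => simp; omega
          | succ j => rw [zero_rows, zero_rows]; simp
  · intro T hT k
    rw [hz]
    refine (hmax _ k).trans ?_
    have h1 := (T.count_pr_pr_two hn).1
    have h3 := T.size_pr_pr_one (by omega)
    rw [size_one] at h3
    rw [Tab.height_zero]
    simp only [zero_add]
    -- The height of `T` in its last row is the height of `pr (pr T)` in its first row.
    have hT' := hT (s.r - 1)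
    obtain ⟨m, hm⟩ : ∃ m, s.r = m + 1 := ⟨s.r - 1, by have := s.one_le_r; omega⟩
    simp only [hm, Nat.add_sub_cancel] at hT' h1
    have e1 : ∀ j ∈ Finset.range m, ((T.count j (x + 2) : ℤ) + T.count j x
        - 2 * T.count j (x + 1)) = T.count j (n - 1) - T.count j n := by
      intro j hj
      rw [Finset.mem_range] at hj
      rw [T.count_top (y := x + 2) (by omega) (by omega),
        T.count_of_top_le (i := j) (y := x + 1) (by omega) (by omega),
        T.count_of_top_le (i := j) (y := n) (by omega) (by omega), show (x : ℕ) = n - 1 by omega]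
      ring
    rw [Tab.height, Finset.sum_congr rfl e1, Finset.sum_sub_distrib, hx,
      T.count_top (y := x + 2) (by omega) (by omega)] at hT'
    simp only [Tab.size, hm, Finset.sum_range_succ] at h3
    push_cast [← Nat.cast_sum] at hT'
    omega

/-! ### Promotion rotates the affine Dynkin diagram -/

namespace Crystal

variable {I J A B : Type} {C : Crystal I A} {D : Crystal J B} {i : I} {j : J}

theorem Regular.ε_map (hC : C.Regular) (hD : D.Regular) {g : A → B}
    (he : ∀ a, D.e j (g a) = (C.e i a).map g) (a : A) : D.ε j (g a) = C.ε i a := by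
  generalize hN : C.ε i a = N
  induction N generalizing a with
  | zero =>
    rw [← hD.e_none, he, hC.e_none.2 hN, Option.map_none]
  | succ N ih =>
    obtain ⟨a', ha⟩ := hC.exists_e i a (by omega)
    have h1 := hC.ε_of_e _ _ _ ha
    have h2 := he a
    rw [ha, Option.map_some] at h2
    rw [hD.ε_of_e _ _ _ h2, ih a' (by omega)]

theorem Regular.φ_map (hC : C.Regular) (hD : D.Regular) {g : A → B}
    (hf : ∀ a, D.f j (g a) = (C.f i a).map g) (a : A) : D.φ j (g a) = C.φ i a := by
  generalize hN : C.φ i a = N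
  induction N generalizing a with
  | zero =>
    rw [← hD.f_none, hf, hC.f_none.2 hN, Option.map_none]
  | succ N ih =>
    obtain ⟨a', ha⟩ := hC.exists_f i a (by omega)
    have h1 := hC.φ_of_e _ _ _ ((hC.e_iff _ _ _).2 ha)
    have h2 := hf a
    rw [ha, Option.map_some] at h2
    rw [hD.φ_of_e _ _ _ ((hD.e_iff _ _ _).2 h2), ih a' (by omega)]

/-- A bijection which intertwines the raising operators intertwines the lowering operators. -/
theorem Regular.f_map (hC : C.Regular) (hD : D.Regular) (g : A ≃ B)
    (he : ∀ a, D.e j (g a) = (C.e i a).map g) (a : A) : D.f j (g a) = (C.f i a).map g := by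
  apply Option.ext
  intro b
  have h := he (g.symm b)
  rw [g.apply_symm_apply] at h
  rw [← hD.e_iff, h]
  simp only [Option.map_eq_some_iff, EmbeddingLike.apply_eq_iff_eq, exists_eq_right]
  rw [hC.e_iff]
  constructor
  · intro ha; exact ⟨_, ha, by simp⟩
  · rintro ⟨a', ha, rfl⟩; simpa using ha

end Crystal

section

variable {n : ℕ} {s : Shape n}

theorem kr_e_pr (i : Fin (n + 1)) (T : Tab s) :
    (kr s).e (i + 1) (Tab.pr s T) = ((kr s).e i T).map (Tab.pr s) := by
  have hn : 0 < n := s.one_le_r.trans s.r_le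
  cases i using Fin.cases with
  | zero =>
    rw [kr_e_zero, zero_add, Option.map_map]
    simp
  | succ x =>
    by_cases hx : (x : ℕ) + 1 < n
    · have : x.succ + 1 = (⟨x + 1, hx⟩ : Fin n).succ := by
        apply Fin.ext
        rw [Fin.val_add_one_of_lt (by rw [Fin.lt_def]; simpa using hx)]
        simp
      rw [this]
      exact kr_e_pr_succ rfl T
    · have hx' : x.succ + 1 = 0 := by
        have : x.succ = Fin.last n := by
          apply Fin.ext
          simp
          have := x.2
          omega
        rw [this, Fin.last_add_one]
      rw [hx', kr_e_zero, one_eq_succ hn,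
        kr_e_pr_pr_last (x := x) (by have := x.2; omega) rfl, Option.map_map]
      congr 1
      funext T
      simp

theorem kr_f_pr (i : Fin (n + 1)) (T : Tab s) :
    (kr s).f (i + 1) (Tab.pr s T) = ((kr s).f i T).map (Tab.pr s) :=
  (kr_regular s).f_map (kr_regular s) (Tab.pr s) (kr_e_pr i) T

theorem kr_ε_pr (i : Fin (n + 1)) (T : Tab s) : (kr s).ε (i + 1) (Tab.pr s T) = (kr s).ε i T :=
  (kr_regular s).ε_map (kr_regular s) (kr_e_pr i) T

theorem kr_φ_pr (i : Fin (n + 1)) (T : Tab s) : (kr s).φ (i + 1) (Tab.pr s T) = (kr s).φ i T :=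
  (kr_regular s).φ_map (kr_regular s) (kr_f_pr i) T

end

/-! ### Raising to the top of strings, and connectedness -/

namespace Crystal

variable {I A B : Type}

/-- `b` and `b'` are connected by Kashiwara operators. -/
def Conn (C : Crystal I B) : B → B → Prop :=
  Relation.EqvGen fun b b' => ∃ i, C.e i b = some b'

/-- The highest element of the `i`-string of `b`. -/
def eMax (C : Crystal I B) (i : I) (b : B) : B :=
  (fun b => (C.e i b).getD b)^[C.ε i b] b

/-- The operators `eMax i` for the letters `i` of a word, the first letter acting first. -/
def eMaxList (C : Crystal I B) (w : List I) (b : B) : B :=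
  w.foldl (fun b i => C.eMax i b) b

/-- Whenever one of the operators `eMax i` for the letters `i` of the word is applied to `b`,
it is applied to a lowest element of an `i`-string. -/
def Vanishes (C : Crystal I B) : List I → B → Prop
  | [], _ => True
  | i :: w, b => C.φ i b = 0 ∧ C.Vanishes w (C.eMax i b)

theorem Vanishes.append {C : Crystal I B} {w w' : List I} {b : B} (h : C.Vanishes w b)
    (h' : C.Vanishes w' (C.eMaxList w b)) : C.Vanishes (w ++ w') b := by
  induction w generalizing b with
  | nil => exact h'
  | cons i w ih => exact ⟨h.1, ih h.2 h'⟩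

theorem eMaxList_append (C : Crystal I B) (w w' : List I) (b : B) :
    C.eMaxList (w ++ w') b = C.eMaxList w' (C.eMaxList w b) :=
  List.foldl_append

theorem eMax_of_ε {C : Crystal I B} {i : I} {b : B} (h : C.ε i b = 0) : C.eMax i b = b := by
  simp [eMax, h]

theorem Regular.eMax_of_e {C : Crystal I B} (hC : C.Regular) {i : I} {b b' : B}
    (h : C.e i b = some b') : C.eMax i b = C.eMax i b' := by
  unfold eMax
  rw [hC.ε_of_e _ _ _ h, Function.iterate_succ_apply, h, Option.getD_some]

theorem Regular.e_induction {C : Crystal I B} (hC : C.Regular) (i : I) {P : B → Prop}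
    (h0 : ∀ b, C.ε i b = 0 → P b) (h1 : ∀ b b', C.e i b = some b' → P b' → P b) (b : B) :
    P b := by
  generalize hN : C.ε i b = N
  induction N generalizing b with
  | zero => exact h0 b hN
  | succ N ih =>
    obtain ⟨b', hb⟩ := hC.exists_e i b (by omega)
    have := hC.ε_of_e _ _ _ hb
    exact h1 b b' hb (ih b' (by omega))

theorem Regular.conn_eMax {C : Crystal I B} (hC : C.Regular) (i : I) (b : B) :
    C.Conn b (C.eMax i b) := by
  induction b using hC.e_induction i with
  | h0 b h => rw [eMax_of_ε h]; exact .refl _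
  | h1 b b' h ih => rw [hC.eMax_of_e h]; exact .trans _ _ _ (.rel _ _ ⟨i, h⟩) ih

theorem Regular.conn_eMaxList {C : Crystal I B} (hC : C.Regular) (w : List I) (b : B) :
    C.Conn b (C.eMaxList w b) := by
  induction w generalizing b with
  | nil => exact .refl _
  | cons i w ih => exact .trans _ _ _ (hC.conn_eMax i b) (ih _)

theorem tensor_e_some {C : Crystal I A} {D : Crystal I B} {i : I} {z z' : A × B}
    (h : (C.tensor D).e i z = some z') :
    D.ε i z.2 ≤ C.φ i z.1 ∧ C.e i z.1 = some z'.1 ∧ z'.2 = z.2 ∨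
    C.φ i z.1 < D.ε i z.2 ∧ D.e i z.2 = some z'.2 ∧ z'.1 = z.1 := by
  simp only [Crystal.tensor] at h
  split_ifs at h with hc
  · obtain ⟨a, ha, rfl⟩ := Option.map_eq_some_iff.1 h
    exact Or.inl ⟨hc, ha, rfl⟩
  · obtain ⟨a, ha, rfl⟩ := Option.map_eq_some_iff.1 h
    exact Or.inr ⟨by omega, ha, rfl⟩

theorem Regular.eMax_tensor_fst {C : Crystal I A} {D : Crystal I B} (hC : C.Regular)
    (hD : D.Regular) (i : I) (z : A × B) : ((C.tensor D).eMax i z).1 = C.eMax i z.1 := by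
  induction z using (hC.tensor hD).e_induction i with
  | h0 z h =>
    rw [eMax_of_ε h, eMax_of_ε]
    simp only [Crystal.tensor] at h
    omega
  | h1 z z' h ih =>
    rw [(hC.tensor hD).eMax_of_e h, ih]
    rcases tensor_e_some h with ⟨-, h1, -⟩ | ⟨-, -, h1⟩
    · rw [hC.eMax_of_e h1]
    · rw [h1]

theorem Regular.eMax_tensor {C : Crystal I A} {D : Crystal I B} (hC : C.Regular)
    (hD : D.Regular) {i : I} {a : A} (b : B) (h : C.φ i a = 0) :
    (C.tensor D).eMax i (a, b) = (C.eMax i a, D.eMax i b) := by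
  have key : ∀ z : A × B, (C.φ i z.1 = 0 ∨ D.ε i z.2 = 0) →
      (C.tensor D).eMax i z = (C.eMax i z.1, D.eMax i z.2) := by
    intro z
    induction z using (hC.tensor hD).e_induction i with
    | h0 z h =>
      intro h'
      change C.ε i z.1 + (D.ε i z.2 - C.φ i z.1) = 0 at h
      rw [eMax_of_ε (C := C.tensor D) h, eMax_of_ε (by omega),
        eMax_of_ε (by omega)]
    | h1 z z' h ih =>
      intro h'
      rw [(hC.tensor hD).eMax_of_e h]
      rcases tensor_e_some h with ⟨h1, h2, h3⟩ | ⟨h1, h2, h3⟩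
      · rw [ih (Or.inr (by rw [h3]; omega)), hC.eMax_of_e h2, h3]
      · rw [ih (Or.inl (by rw [h3]; omega)), hD.eMax_of_e h2, h3]
  exact key (a, b) (Or.inl h)

theorem Regular.eMaxList_tensor_fst {C : Crystal I A} {D : Crystal I B} (hC : C.Regular)
    (hD : D.Regular) (w : List I) (z : A × B) :
    ((C.tensor D).eMaxList w z).1 = C.eMaxList w z.1 := by
  induction w generalizing z with
  | nil => rfl
  | cons i w ih =>
    change ((C.tensor D).eMaxList w ((C.tensor D).eMax i z)).1 = C.eMaxList w (C.eMax i z.1)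
    rw [ih, hC.eMax_tensor_fst hD]

theorem Regular.eMaxList_tensor {C : Crystal I A} {D : Crystal I B} (hC : C.Regular)
    (hD : D.Regular) {w : List I} {a : A} (b : B) (h : C.Vanishes w a) :
    (C.tensor D).eMaxList w (a, b) = (C.eMaxList w a, D.eMaxList w b) := by
  induction w generalizing a b with
  | nil => rfl
  | cons i w ih =>
    change (C.tensor D).eMaxList w ((C.tensor D).eMax i (a, b)) = _
    rw [hC.eMax_tensor hD b h.1, ih _ h.2]
    rfl

/-- `g` rotates the affine Dynkin diagram by one step. -/
structure Rotates {n : ℕ} (C : Crystal (Fin (n + 1)) B) (g : B ≃ B) : Prop where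
  e : ∀ i b, C.e (i + 1) (g b) = (C.e i b).map g
  f : ∀ i b, C.f (i + 1) (g b) = (C.f i b).map g
  ε : ∀ i b, C.ε (i + 1) (g b) = C.ε i b
  φ : ∀ i b, C.φ (i + 1) (g b) = C.φ i b

theorem Rotates.tensor {n : ℕ} {C : Crystal (Fin (n + 1)) A} {D : Crystal (Fin (n + 1)) B}
    {g : A ≃ A} {h : B ≃ B} (hC : C.Rotates g) (hD : D.Rotates h) :
    (C.tensor D).Rotates (g.prodCongr h) where
  e i b := by
    simp only [Crystal.tensor, Equiv.prodCongr_apply, Prod.map_fst, Prod.map_snd, hC.e, hD.e,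
      hD.ε, hC.φ]
    split_ifs <;> simp [Option.map_map, Function.comp_def]
  f i b := by
    simp only [Crystal.tensor, Equiv.prodCongr_apply, Prod.map_fst, Prod.map_snd, hC.f, hD.f,
      hD.ε, hC.φ]
    split_ifs <;> simp [Option.map_map, Function.comp_def]
  ε i b := by simp [Crystal.tensor, hC.ε, hC.φ, hD.ε]
  φ i b := by simp [Crystal.tensor, hD.φ, hC.φ, hD.ε]

theorem Rotates.e_symm {n : ℕ} {C : Crystal (Fin (n + 1)) B} {g : B ≃ B} (h : C.Rotates g)
    (i : Fin (n + 1)) (b : B) : C.e i (g.symm b) = (C.e (i + 1) b).map g.symm := by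
  have := h.e i (g.symm b)
  rw [g.apply_symm_apply] at this
  rw [this, Option.map_map]
  simp

theorem Rotates.conn_symm {n : ℕ} {C : Crystal (Fin (n + 1)) B} {g : B ≃ B} (h : C.Rotates g)
    {b b' : B} (hb : C.Conn b b') : C.Conn (g.symm b) (g.symm b') := by
  induction hb with
  | rel b b' hb =>
    obtain ⟨i, hb⟩ := hb
    refine .rel _ _ ⟨i - 1, ?_⟩
    rw [h.e_symm, sub_add_cancel, hb, Option.map_some]
  | refl => exact .refl _
  | symm _ _ _ ih => exact .symm _ _ ih
  | trans _ _ _ _ _ ih ih' => exact .trans _ _ _ ih ih'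

theorem Rotates.conn_symm_iterate {n : ℕ} {C : Crystal (Fin (n + 1)) B} {g : B ≃ B}
    (h : C.Rotates g) (k : ℕ) {b b' : B} (hb : C.Conn b b') :
    C.Conn (g.symm^[k] b) (g.symm^[k] b') := by
  induction k with
  | zero => exact hb
  | succ k ih =>
    rw [Function.iterate_succ_apply', Function.iterate_succ_apply']
    exact h.conn_symm ih

end Crystal

theorem kr_rotates {n : ℕ} (s : Shape n) : (kr s).Rotates (Tab.pr s) :=
  ⟨kr_e_pr, kr_f_pr, kr_ε_pr, kr_φ_pr⟩

/-! ### Raising tableaux to the highest one -/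

section

variable {n : ℕ} {s : Shape n}

theorem count_eMax_ne (x : Fin n) (T : Tab s) (k : ℕ) {y : ℕ} (hy : y ≠ x + 1) :
    ((kr s).eMax x.succ T).count k y = T.count k y := by
  induction T using (kr_regular s).e_induction x.succ with
  | h0 T h => rw [Crystal.eMax_of_ε h]
  | h1 T T' h ih =>
    rw [(kr_regular s).eMax_of_e h, ih]
    obtain ⟨j, hj⟩ := (kr_e_iff x T T').1 h
    exact hj.count_ne k hy

theorem size_eMax (x : Fin n) (T : Tab s) :
    ((kr s).eMax x.succ T).size (x + 1) = T.size (x + 1) + (kr s).ε x.succ T := by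
  induction T using (kr_regular s).e_induction x.succ with
  | h0 T h => rw [Crystal.eMax_of_ε h, h]; rfl
  | h1 T T' h ih =>
    rw [(kr_regular s).eMax_of_e h, ih, (kr_regular s).ε_of_e _ _ _ h]
    obtain ⟨j, hj⟩ := (kr_e_iff x T T').1 h
    rw [hj.size_self]
    omega

namespace Tab

/-- The rows below the row `y - 1` do not contain letters `< y`. -/
theorem size_eq_sum (T : Tab s) (y : ℕ) : T.size y = ∑ k ∈ Finset.range y, T.count k y := by
  unfold size
  rcases le_total s.r y with h | h
  · refine Finset.sum_subset (Finset.range_subset_range.2 h) fun k _ hk => ?_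
    exact T.count_of_le (by simpa using hk) y
  · refine (Finset.sum_subset (Finset.range_subset_range.2 h) fun k _ hk => ?_).symm
    exact T.count_of_le_row (by simpa using hk)

theorem height_eq_size (T : Tab s) (x : ℕ) :
    T.height x s.r = T.size (x + 2) + T.size x - 2 * T.size (x + 1) := by
  rw [height, T.count_of_le le_rfl, T.count_of_le le_rfl, Finset.sum_sub_distrib,
    Finset.sum_add_distrib, ← Finset.mul_sum]
  simp [size]

theorem size_add_ε_le (x : Fin n) (T : Tab s) :
    T.size (x + 1) + (kr s).ε x.succ T ≤ ∑ k ∈ Finset.range (x + 1), T.count k (x + 2) := by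
  rw [← size_eMax, size_eq_sum]
  refine Finset.sum_le_sum fun k _ => ?_
  rw [← count_eMax_ne x T k (show (x : ℕ) + 2 ≠ x + 1 by omega)]
  exact count_mono _ _ (by omega)

/-- If the letters `x` all lie in the row `x`, then `e_{x+1}^{max}` moves all the letters `x + 1`
to the row `x + 1`. -/
theorem count_eMax (x : Fin n) (T : Tab s) (h : ∀ k < (x : ℕ), T.count k x = T.count k (x + 1))
    {k : ℕ} (hk : k ≤ x) : ((kr s).eMax x.succ T).count k (x + 1) = T.count k (x + 2) := by
  have h1 := (kr_ε x T).1 x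
  have h2 : T.height x x + T.size (x + 1) = ∑ k ∈ Finset.range (x + 1), T.count k (x + 2) := by
    rw [height, size_eq_sum, Finset.sum_range_succ, Finset.sum_range_succ,
      Finset.sum_congr rfl (g := fun k => ((T.count k (x + 2) : ℤ) - T.count k (x + 1)))]
    · push_cast
      rw [Finset.sum_sub_distrib]
      ring
    · intro k hk
      rw [h k (Finset.mem_range.1 hk)]
      ring
  have h3 : ∀ k ∈ Finset.range (x + 1),
      ((kr s).eMax x.succ T).count k (x + 1) ≤ T.count k (x + 2) := by
    intro k _
    rw [← count_eMax_ne x T k (show (x : ℕ) + 2 ≠ x + 1 by omega)]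
    exact count_mono _ _ (by omega)
  have h4 := size_eMax x T
  rw [size_eq_sum] at h4
  refine (Finset.sum_eq_sum_iff_of_le h3).1 (le_antisymm (Finset.sum_le_sum h3) ?_) k
    (Finset.mem_range.2 (by omega))
  zify at h4 h2 ⊢
  omega

theorem φ_eq_zero (x : Fin n) (T : Tab s) (h : ∀ k < (x : ℕ), T.count k x = T.count k (x + 1))
    (h' : T.count x (x + 1) = T.count (x + 1) (x + 2)) : (kr s).φ x.succ T = 0 := by
  have h1 := kr_φ x T
  have h2 := T.size_add_ε_le x
  have h3 := T.height_eq_size x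
  have h4 : T.size (x + 1) = T.size x + T.count x (x + 1) := by
    rw [size_eq_sum, size_eq_sum, Finset.sum_range_succ]
    congr 1
    exact Finset.sum_congr rfl fun k hk => (h k (Finset.mem_range.1 hk)).symm
  have h5 : T.size (x + 2) = ∑ k ∈ Finset.range (x + 1), T.count k (x + 2) +
      T.count (x + 1) (x + 2) := by
    rw [size_eq_sum, Finset.sum_range_succ]
  omega

end Tab

/-- The word `k, k - 1, …, 1`. -/
def descWord (n : ℕ) : ℕ → List (Fin (n + 1))
  | 0 => []
  | k + 1 => Fin.ofNat (n + 1) (k + 1) :: descWord n k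

/-- The word `1; 2, 1; 3, 2, 1; …; K, …, 1`. -/
def sweepWord (n : ℕ) : ℕ → List (Fin (n + 1))
  | 0 => []
  | K + 1 => sweepWord n K ++ descWord n (K + 1)

theorem ofNat_succ {n k : ℕ} (hk : k < n) :
    Fin.ofNat (n + 1) (k + 1) = (⟨k, hk⟩ : Fin n).succ := by
  apply Fin.ext
  simp [Nat.mod_eq_of_lt (show k + 1 < n + 1 by omega)]

/-- If the letters `< j` form a tableau of highest weight of the shape `lam`, then the letters
`≤ j`, which form the shape `mu`, are moved to the tableau of highest weight of this shape. -/
theorem eMaxList_descWord (lam mu : ℕ → ℕ) {j : ℕ} (hj : j ≤ n) (T : Tab s)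
    (h1 : ∀ y ≤ j, ∀ i < y, T.count i y = lam i) (h2 : ∀ i < j + 1, T.count i (j + 1) = mu i) :
    (∀ y ≤ j + 1, ∀ i < y, ((kr s).eMaxList (descWord n j) T).count i y = mu i) ∧
    (∀ y, j < y → ∀ i, ((kr s).eMaxList (descWord n j) T).count i y = T.count i y) ∧
    ((∀ i < j, lam i = mu (i + 1)) → (kr s).Vanishes (descWord n j) T) := by
  induction j generalizing T with
  | zero =>
    refine ⟨fun y hy i hi => ?_, fun _ _ _ => rfl, fun _ => trivial⟩
    obtain rfl : y = 1 := by omega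
    exact h2 i hi
  | succ x ih =>
    have htr : ∀ k < x, T.count k x = T.count k (x + 1) := fun k hk => by
      rw [h1 x (by omega) k hk, h1 (x + 1) le_rfl k (by omega)]
    have hw : descWord n (x + 1) = (⟨x, hj⟩ : Fin n).succ :: descWord n x := by
      rw [descWord, ofNat_succ hj]
    rw [hw]
    change (∀ y ≤ x + 1 + 1, ∀ i < y, ((kr s).eMaxList (descWord n x)
        ((kr s).eMax (⟨x, hj⟩ : Fin n).succ T)).count i y = mu i) ∧
      (∀ y, x + 1 < y → ∀ i, ((kr s).eMaxList (descWord n x)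
        ((kr s).eMax (⟨x, hj⟩ : Fin n).succ T)).count i y = T.count i y) ∧
      (_ → _ ∧ _)
    obtain ⟨a1, a2, a3⟩ := ih (by omega) ((kr s).eMax (⟨x, hj⟩ : Fin n).succ T)
      (fun y hy i hi => by
        rw [count_eMax_ne _ _ _ (by simp only; omega)]
        exact h1 y (by omega) i hi)
      (fun i hi => by
        rw [Tab.count_eMax ⟨x, hj⟩ T htr (by simp only; omega)]
        exact h2 i (by omega))
    have hne : ∀ y, x + 1 < y → ∀ i, ((kr s).eMaxList (descWord n x)
        ((kr s).eMax (⟨x, hj⟩ : Fin n).succ T)).count i y = T.count i y := fun y hy i => by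
      rw [a2 y (by omega) i, count_eMax_ne _ _ _ (by simp only; omega)]
    refine ⟨fun y hy i hi => ?_, hne, fun h => ⟨?_, a3 fun i hi => h i (by omega)⟩⟩
    · by_cases hy' : y ≤ x + 1
      · exact a1 y hy' i hi
      · obtain rfl : y = x + 2 := by omega
        rw [hne _ (by omega)]
        exact h2 i (by omega)
    · refine Tab.φ_eq_zero _ T htr ?_
      simp only
      rw [h1 (x + 1) le_rfl x (by omega), h2 (x + 1) (by omega), h x (by omega)]

theorem eMaxList_sweepWord {K : ℕ} (hK : K ≤ n) (T : Tab s) :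
    (∀ y ≤ K + 1, ∀ i < y, ((kr s).eMaxList (sweepWord n K) T).count i y = T.count i (K + 1)) ∧
    (∀ y, K < y → ∀ i, ((kr s).eMaxList (sweepWord n K) T).count i y = T.count i y) ∧
    ((∀ k ≤ K, ∀ i < k, T.count i k = T.count (i + 1) (k + 1)) →
      (kr s).Vanishes (sweepWord n K) T) := by
  induction K with
  | zero =>
    refine ⟨fun y hy i hi => ?_, fun _ _ _ => rfl, fun _ => trivial⟩
    obtain rfl : y = 1 := by omega
    rfl
  | succ K ih =>
    obtain ⟨a1, a2, a3⟩ := ih (by omega)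
    obtain ⟨b1, b2, b3⟩ := eMaxList_descWord (fun i => T.count i (K + 1))
      (fun i => T.count i (K + 2)) hK ((kr s).eMaxList (sweepWord n K) T) a1
      (fun i _ => a2 _ (by omega) i)
    rw [sweepWord, Crystal.eMaxList_append]
    refine ⟨b1, fun y hy i => (b2 y hy i).trans (a2 y (by omega) i), fun h => ?_⟩
    exact (a3 fun k hk => h k (by omega)).append (b3 fun i hi => h (K + 1) le_rfl i hi)

namespace Tab

theorem count_highest (k y : ℕ) :
    (highest s).count k y = if k < s.r ∧ k < y then s.l else 0 := by
  split_ifs with h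
  · refine count_eq _ ⟨k, h.1⟩ y _ le_rfl fun c => ?_
    simp [highest, h.2]
  · by_cases hk : k < s.r
    · exact count_of_le_row _ (by omega)
    · exact count_of_le _ (by omega) _

theorem eMaxList_eq_highest (T : Tab s) : (kr s).eMaxList (sweepWord n n) T = highest s := by
  refine ext_count fun i y hi => ?_
  rw [count_highest]
  obtain ⟨a1, a2, -⟩ := eMaxList_sweepWord le_rfl T
  split_ifs with h
  · by_cases hy : y ≤ n + 1
    · rw [a1 y hy i h.2, T.count_top hi (by omega)]
    · exact count_top _ hi (by omega)
  · exact count_of_le_row _ (by omega)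

/-- A tableau which contains each letter `l` times or not at all has constant rows. -/
theorem count_of_size (N : ℕ → ℕ) (T : Tab s) (h : ∀ y ≤ n + 1, T.size y = s.l * N y) {y : ℕ}
    (hy : y ≤ n + 1) (k : ℕ) : T.count k y = if k < N y then s.l else 0 := by
  have hl := s.one_le_l
  induction y generalizing k with
  | zero =>
    have h0 := h 0 hy
    rw [T.size_zero] at h0
    have : N 0 = 0 := by
      rcases mul_eq_zero.1 h0.symm with h | h <;> omega
    simp [this, T.count_zero]
  | succ y ih =>
    have ih := ih (by omega)
    have e1 := h y (by omega)
    have e2 := h (y + 1) hy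
    have c1 : ∀ k < N y, T.count k (y + 1) = s.l := fun k hk => by
      have := T.count_mono k (show y ≤ y + 1 by omega)
      have := ih k
      rw [if_pos hk] at this
      have := T.count_le k (y + 1)
      omega
    have c2 : ∀ k, N y < k → T.count k (y + 1) = 0 := fun k hk => by
      obtain ⟨m, rfl⟩ : ∃ m, k = m + 1 := ⟨k - 1, by omega⟩
      have := T.count_succ_le m y
      have := ih m
      rw [if_neg (by omega)] at this
      omega
    have hNr : ∀ z, z ≤ n + 1 → N z ≤ s.r := fun z hz => by
      have a1 := T.size_mono hz
      rw [T.size_top (show n < n + 1 by omega), h z hz, mul_comm] at a1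
      exact Nat.le_of_mul_le_mul_right a1 hl
    have hsum : T.size (y + 1) = s.l * N y + T.count (N y) (y + 1) := by
      have : T.size (y + 1) = ∑ k ∈ Finset.range (s.r + 1), T.count k (y + 1) := by
        rw [Finset.sum_range_succ, T.count_of_le le_rfl, add_zero]
        rfl
      rw [this, ← Finset.sum_subset (Finset.range_subset_range.2
        (show N y + 1 ≤ s.r + 1 by have := hNr y (by omega); omega)), Finset.sum_range_succ,
        Finset.sum_congr rfl fun k hk => c1 k (Finset.mem_range.1 hk)]
      · simp [mul_comm]
      · intro k _ hk
        exact c2 k (by simp at hk; omega)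
    have hle := T.count_le (N y) (y + 1)
    -- The row `N y` is either full or empty.
    have hN : N (y + 1) = N y ∧ T.count (N y) (y + 1) = 0 ∨
        N (y + 1) = N y + 1 ∧ T.count (N y) (y + 1) = s.l := by
      rw [e2] at hsum
      have g1 : N y ≤ N (y + 1) := Nat.le_of_mul_le_mul_left (by omega) hl
      obtain ⟨d, hd⟩ := Nat.exists_eq_add_of_le g1
      rw [hd, mul_add] at hsum
      have g2 : s.l * d ≤ s.l * 1 := by omega
      have g3 := Nat.le_of_mul_le_mul_left g2 hl
      have g4 : d = 0 ∨ d = 1 := by omega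
      rcases g4 with rfl | rfl
      · left; omega
      · right; omega
    rcases lt_trichotomy k (N y) with hk | rfl | hk
    · rw [c1 k hk, if_pos (by omega)]
    · rcases hN with ⟨h1, h2⟩ | ⟨h1, h2⟩
      · rw [h2, if_neg (by omega)]
      · rw [h2, if_pos (by omega)]
    · rw [c2 k hk, if_neg (by omega)]

theorem size_pr_symm (T : Tab s) {y : ℕ} (hy : y ≤ n) :
    ((pr s).symm T).size y + T.size 1 = T.size (y + 1) := by
  have h1 := size_pr hy ((pr s).symm T)
  have h2 := size_pr (Nat.zero_le n) ((pr s).symm T)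
  rw [Equiv.apply_symm_apply] at h1 h2
  rw [size_zero] at h2
  simp only [zero_add] at h2
  omega

theorem size_pr_symm_iterate (T : Tab s) {k : ℕ} (hk : k ≤ n + 1) :
    (∀ y, y + k ≤ n + 1 → ((pr s).symm^[k] T).size y + T.size k = T.size (y + k)) ∧
    ∀ y ≤ n + 1, n + 1 ≤ y + k →
      ((pr s).symm^[k] T).size y + T.size k = T.size (y + k - (n + 1)) + s.r * s.l := by
  induction k with
  | zero =>
    refine ⟨fun y _ => ?_, fun y h1 h2 => ?_⟩
    · simp [T.size_zero]
    · obtain rfl : y = n + 1 := by omega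
      simp [T.size_zero, T.size_top (show n < n + 1 by omega)]
  | succ k ih =>
    obtain ⟨a1, a2⟩ := ih (by omega)
    rw [Function.iterate_succ_apply']
    have b1 := a1 1 (by omega)
    rw [add_comm 1 k] at b1
    refine ⟨fun y hy => ?_, fun y h1 h2 => ?_⟩
    · have c1 := size_pr_symm ((pr s).symm^[k] T) (show y ≤ n by omega)
      have c2 := a1 (y + 1) (by omega)
      rw [show y + (k + 1) = y + 1 + k by omega]
      omega
    · by_cases hy : y ≤ n
      · have c1 := size_pr_symm ((pr s).symm^[k] T) hy
        have c2 := a2 (y + 1) (by omega) (by omega)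
        rw [show y + (k + 1) = y + 1 + k by omega]
        omega
      · obtain rfl : y = n + 1 := by omega
        rw [size_top _ (by omega), show n + 1 + (k + 1) - (n + 1) = k + 1 by omega]
        omega

theorem size_highest (y : ℕ) : (highest s).size y = s.l * min y s.r := by
  rw [size_eq_sum, Finset.sum_congr rfl fun k _ => count_highest k y]
  have : ∀ m, ∑ k ∈ Finset.range m, (if k < s.r ∧ k < y then s.l else 0) =
      s.l * min m (min y s.r) := by
    intro m
    induction m with
    | zero => simp
    | succ m ih =>
      rw [Finset.sum_range_succ, ih]
      split_ifs with h
      · rw [show min (m + 1) (min y s.r) = min m (min y s.r) + 1 by omega, mul_add, mul_one]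
      · rw [show min (m + 1) (min y s.r) = min m (min y s.r) by omega, add_zero]
  rw [this]
  congr 1
  omega

end Tab

end

/-! ### Triple tensor products are connected -/

namespace Tab

variable {n : ℕ} {s : Shape n}

/-- If each letter occurs `l` times or not at all, and among the letters `≤ K` exactly those `≥ a`
occur, then each operator of the sweep which raises the letters `≤ K` is applied at the bottom of a
string: admitting one more letter adds one full row to the shape formed by the smaller letters. -/
theorem vanishes_sweepWord {K a : ℕ} (hK : K ≤ n) (N : ℕ → ℕ) (T : Tab s)
    (h : ∀ y ≤ n + 1, T.size y = s.l * N y) (hN : ∀ y ≤ K + 1, N y = y - a) :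
    (kr s).Vanishes (sweepWord n K) T := by
  refine (eMaxList_sweepWord hK T).2.2 fun k hk i hi => ?_
  rw [count_of_size N T h (by omega), count_of_size N T h (by omega), hN k (by omega),
    hN (k + 1) (by omega)]
  congr 1
  apply propext
  omega

theorem size_pr_symm_iterate_highest (k : ℕ) (hk : k ≤ n + 1) (hr : s.r ≤ k) :
    ∀ y ≤ n + 1, ((pr s).symm^[k] (highest s)).size y = s.l * min (y - (n + 1 - k)) s.r := by
  intro y hy
  obtain ⟨h1, h2⟩ := (highest s).size_pr_symm_iterate hk
  simp only [size_highest] at h1 h2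
  rcases le_total (y + k) (n + 1) with h | h
  · have := h1 y h
    rw [min_eq_right hr, min_eq_right (by omega)] at this
    rw [show y - (n + 1 - k) = 0 by omega]
    simp
    omega
  · have := h2 y hy h
    rw [min_eq_right hr, mul_comm s.r] at this
    rw [show y - (n + 1 - k) = y + k - (n + 1) by omega]
    omega

theorem size_eMaxList_sweepWord {a c : ℕ} (hc : 0 < c) (hac : a + c ≤ n + 1) (hcr : c ≤ s.r)
    (T : Tab s) (h : ∀ y ≤ n + 1, T.size y = s.l * min (y - a) s.r) :
    ∀ y ≤ n + 1, ((kr s).eMaxList (sweepWord n (a + c - 1)) T).size y =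
      s.l * if y ≤ a + c then min y c else min (y - a) s.r := by
  intro y hy
  obtain ⟨h1, h2, -⟩ := eMaxList_sweepWord (show a + c - 1 ≤ n by omega) T
  split_ifs with hya
  · rw [size_eq_sum, Finset.sum_congr rfl (g := fun k => (highest ⟨c, s.l, hc,
      hcr.trans s.r_le, s.one_le_l⟩).count k y), ← size_eq_sum, size_highest]
    intro k hk
    rw [h1 y (by omega) k (Finset.mem_range.1 hk), count_of_size _ T h (by omega), count_highest]
    have := Finset.mem_range.1 hk
    congr 1
    apply propext
    simp only
    omega
  · rw [← h y hy]
    exact Finset.sum_congr rfl fun k _ => h2 y (by omega) k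

theorem size_pr_symm_iterate_sweepWord {a c : ℕ} (hc : 0 < c) (hac : a + c ≤ n + 1)
    (hcr : c ≤ s.r) (hr : s.r = c ∨ a + s.r = n + 1) (T : Tab s)
    (h : ∀ y ≤ n + 1, T.size y = s.l * if y ≤ a + c then min y c else min (y - a) s.r) :
    ∀ y ≤ n + 1, ((pr s).symm^[c] T).size y = s.l * (y - (n + 1 - s.r)) := by
  intro y hy
  have hrn := s.r_le
  obtain ⟨h1, h2⟩ := T.size_pr_symm_iterate (show c ≤ n + 1 by omega)
  have hsc := h c (by omega)
  rw [if_pos (by omega), min_self] at hsc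
  rcases le_total (y + c) (n + 1) with hyc | hyc
  · have e1 := h1 y hyc
    rw [hsc, h _ (by omega)] at e1
    have : (if y + c ≤ a + c then min (y + c) c else min (y + c - a) s.r) =
        (y - (n + 1 - s.r)) + c := by
      split_ifs <;> omega
    rw [this, mul_add] at e1
    omega
  · have e1 := h2 y hy hyc
    rw [hsc, h _ (by omega), mul_comm s.r, if_pos (by omega), min_eq_left (by omega),
      ← mul_add] at e1
    have : y + c - (n + 1) + s.r = (y - (n + 1 - s.r)) + c := by omega
    rw [this, mul_add] at e1
    omega

end Tab

section

variable {n : ℕ} (s t u : Shape n)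

/-- `B ⊗ B' ⊗ B''` is connected. -/
theorem conn_highest (z : Tab s × Tab t × Tab u) :
    ((kr s).tensor ((kr t).tensor (kr u))).Conn z
      (Tab.highest s, Tab.highest t, Tab.highest u) := by
  have hs := kr_regular s
  have ht := kr_regular t
  have hu := kr_regular u
  have htu := ht.tensor hu
  have hC := hs.tensor htu
  have hrot := (kr_rotates s).tensor ((kr_rotates t).tensor (kr_rotates u))
  have hsn := s.r_le
  have htn := t.r_le
  have hs1 := s.one_le_r
  have ht1 := t.one_le_r
  generalize hCdef : (kr s).tensor ((kr t).tensor (kr u)) = C at *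
  generalize hg : (Tab.pr s).prodCongr ((Tab.pr t).prodCongr (Tab.pr u)) = g at *
  have hgk : ∀ k (x : Tab s × Tab t × Tab u), g.symm^[k] x =
      ((Tab.pr s).symm^[k] x.1, (Tab.pr t).symm^[k] x.2.1, (Tab.pr u).symm^[k] x.2.2) := by
    intro k x
    induction k with
    | zero => rfl
    | succ k ih => rw [Function.iterate_succ_apply', ih, ← hg]; simp [Function.iterate_succ_apply']
  have hinv : ∀ k (x : Tab s × Tab t × Tab u), ∃ y, g.symm^[k] y = x := fun k x =>
    ⟨g^[k] x, Function.LeftInverse.iterate g.symm_apply_apply k x⟩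
  -- Every element is connected to one whose first factor is the lowest tableau.
  have r1 : ∀ z, ∃ x, C.Conn z ((Tab.pr s).symm^[s.r] (Tab.highest s), x) := by
    intro z
    obtain ⟨y, rfl⟩ := hinv s.r z
    have h1 := hrot.conn_symm_iterate s.r (hC.conn_eMaxList (sweepWord n n) y)
    have h2 : (C.eMaxList (sweepWord n n) y).1 = Tab.highest s := by
      rw [← hCdef, hs.eMaxList_tensor_fst htu, Tab.eMaxList_eq_highest]
    rw [hgk _ (C.eMaxList _ _), h2] at h1
    exact ⟨_, h1⟩
  have low : ∀ (s : Shape n) (T : Tab s),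
      (∀ y ≤ n + 1, T.size y = s.l * (y - (n + 1 - s.r))) →
      (kr s).Vanishes (sweepWord n n) T := fun s T h =>
    Tab.vanishes_sweepWord le_rfl _ T h fun y _ => rfl
  have r2 : ∀ z, ∃ x, C.Conn z (Tab.highest s, Tab.highest t, x) := by
    intro z
    obtain ⟨x, hx⟩ := r1 z
    have h1 := hC.conn_eMaxList (sweepWord n n) ((Tab.pr s).symm^[s.r] (Tab.highest s), x)
    have h2 : (kr s).Vanishes (sweepWord n n) ((Tab.pr s).symm^[s.r] (Tab.highest s)) := by
      refine low s _ fun y hy => ?_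
      rw [Tab.size_pr_symm_iterate_highest _ (by omega) le_rfl y hy, min_eq_left (by omega)]
    have h3 := ht.eMaxList_tensor_fst hu (sweepWord n n) x
    rw [← hCdef, hs.eMaxList_tensor htu _ h2, Tab.eMaxList_eq_highest, hCdef] at h1
    rw [Tab.eMaxList_eq_highest] at h3
    refine ⟨(((kr t).tensor (kr u)).eMaxList (sweepWord n n) x).2, .trans _ _ _ hx ?_⟩
    rw [← h3]
    exact h1
  have shift : ∀ k a b, (∀ z, ∃ x, C.Conn z (a, b, x)) →
      ∀ z, ∃ x, C.Conn z ((Tab.pr s).symm^[k] a, (Tab.pr t).symm^[k] b, x) := by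
    intro k a b h z
    obtain ⟨y, rfl⟩ := hinv k z
    obtain ⟨x, hx⟩ := h y
    have := hrot.conn_symm_iterate k hx
    rw [hgk _ (a, b, x)] at this
    exact ⟨_, this⟩
  -- The two first factors have the letters `≥ a` and the letters `a, …, a + c - 1`, where `c` is
  -- the smaller one of the numbers of rows. The latter are moved down to `0, …, c - 1` in both of
  -- them, and then they are rotated to the top.
  obtain ⟨a, c, hc, hac, hcs, hct, ha, hsc, htc⟩ : ∃ a c, 0 < c ∧ a + c ≤ n + 1 ∧ c ≤ s.r ∧
      c ≤ t.r ∧ a + max s.r t.r = n + 1 ∧ (s.r = c ∨ a + s.r = n + 1) ∧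
      (t.r = c ∨ a + t.r = n + 1) :=
    ⟨n + 1 - max s.r t.r, min s.r t.r, by omega, by omega, by omega, by omega, by omega, by omega,
      by omega⟩
  have r3 := shift (max s.r t.r) _ _ r2
  have sz : ∀ s' : Shape n, s'.r ≤ max s.r t.r → ∀ y ≤ n + 1,
      ((Tab.pr s').symm^[max s.r t.r] (Tab.highest s')).size y = s'.l * min (y - a) s'.r := by
    intro s' hs' y hy
    rw [Tab.size_pr_symm_iterate_highest _ (by omega) hs' y hy,
      show n + 1 - max s.r t.r = a by omega]
  have szs := sz s (le_max_left _ _)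
  have szt := sz t (le_max_right _ _)
  generalize (Tab.pr s).symm^[max s.r t.r] (Tab.highest s) = T₁ at r3 szs
  generalize (Tab.pr t).symm^[max s.r t.r] (Tab.highest t) = T₂ at r3 szt
  have r4 : ∀ z, ∃ x, C.Conn z ((kr s).eMaxList (sweepWord n (a + c - 1)) T₁,
      (kr t).eMaxList (sweepWord n (a + c - 1)) T₂, x) := by
    intro z
    obtain ⟨x, hx⟩ := r3 z
    have h1 := hC.conn_eMaxList (sweepWord n (a + c - 1)) (T₁, T₂, x)
    have h2 : (kr s).Vanishes (sweepWord n (a + c - 1)) T₁ :=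
      Tab.vanishes_sweepWord (by omega) (a := a) _ T₁ szs fun y hy => by omega
    have h3 := ht.eMaxList_tensor_fst hu (sweepWord n (a + c - 1)) (T₂, x)
    rw [← hCdef, hs.eMaxList_tensor htu _ h2, hCdef] at h1
    refine ⟨(((kr t).tensor (kr u)).eMaxList (sweepWord n (a + c - 1)) (T₂, x)).2,
      .trans _ _ _ hx ?_⟩
    rw [← h3]
    exact h1
  have r5 := shift c _ _ r4
  have sz5s := Tab.size_pr_symm_iterate_sweepWord hc hac hcs hsc _
    (Tab.size_eMaxList_sweepWord hc hac hcs T₁ szs)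
  have sz5t := Tab.size_pr_symm_iterate_sweepWord hc hac hct htc _
    (Tab.size_eMaxList_sweepWord hc hac hct T₂ szt)
  obtain ⟨x, hx⟩ := r5 z
  refine .trans _ _ _ hx ?_
  have h1 := hC.conn_eMaxList (sweepWord n n) (((Tab.pr s).symm^[c]
    ((kr s).eMaxList (sweepWord n (a + c - 1)) T₁)), ((Tab.pr t).symm^[c]
    ((kr t).eMaxList (sweepWord n (a + c - 1)) T₂)), x)
  rw [← hCdef, hs.eMaxList_tensor htu _ (low s _ sz5s), ht.eMaxList_tensor hu _ (low t _ sz5t),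
    Tab.eMaxList_eq_highest, Tab.eMaxList_eq_highest, Tab.eMaxList_eq_highest, hCdef] at h1
  exact h1

end

/-! ### Morphisms of crystals and combinatorial R -/

namespace Crystal

variable {I A B A' B' K : Type}

/-- A strict morphism of crystals. -/
structure IsHom (C : Crystal I A) (D : Crystal I B) (g : A → B) : Prop where
  e : ∀ i a, D.e i (g a) = (C.e i a).map g
  f : ∀ i a, D.f i (g a) = (C.f i a).map g
  ε : ∀ i a, D.ε i (g a) = C.ε i a
  φ : ∀ i a, D.φ i (g a) = C.φ i a

namespace IsHom

variable {C : Crystal I A} {D : Crystal I B} {C' : Crystal I A'} {D' : Crystal I B'}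
  {F : Crystal I K}

theorem id (C : Crystal I A) : C.IsHom C id := ⟨by simp, by simp, by simp, by simp⟩

theorem comp {g : B → K} {h : A → B} (hg : D.IsHom F g) (hh : C.IsHom D h) :
    C.IsHom F (g ∘ h) where
  e i a := by simp [hg.e, hh.e, Option.map_map]
  f i a := by simp [hg.f, hh.f, Option.map_map]
  ε i a := by simp [hg.ε, hh.ε]
  φ i a := by simp [hg.φ, hh.φ]

theorem symm {g : A ≃ B} (hg : C.IsHom D g) : D.IsHom C g.symm where
  e i a := by
    obtain ⟨a, rfl⟩ := g.surjective a
    simp [hg.e, Option.map_map]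
  f i a := by
    obtain ⟨a, rfl⟩ := g.surjective a
    simp [hg.f, Option.map_map]
  ε i a := by
    obtain ⟨a, rfl⟩ := g.surjective a
    simp [hg.ε]
  φ i a := by
    obtain ⟨a, rfl⟩ := g.surjective a
    simp [hg.φ]

theorem tensor {g : A → B} {h : A' → B'} (hg : C.IsHom D g) (hh : C'.IsHom D' h) :
    (C.tensor C').IsHom (D.tensor D') (Prod.map g h) where
  e i a := by
    simp only [Crystal.tensor, Prod.map_fst, Prod.map_snd, hg.e, hh.e, hh.ε, hg.φ]
    split_ifs <;> simp [Option.map_map, Function.comp_def]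
  f i a := by
    simp only [Crystal.tensor, Prod.map_fst, Prod.map_snd, hg.f, hh.f, hh.ε, hg.φ]
    split_ifs <;> simp [Option.map_map, Function.comp_def]
  ε i a := by simp [Crystal.tensor, hg.ε, hg.φ, hh.ε]
  φ i a := by simp [Crystal.tensor, hh.φ, hg.φ, hh.ε]

/-- The tensor product of crystals is associative. -/
theorem assoc (C : Crystal I A) (D : Crystal I B) (F : Crystal I K) :
    ((C.tensor D).tensor F).IsHom (C.tensor (D.tensor F)) (Equiv.prodAssoc A B K) where
  e i x := by
    obtain ⟨⟨a, b⟩, c⟩ := x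
    simp only [Crystal.tensor, Equiv.prodAssoc_apply]
    by_cases h1 : F.ε i c ≤ D.φ i b <;> by_cases h2 : D.ε i b ≤ C.φ i a <;>
      by_cases h3 : D.ε i b + (F.ε i c - D.φ i b) ≤ C.φ i a <;>
      by_cases h4 : F.ε i c ≤ D.φ i b + (C.φ i a - D.ε i b) <;>
      first
      | omega
      | simp [h1, h2, h3, h4, Option.map_map, Function.comp_def]
  f i x := by
    obtain ⟨⟨a, b⟩, c⟩ := x
    simp only [Crystal.tensor, Equiv.prodAssoc_apply]
    by_cases h1 : F.ε i c < D.φ i b <;> by_cases h2 : D.ε i b < C.φ i a <;>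
      by_cases h3 : D.ε i b + (F.ε i c - D.φ i b) < C.φ i a <;>
      by_cases h4 : F.ε i c < D.φ i b + (C.φ i a - D.ε i b) <;>
      first
      | omega
      | simp [h1, h2, h3, h4, Option.map_map, Function.comp_def]
  ε i x := by
    simp only [Crystal.tensor, Equiv.prodAssoc_apply]
    omega
  φ i x := by
    simp only [Crystal.tensor, Equiv.prodAssoc_apply]
    omega

/-- Forgetting the degrees. -/
theorem aff_snd {m : ℕ} (C : Crystal (Fin (m + 1)) B) : C.aff.IsHom C Prod.snd where
  e i a := by simp [Crystal.aff, Option.map_map, Function.comp_def]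
  f i a := by simp [Crystal.aff, Option.map_map, Function.comp_def]
  ε i a := rfl
  φ i a := rfl

end IsHom

/-- Conjugating a morphism by rotations gives a morphism. -/
theorem IsHom.conj_symm {n : ℕ} {C : Crystal (Fin (n + 1)) A} {D : Crystal (Fin (n + 1)) B}
    {Φ : A → B} (hΦ : C.IsHom D Φ) {g : A ≃ A} {h : B ≃ B} (hg : C.Rotates g)
    (hh : D.Rotates h) : C.IsHom D fun a => h.symm (Φ (g a)) where
  e i a := by
    apply Option.map_injective h.injective
    rw [← hh.e]
    simp [hΦ.e, hg.e, Option.map_map, Function.comp_def]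
  f i a := by
    apply Option.map_injective h.injective
    rw [← hh.f]
    simp [hΦ.f, hg.f, Option.map_map, Function.comp_def]
  ε i a := by rw [← hh.ε]; simp [hΦ.ε, hg.ε]
  φ i a := by rw [← hh.φ]; simp [hΦ.φ, hg.φ]

theorem Rotates.isHom {n : ℕ} {C : Crystal (Fin (n + 1)) A} {g : A ≃ A} (hg : C.Rotates g) :
    C.IsHom ⟨fun i => C.e (i + 1), fun i => C.f (i + 1), fun i => C.ε (i + 1),
      fun i => C.φ (i + 1)⟩ g := ⟨hg.e, hg.f, hg.ε, hg.φ⟩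

theorem IsHom.conj {n : ℕ} {C : Crystal (Fin (n + 1)) A} {D : Crystal (Fin (n + 1)) B}
    {Φ : A → B} (hΦ : C.IsHom D Φ) {g : A ≃ A} {h : B ≃ B} (hg : C.Rotates g)
    (hh : D.Rotates h) : C.IsHom D fun a => h (Φ (g.symm a)) where
  e i a := by
    have h1 := hg.isHom.symm.e (i - 1) a
    have h2 := hh.e (i - 1) (Φ (g.symm a))
    simp only [sub_add_cancel] at h1 h2
    rw [h2, hΦ.e, h1, Option.map_map, Option.map_map]
    rfl
  f i a := by
    have h1 := hg.isHom.symm.f (i - 1) a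
    have h2 := hh.f (i - 1) (Φ (g.symm a))
    simp only [sub_add_cancel] at h1 h2
    rw [h2, hΦ.f, h1, Option.map_map, Option.map_map]
    rfl
  ε i a := by
    have h1 := hg.isHom.symm.ε (i - 1) a
    have h2 := hh.ε (i - 1) (Φ (g.symm a))
    simp only [sub_add_cancel] at h1 h2
    rw [h2, hΦ.ε, h1]
  φ i a := by
    have h1 := hg.isHom.symm.φ (i - 1) a
    have h2 := hh.φ (i - 1) (Φ (g.symm a))
    simp only [sub_add_cancel] at h1 h2
    rw [h2, hΦ.φ, h1]

end Crystal

section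

variable {n : ℕ} {s t : Shape n}

/-- The weight in terms of the content. -/
theorem kr_weight (x : Fin n) (T : Tab s) : ((kr s).φ x.succ T : ℤ) - (kr s).ε x.succ T =
    2 * T.size (x + 1) - T.size (x + 2) - T.size x := by
  rw [kr_φ, Tab.height_eq_size]
  ring

theorem eq_zero_of_second_difference (D : ℕ → ℤ) (h0 : D 0 = 0) (h1 : D (n + 1) = 0)
    (h : ∀ x < n, 2 * D (x + 1) - D (x + 2) - D x = 0) {y : ℕ} (hy : y ≤ n + 1) : D y = 0 := by
  have key : ∀ y, y ≤ n → D y = y * D 1 ∧ D (y + 1) = (y + 1) * D 1 := by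
    intro y
    induction y with
    | zero => intro _; simp [h0]
    | succ y ih =>
      intro hy
      obtain ⟨a1, a2⟩ := ih (by omega)
      refine ⟨by push_cast; exact a2, ?_⟩
      have := h y (by omega)
      push_cast
      linear_combination -this + 2 * a2 - a1
  have h2 : D 1 = 0 := by
    have := (key n le_rfl).2
    rw [h1] at this
    rcases mul_eq_zero.1 this.symm with h | h
    · omega
    · exact h
  cases y with
  | zero => exact h0
  | succ y => rw [(key y (by omega)).2, h2, mul_zero]

namespace CombinatorialR

theorem isHom (R : CombinatorialR s t) :
    ((kr s).aff.tensor (kr t).aff).IsHom ((kr t).aff.tensor (kr s).aff) (affMap R.σ R.H) :=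
  ⟨R.map_e, R.map_f, R.map_ε, R.map_φ⟩

theorem isHom_σ_ε (R : CombinatorialR s t) (i : Fin (n + 1)) (b : Tab s) (c : Tab t) :
    ((kr t).tensor (kr s)).ε i (R.σ (b, c)) = ((kr s).tensor (kr t)).ε i (b, c) :=
  R.map_ε i ((0, b), (0, c))

theorem isHom_σ_φ (R : CombinatorialR s t) (i : Fin (n + 1)) (b : Tab s) (c : Tab t) :
    ((kr t).tensor (kr s)).φ i (R.σ (b, c)) = ((kr s).tensor (kr t)).φ i (b, c) :=
  R.map_φ i ((0, b), (0, c))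

/-- The combinatorial R preserves the content. -/
theorem size_add_size (R : CombinatorialR s t) (b : Tab s) (c : Tab t) {y : ℕ} (hy : y ≤ n + 1) :
    (R.σ (b, c)).1.size y + (R.σ (b, c)).2.size y = b.size y + c.size y := by
  have := eq_zero_of_second_difference (n := n) (fun y => ((R.σ (b, c)).1.size y : ℤ) +
    (R.σ (b, c)).2.size y - (b.size y + c.size y)) (by simp [Tab.size_zero])
    (by simp [Tab.size_top]; ring) (fun x hx => ?_) hy
  · omega
  · have h1 := R.isHom_σ_ε (⟨x, hx⟩ : Fin n).succ b c
    have h2 := R.isHom_σ_φ (⟨x, hx⟩ : Fin n).succ b c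
    have w1 := kr_weight ⟨x, hx⟩ b
    have w2 := kr_weight ⟨x, hx⟩ c
    have w3 := kr_weight ⟨x, hx⟩ (R.σ (b, c)).1
    have w4 := kr_weight ⟨x, hx⟩ (R.σ (b, c)).2
    simp only [Crystal.tensor] at h1 h2
    simp only at w1 w2 w3 w4
    omega

end CombinatorialR

theorem Tab.eq_highest_of_size (T : Tab s) (h : ∀ y ≤ n + 1, T.size y = s.l * min y s.r) :
    T = highest s := by
  refine ext_count fun k y hk => ?_
  by_cases hy : y ≤ n + 1
  · rw [count_of_size _ T h hy, count_of_size _ (highest s) (fun y _ => size_highest y) hy]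
  · rw [count_top _ hk (by omega), count_top _ hk (by omega)]

theorem Crystal.eMaxList_of_ε {I B : Type} {C : Crystal I B} {w : List I} {b : B}
    (h : ∀ i ∈ w, C.ε i b = 0) : C.eMaxList w b = b := by
  induction w with
  | nil => rfl
  | cons i w ih =>
    change C.eMaxList w (C.eMax i b) = b
    rw [Crystal.eMax_of_ε (h i (by simp)), ih fun j hj => h j (by simp [hj])]

theorem mem_descWord {k : ℕ} (hk : k ≤ n) {i : Fin (n + 1)} (hi : i ∈ descWord n k) : i ≠ 0 := by
  induction k with
  | zero => simp [descWord] at hi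
  | succ k ih =>
    rw [descWord, List.mem_cons, ofNat_succ hk] at hi
    rcases hi with rfl | hi
    · exact Fin.succ_ne_zero _
    · exact ih (by omega) hi

theorem mem_sweepWord {k : ℕ} (hk : k ≤ n) {i : Fin (n + 1)} (hi : i ∈ sweepWord n k) :
    i ≠ 0 := by
  induction k with
  | zero => simp [sweepWord] at hi
  | succ k ih =>
    rw [sweepWord, List.mem_append] at hi
    rcases hi with hi | hi
    · exact ih (by omega) hi
    · exact mem_descWord hk hi

/-- The highest element is characterized by the vanishing of `ε i` for `i ≠ 0`. -/
theorem Tab.eq_highest_of_ε (T : Tab s) (h : ∀ i, i ≠ 0 → (kr s).ε i T = 0) : T = highest s := by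
  rw [← T.eMaxList_eq_highest, Crystal.eMaxList_of_ε]
  exact fun i hi => h i (mem_sweepWord le_rfl hi)

theorem Tab.ε_highest {i : Fin (n + 1)} (hi : i ≠ 0) : (kr s).ε i (highest s) = 0 := by
  obtain ⟨x, rfl⟩ := Fin.exists_succ_eq.2 hi
  have h1 := (highest s).size_add_ε_le x
  rw [size_eq_sum, Finset.sum_congr rfl (g := fun k => (highest s).count k (x + 2))] at h1
  · omega
  · intro k hk
    have := Finset.mem_range.1 hk
    rw [count_highest, count_highest]
    congr 1
    apply propext
    omega

end

/-! ### Inverses and rotations of combinatorial R -/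

section

variable {n : ℕ} {s t : Shape n}

namespace CombinatorialR

theorem σ_highest (R : CombinatorialR s t) :
    R.σ (Tab.highest s, Tab.highest t) = (Tab.highest t, Tab.highest s) := by
  have h1 : (R.σ (Tab.highest s, Tab.highest t)).1 = Tab.highest t := by
    refine Tab.eq_highest_of_ε _ fun i hi => ?_
    have h := R.isHom_σ_ε i (Tab.highest s) (Tab.highest t)
    simp only [Crystal.tensor, Tab.ε_highest hi] at h
    omega
  refine Prod.ext h1 (Tab.eq_highest_of_size _ fun y hy => ?_)
  have h := R.size_add_size (Tab.highest s) (Tab.highest t) hy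
  rw [h1, Tab.size_highest (s := s)] at h
  omega

/-- The inverse of a combinatorial R. -/
def inv (R : CombinatorialR s t) : CombinatorialR t s :=
  have hσ : ∀ x, affMap R.σ.symm (fun z => R.H (R.σ.symm z)) (affMap R.σ R.H x) = x := fun x => by
    simp [affMap]
  have hσ' : ∀ x, affMap R.σ R.H (affMap R.σ.symm (fun z => R.H (R.σ.symm z)) x) = x := fun x => by
    simp [affMap]
  have h := (Crystal.IsHom.symm (g := ⟨affMap R.σ R.H, _, hσ, hσ'⟩) R.isHom)
  { σ := R.σ.symm
    H := fun z => R.H (R.σ.symm z)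
    map_e := h.e
    map_f := h.f
    map_ε := h.ε
    map_φ := h.φ
    H_highest := by rw [← R.σ_highest, Equiv.symm_apply_apply, R.H_highest] }

/-- The energy function is invariant under the classical operators. -/
theorem H_e (R : CombinatorialR s t) {i : Fin (n + 1)} (hi : i ≠ 0) {z z' : Tab s × Tab t}
    (h : ((kr s).tensor (kr t)).e i z = some z') : R.H z' = R.H z := by
  have deg : ∀ {s t : Shape n} {x x' : (ℤ × Tab s) × (ℤ × Tab t)},
      ((kr s).aff.tensor (kr t).aff).e i x = some x' → x'.1.1 = x.1.1 := by
    intro s t x x' h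
    rcases Crystal.tensor_e_some h with ⟨-, h1, -⟩ | ⟨-, -, h1⟩
    · simp only [Crystal.aff, Option.map_eq_some_iff, if_neg hi, add_zero] at h1
      obtain ⟨a, -, ha⟩ := h1
      rw [← ha]
    · rw [h1]
  have deg' : ∀ {s t : Shape n} {x x' : (ℤ × Tab s) × (ℤ × Tab t)},
      ((kr s).aff.tensor (kr t).aff).e i x = some x' → x'.2.1 = x.2.1 := by
    intro s t x x' h
    rcases Crystal.tensor_e_some h with ⟨-, -, h1⟩ | ⟨-, h1, -⟩
    · rw [h1]
    · simp only [Crystal.aff, Option.map_eq_some_iff, if_neg hi, add_zero] at h1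
      obtain ⟨a, -, ha⟩ := h1
      rw [← ha]
  have h1 := ((Crystal.IsHom.aff_snd (kr s)).tensor (Crystal.IsHom.aff_snd (kr t))).e i
    (((0 : ℤ), z.1), ((0 : ℤ), z.2))
  simp only [Prod.map_apply, Prod.mk.eta, h] at h1
  obtain ⟨x', hx, rfl⟩ := Option.map_eq_some_iff.1 h1.symm
  have h2 := R.map_e i (((0 : ℤ), z.1), ((0 : ℤ), z.2))
  rw [hx, Option.map_some] at h2
  have h3 := deg h2
  have h4 := deg' hx
  simp only [affMap] at h3 h4
  simp only [Prod.map, Prod.mk.eta] at h3 ⊢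
  omega

theorem H_eMaxList (R : CombinatorialR s t) {w : List (Fin (n + 1))} (hw : ∀ i ∈ w, i ≠ 0)
    (z : Tab s × Tab t) : R.H (((kr s).tensor (kr t)).eMaxList w z) = R.H z := by
  have hC := (kr_regular s).tensor (kr_regular t)
  induction w generalizing z with
  | nil => rfl
  | cons i w ih =>
    change R.H (((kr s).tensor (kr t)).eMaxList w (((kr s).tensor (kr t)).eMax i z)) = _
    rw [ih fun j hj => hw j (by simp [hj])]
    induction z using hC.e_induction i with
    | h0 z h => rw [Crystal.eMax_of_ε h]
    | h1 z z' h ih' => rw [hC.eMax_of_e h, ih', R.H_e (hw i (by simp)) h]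

end CombinatorialR

/-- The word `1, 2, …, K`. -/
def ascWord (n : ℕ) : ℕ → List (Fin (n + 1))
  | 0 => []
  | K + 1 => ascWord n K ++ [Fin.ofNat (n + 1) (K + 1)]

theorem mem_ascWord {k : ℕ} (hk : k ≤ n) {i : Fin (n + 1)} (hi : i ∈ ascWord n k) : i ≠ 0 := by
  induction k with
  | zero => simp [ascWord] at hi
  | succ k ih =>
    rw [ascWord, List.mem_append, ofNat_succ hk, List.mem_singleton] at hi
    rcases hi with hi | rfl
    · exact ih (by omega) hi
    · exact Fin.succ_ne_zero _

theorem eMaxList_ascWord {K : ℕ} (hK : K ≤ n) (T : Tab s)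
    (h : ∀ y ≤ n + 1, ∀ k, T.count k y = if k < min (y - 1) s.r then s.l else 0) :
    (∀ y ≤ K, ∀ k, ((kr s).eMaxList (ascWord n K) T).count k y =
      if k < min y s.r then s.l else 0) ∧
    (∀ y ≤ n + 1, K < y → ∀ k, ((kr s).eMaxList (ascWord n K) T).count k y =
      if k < min (y - 1) s.r then s.l else 0) ∧
    (kr s).Vanishes (ascWord n K) T := by
  induction K with
  | zero =>
    refine ⟨fun y hy k => ?_, fun y hy _ k => h y hy k, trivial⟩
    have := h y (by omega) k
    rwa [show y - 1 = y by omega] at this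
  | succ K ih =>
    obtain ⟨a1, a2, a3⟩ := ih (by omega)
    have hw : ascWord n (K + 1) = ascWord n K ++ [(⟨K, hK⟩ : Fin n).succ] := by
      rw [ascWord, ofNat_succ hK]
    rw [hw, Crystal.eMaxList_append]
    generalize hU : (kr s).eMaxList (ascWord n K) T = U at a1 a2 a3
    have htr : ∀ k < K, U.count k K = U.count k (K + 1) := fun k _ => by
      rw [a1 K le_rfl, a2 (K + 1) (by omega) (by omega)]
      simp
    have hc := fun k => Tab.count_eMax ⟨K, hK⟩ U htr (k := k)
    have hn := fun y => count_eMax_ne ⟨K, hK⟩ U (y := y)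
    simp only at hc hn
    change (∀ y ≤ K + 1, ∀ k, ((kr s).eMax (⟨K, hK⟩ : Fin n).succ U).count k y = _) ∧
      (∀ y ≤ n + 1, K + 1 < y → ∀ k, ((kr s).eMax (⟨K, hK⟩ : Fin n).succ U).count k y = _) ∧ _
    refine ⟨fun y hy k => ?_, fun y hy hy' k => ?_, a3.append ⟨?_, trivial⟩⟩
    · by_cases hy' : y ≤ K
      · rw [hn y k (by omega), a1 y hy']
      · obtain rfl : y = K + 1 := by omega
        by_cases hk : k ≤ K
        · rw [hc k hk, a2 (K + 2) (by omega) (by omega)]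
          simp
        · rw [Tab.count_of_le_row _ (by omega), if_neg (by omega)]
    · rw [hn y k (by omega), a2 y hy (by omega)]
    · rw [hU]
      refine Tab.φ_eq_zero ⟨K, hK⟩ U htr ?_
      simp only
      rw [a2 (K + 1) (by omega) (by omega), a2 (K + 2) (by omega) (by omega), if_neg (by omega),
        if_neg (by omega)]

theorem Tab.eMaxList_pr_highest :
    (kr s).eMaxList (ascWord n n) (Tab.pr s (Tab.highest s)) = Tab.highest s ∧
    (kr s).Vanishes (ascWord n n) (Tab.pr s (Tab.highest s)) := by
  have hr := s.r_le
  have hsz : ∀ y ≤ n + 1, (Tab.pr s (Tab.highest s)).size y = s.l * min (y - 1) s.r := by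
    intro y hy
    cases y with
    | zero => simp [Tab.size_zero]
    | succ y =>
      have h1 := Tab.size_pr (show y ≤ n by omega) (Tab.highest s)
      rw [Tab.size_highest, Tab.size_highest, Tab.size_highest, min_eq_right hr,
        min_eq_right (show s.r ≤ n + 1 by omega)] at h1
      rw [Nat.add_sub_cancel]
      omega
  obtain ⟨a1, a2, a3⟩ := eMaxList_ascWord le_rfl _ fun y hy k => Tab.count_of_size _ _ hsz hy k
  refine ⟨Tab.eq_highest_of_size _ fun y hy => ?_, a3⟩
  rw [← Tab.size_highest]
  refine Finset.sum_congr rfl fun k hk => ?_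
  have := Finset.mem_range.1 hk
  rw [Tab.count_highest]
  by_cases hy' : y ≤ n
  · rw [a1 y hy']
    congr 1
    apply propext
    omega
  · rw [a2 y hy (by omega)]
    congr 1
    apply propext
    omega

theorem Tab.eMaxList_pr_symm_highest :
    (kr s).eMaxList (descWord n n) ((Tab.pr s).symm (Tab.highest s)) = Tab.highest s ∧
    (kr s).Vanishes (descWord n n) ((Tab.pr s).symm (Tab.highest s)) := by
  have hr := s.r_le
  have hr1 := s.one_le_r
  have hsz : ∀ y ≤ n + 1, ((Tab.pr s).symm (Tab.highest s)).size y =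
      s.l * if y ≤ n then min y (s.r - 1) else s.r := by
    intro y hy
    split_ifs with hy'
    · have h1 := Tab.size_pr_symm (Tab.highest s) hy'
      rw [Tab.size_highest, Tab.size_highest, min_eq_left hr1,
        show min (y + 1) s.r = min y (s.r - 1) + 1 by omega, mul_add] at h1
      omega
    · rw [Tab.size_top _ (by omega), mul_comm]
  have hc := fun y hy k => Tab.count_of_size _ _ hsz (y := y) hy k
  obtain ⟨a1, -, a3⟩ := eMaxList_descWord (fun i => if i < s.r - 1 then s.l else 0)
    (fun i => if i < s.r then s.l else 0) le_rfl ((Tab.pr s).symm (Tab.highest s))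
    (fun y hy i hi => by
      rw [hc y (by omega) i, if_pos hy]
      congr 1
      apply propext
      omega)
    (fun i hi => by rw [hc (n + 1) le_rfl i, if_neg (show ¬ n + 1 ≤ n by omega)])
  refine ⟨Tab.eq_highest_of_size _ fun y hy => ?_, a3 fun i _ => ?_⟩
  · rw [← Tab.size_highest, Tab.size_eq_sum, Tab.size_eq_sum]
    refine Finset.sum_congr rfl fun k hk => ?_
    have := Finset.mem_range.1 hk
    rw [a1 y hy k this, Tab.count_highest]
    congr 1
    apply propext
    omega
  · congr 1
    apply propext
    omega

theorem size_of_e {i : Fin (n + 1)} {T T' : Tab s} (h : (kr s).e i T = some T') :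
    (T'.size n : ℤ) + (if i = 0 then 1 else 0) = T.size n + if i + 1 = 0 then 1 else 0 := by
  have hn : 0 < n := s.one_le_r.trans s.r_le
  cases i using Fin.cases with
  | zero =>
    have h1 := kr_e_pr 0 T
    rw [h, zero_add, Option.map_some, one_eq_succ hn, kr_e_iff] at h1
    obtain ⟨k, hk⟩ := h1
    have h2 := hk.size_self
    have h3 := Tab.size_pr (Nat.zero_le n) T
    have h4 := Tab.size_pr (Nat.zero_le n) T'
    rw [Tab.size_zero, Tab.size_top _ (Nat.lt_succ_self n)] at h3 h4
    have h5 : (0 : Fin (n + 1)) + 1 ≠ 0 := by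
      rw [zero_add, one_eq_succ hn]
      exact Fin.succ_ne_zero _
    rw [if_pos rfl, if_neg h5]
    simp only [zero_add] at h2 h3 h4
    omega
  | succ x =>
    obtain ⟨k, hk⟩ := (kr_e_iff x T T').1 h
    rw [if_neg (Fin.succ_ne_zero x)]
    have hx : x.succ + 1 = 0 ↔ (x : ℕ) + 1 = n := by
      rw [Fin.ext_iff, Fin.val_add_one]
      split_ifs with h'
      · simpa [Fin.ext_iff] using h'
      · simpa [Fin.ext_iff] using h'
    simp only [hx]
    split_ifs with hxn
    · have := hk.size_self
      rw [hxn] at this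
      omega
    · have := hk.size_ne (y := n) (by omega)
      omega

/-- Promotion as an operator on the affinization. The degree is increased by the number of letters
`≠ n`; up to an additive constant this is the only choice which makes the operators `e 0` and `e 1`
compatible with the rotation of the colours. -/
def affPr (s : Shape n) : ℤ × Tab s ≃ ℤ × Tab s where
  toFun x := (x.1 + x.2.size n, Tab.pr s x.2)
  invFun x := (x.1 - ((Tab.pr s).symm x.2).size n, (Tab.pr s).symm x.2)
  left_inv x := by simp
  right_inv x := by simp

theorem affPr_rotates (s : Shape n) : (kr s).aff.Rotates (affPr s) := by
  have he : ∀ i x, (kr s).aff.e (i + 1) (affPr s x) = ((kr s).aff.e i x).map (affPr s) := by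
    intro i x
    simp only [Crystal.aff, affPr, Equiv.coe_fn_mk, kr_e_pr, Option.map_map]
    cases h : (kr s).e i x.2 with
    | none => rfl
    | some b =>
      have := size_of_e h
      simp only [Option.map_some, Function.comp_apply, Option.some.injEq,
        Prod.mk.injEq, and_true]
      omega
  exact ⟨he, fun i x => (kr_regular s).aff.f_map (kr_regular s).aff (affPr s) (he i) x,
    fun i x => kr_ε_pr i x.2, fun i x => kr_φ_pr i x.2⟩

namespace CombinatorialR

theorem H_pr_highest (R : CombinatorialR s t) :
    R.H (Tab.pr s (Tab.highest s), Tab.pr t (Tab.highest t)) = 0 := by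
  rw [← R.H_eMaxList (w := ascWord n n) (fun i hi => mem_ascWord le_rfl hi),
    (kr_regular s).eMaxList_tensor (kr_regular t) _ Tab.eMaxList_pr_highest.2,
    Tab.eMaxList_pr_highest.1, Tab.eMaxList_pr_highest.1, R.H_highest]

theorem H_pr_symm_highest (R : CombinatorialR s t) :
    R.H ((Tab.pr s).symm (Tab.highest s), (Tab.pr t).symm (Tab.highest t)) = 0 := by
  rw [← R.H_eMaxList (w := descWord n n) (fun i hi => mem_descWord le_rfl hi),
    (kr_regular s).eMaxList_tensor (kr_regular t) _ Tab.eMaxList_pr_symm_highest.2,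
    Tab.eMaxList_pr_symm_highest.1, Tab.eMaxList_pr_symm_highest.1, R.H_highest]

end CombinatorialR

theorem Tab.size_pr_one (T : Tab s) : (Tab.pr s T).size 1 + T.size n = s.r * s.l := by
  have h := Tab.size_pr (Nat.zero_le n) T
  rwa [Tab.size_zero, Tab.size_top _ (Nat.lt_succ_self n), zero_add, zero_add] at h

theorem Tab.size_last_ge (T : Tab s) : (s.r - 1) * s.l ≤ T.size n := by
  obtain ⟨m, hm⟩ : ∃ m, s.r = m + 1 := ⟨s.r - 1, by have := s.one_le_r; omega⟩
  rw [Tab.size, hm, Finset.sum_range_succ, Nat.add_sub_cancel]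
  refine Nat.le_add_right_of_le (le_of_eq ?_)
  rw [Finset.sum_congr rfl (g := fun _ => s.l)]
  · simp
  · intro k hk
    have := Finset.mem_range.1 hk
    exact T.count_of_top_le (by omega) (by omega)

namespace CombinatorialR

theorem size_last_add (R : CombinatorialR s t) (b : Tab s) (c : Tab t) :
    (R.σ (b, c)).1.size n + (R.σ (b, c)).2.size n = b.size n + c.size n :=
  R.size_add_size b c (Nat.le_succ n)

/-- The conjugate `pr⁻¹ R pr` of a combinatorial R, with the energy function corrected by the
numbers of letters `≠ n`. -/
def conjPrSymm (R : CombinatorialR s t) : CombinatorialR s t :=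
  let σ := (((Tab.pr s).prodCongr (Tab.pr t)).trans R.σ).trans
    ((Tab.pr t).prodCongr (Tab.pr s)).symm
  let H := fun z => R.H (Tab.pr s z.1, Tab.pr t z.2) + z.2.size n - (σ z).1.size n
  have key : ∀ x, affMap σ H x = ((affPr t).prodCongr (affPr s)).symm
      (affMap R.σ R.H ((affPr s).prodCongr (affPr t) x)) := fun x => by
    obtain ⟨⟨d, b⟩, ⟨e, c⟩⟩ := x
    have h1 := R.size_add_size (Tab.pr s b) (Tab.pr t c) (y := 1) (by omega)
    have h2 := b.size_pr_one
    have h3 := c.size_pr_one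
    have h4 := ((Tab.pr t).symm (R.σ (Tab.pr s b, Tab.pr t c)).1).size_pr_one
    have h5 := ((Tab.pr s).symm (R.σ (Tab.pr s b, Tab.pr t c)).2).size_pr_one
    rw [Equiv.apply_symm_apply] at h4 h5
    refine Prod.ext (Prod.ext ?_ rfl) (Prod.ext ?_ rfl)
    · simp [affMap, affPr, σ, H]
      ring
    · simp [affMap, affPr, σ, H]
      omega
  have h : ((kr s).aff.tensor (kr t).aff).IsHom ((kr t).aff.tensor (kr s).aff) (affMap σ H) :=
    (funext key : affMap σ H = _) ▸ R.isHom.conj_symm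
      ((affPr_rotates s).tensor (affPr_rotates t)) ((affPr_rotates t).tensor (affPr_rotates s))
  { σ := σ
    H := H
    map_e := h.e
    map_f := h.f
    map_ε := h.ε
    map_φ := h.φ
    H_highest := by
      have h1 := R.size_add_size (Tab.pr s (Tab.highest s)) (Tab.pr t (Tab.highest t))
        (y := 1) (by omega)
      have h2 := (Tab.highest s).size_pr_one
      have h3 := (Tab.highest t).size_pr_one
      have h4 := ((Tab.pr t).symm
        (R.σ (Tab.pr s (Tab.highest s), Tab.pr t (Tab.highest t))).1).size_pr_one
      have h5 := s.r_le
      have h6 := t.r_le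
      rw [Equiv.apply_symm_apply] at h4
      rw [Tab.size_highest, min_eq_right h5, mul_comm] at h2
      rw [Tab.size_highest, min_eq_right h6, mul_comm] at h3
      simp only [H, σ, H_pr_highest, Tab.size_highest, min_eq_right h6, Equiv.trans_apply,
        Equiv.prodCongr_apply, Prod.map, Equiv.prodCongr_symm]
      have h7 := mul_comm t.r t.l
      omega }

/-- The conjugate `pr R pr⁻¹` of a combinatorial R, with the energy function corrected by the
numbers of letters `≠ n`. -/
def conjPr (R : CombinatorialR s t) : CombinatorialR s t :=
  let σ := (((Tab.pr s).prodCongr (Tab.pr t)).symm.trans R.σ).trans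
    ((Tab.pr t).prodCongr (Tab.pr s))
  let H := fun z => R.H ((Tab.pr s).symm z.1, (Tab.pr t).symm z.2) -
    ((Tab.pr t).symm z.2).size n + ((Tab.pr t).symm (σ z).1).size n
  have key : ∀ x, affMap σ H x = (affPr t).prodCongr (affPr s)
      (affMap R.σ R.H (((affPr s).prodCongr (affPr t)).symm x)) := fun x => by
    obtain ⟨⟨d, b⟩, ⟨e, c⟩⟩ := x
    have h1 := R.size_last_add ((Tab.pr s).symm b) ((Tab.pr t).symm c)
    refine Prod.ext (Prod.ext ?_ rfl) (Prod.ext ?_ rfl)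
    · simp [affMap, affPr, σ, H]
      ring
    · simp [affMap, affPr, σ, H]
      omega
  have h : ((kr s).aff.tensor (kr t).aff).IsHom ((kr t).aff.tensor (kr s).aff) (affMap σ H) :=
    (funext key : affMap σ H = _) ▸ R.isHom.conj
      ((affPr_rotates s).tensor (affPr_rotates t)) ((affPr_rotates t).tensor (affPr_rotates s))
  { σ := σ
    H := H
    map_e := h.e
    map_f := h.f
    map_ε := h.ε
    map_φ := h.φ
    H_highest := by
      have h1 := R.size_last_add ((Tab.pr s).symm (Tab.highest s))
        ((Tab.pr t).symm (Tab.highest t))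
      -- The letter `n` occurs in the last row only. Both tableaux contain it as often as possible,
      -- hence so do their images.
      have h2 := (R.σ ((Tab.pr s).symm (Tab.highest s),
        (Tab.pr t).symm (Tab.highest t))).1.size_last_ge
      have h3 := (R.σ ((Tab.pr s).symm (Tab.highest s),
        (Tab.pr t).symm (Tab.highest t))).2.size_last_ge
      have h4 : ∀ s : Shape n, ((Tab.pr s).symm (Tab.highest s)).size n = (s.r - 1) * s.l := by
        intro s
        have h := ((Tab.pr s).symm (Tab.highest s)).size_pr_one
        rw [Equiv.apply_symm_apply, Tab.size_highest, min_eq_left s.one_le_r] at h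
        rw [Nat.sub_mul]
        omega
      rw [h4, h4] at h1
      simp only [H, σ, H_pr_symm_highest, h4, Equiv.trans_apply,
        Equiv.prodCongr_apply, Prod.map, Equiv.prodCongr_symm, Equiv.symm_apply_apply]
      omega }

end CombinatorialR

open CombinatorialR in
/-- Promotion commutes with the combinatorial R up to a change of degrees. -/
theorem isR_pr_iff {b c c' b' : KR n} {h : ℤ} :
    IsR ⟨b.1, Tab.pr _ b.2⟩ ⟨c.1, Tab.pr _ c.2⟩ h ⟨c'.1, Tab.pr _ c'.2⟩ ⟨b'.1, Tab.pr _ b'.2⟩ ↔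
      IsR b c (h + c.2.size n - c'.2.size n) c' b' := by
  obtain ⟨s, b⟩ := b
  obtain ⟨t, c⟩ := c
  constructor
  · rintro ⟨R, h1, h2, h3⟩
    obtain ⟨t', c'⟩ := c'
    obtain ⟨s', b'⟩ := b'
    obtain rfl : t' = t := congrArg Sigma.fst h2
    obtain rfl : s' = s := congrArg Sigma.fst h3
    have h2' := eq_of_heq (Sigma.mk.inj h2).2
    have h3' := eq_of_heq (Sigma.mk.inj h3).2
    simp only at h1 h2' h3'
    refine ⟨R.conjPrSymm, ?_, ?_, ?_⟩
    · simp [conjPrSymm, h1, ← h2']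
    · simp [conjPrSymm, ← h2']
    · simp [conjPrSymm, ← h3']
  · rintro ⟨R, h1, rfl, rfl⟩
    simp only at h1
    refine ⟨R.conjPr, ?_, ?_, ?_⟩
    · simp [conjPr]
      omega
    · simp [conjPr]
    · simp [conjPr]

end

/-! ### The Yang-Baxter equation -/

/-- A map applied to the first two of three factors. -/
def onFirstTwo {A B K B' A' : Type} (g : A × B → B' × A') (x : A × B × K) : B' × A' × K :=
  ((g (x.1, x.2.1)).1, (g (x.1, x.2.1)).2, x.2.2)

/-- A map applied to the last two of three factors. -/
def onLastTwo {A B K B' K' : Type} (g : B × K → K' × B') (x : A × B × K) : A × K' × B' :=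
  (x.1, g x.2)

namespace Crystal

variable {I A B K A' B' K' : Type} {C : Crystal I A} {D : Crystal I B} {F : Crystal I K}

theorem IsHom.onFirstTwo {C' : Crystal I A'} {D' : Crystal I B'} {g : A × B → B' × A'}
    (hg : (C.tensor D).IsHom (D'.tensor C') g) (F : Crystal I K) :
    (C.tensor (D.tensor F)).IsHom (D'.tensor (C'.tensor F)) (onFirstTwo g) :=
  ((IsHom.assoc D' C' F).comp (hg.tensor (IsHom.id F))).comp (IsHom.assoc C D F).symm

theorem IsHom.onLastTwo {D' : Crystal I B'} {F' : Crystal I K'} {g : B × K → K' × B'}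
    (hg : (D.tensor F).IsHom (F'.tensor D') g) (C : Crystal I A) :
    (C.tensor (D.tensor F)).IsHom (C.tensor (F'.tensor D')) (onLastTwo g) :=
  (IsHom.id C).tensor hg

/-- Two morphisms agree if they agree above one element of a connected crystal. -/
theorem IsHom.eq_of_conn {g h : A → B} (hC : C.Regular) (hF : F.Regular) (hg : C.IsHom D g)
    (hh : C.IsHom D h) {p : A → K} (hp : C.IsHom F p) {z z' : K} (hz : F.Conn z z') :
    (∀ x, p x = z → g x = h x) ↔ ∀ x, p x = z' → g x = h x := by
  induction hz with
  | rel z z' hz =>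
    obtain ⟨i, hz⟩ := hz
    constructor
    · rintro H x rfl
      have h1 := (hp.f i x).symm.trans ((hF.e_iff _ _ _).1 hz)
      obtain ⟨y, hy, rfl⟩ := Option.map_eq_some_iff.1 h1
      have h2 := (hC.e_iff _ _ _).2 hy
      have h3 := hg.e i y
      have h4 := hh.e i y
      rw [h2, Option.map_some] at h3 h4
      rw [H y rfl, h4, Option.some.injEq] at h3
      exact h3.symm
    · rintro H x rfl
      have h1 := (hp.e i x).symm.trans hz
      obtain ⟨y, hy, rfl⟩ := Option.map_eq_some_iff.1 h1
      have h2 := (hC.e_iff _ _ _).1 hy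
      have h3 := hg.f i y
      have h4 := hh.f i y
      rw [h2, Option.map_some] at h3 h4
      rw [H y rfl, h4, Option.some.injEq] at h3
      exact h3.symm
  | refl => rfl
  | symm _ _ _ ih => exact ih.symm
  | trans _ _ _ _ _ ih ih' => exact ih.trans ih'

end Crystal

section

variable {n : ℕ} {s t u : Shape n}

/-- Both sides of the Yang-Baxter equation are morphisms, and they agree above the tensor product
of the highest elements; so they agree everywhere since triple tensor products are connected. -/
theorem CombinatorialR.yang_baxter (R₁ R₆ : CombinatorialR s t) (R₂ R₅ : CombinatorialR s u)
    (R₃ R₄ : CombinatorialR t u) (x : (ℤ × Tab s) × (ℤ × Tab t) × (ℤ × Tab u)) :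
    onFirstTwo (affMap R₃.σ R₃.H) (onLastTwo (affMap R₂.σ R₂.H)
      (onFirstTwo (affMap R₁.σ R₁.H) x)) =
    onLastTwo (affMap R₆.σ R₆.H) (onFirstTwo (affMap R₅.σ R₅.H)
      (onLastTwo (affMap R₄.σ R₄.H) x)) := by
  have hs := kr_regular s
  have ht := kr_regular t
  have hu := kr_regular u
  have h1 := ((R₃.isHom.onFirstTwo (kr s).aff).comp (R₂.isHom.onLastTwo (kr t).aff)).comp
    (R₁.isHom.onFirstTwo (kr u).aff)
  have h2 := ((R₆.isHom.onLastTwo (kr u).aff).comp (R₅.isHom.onFirstTwo (kr t).aff)).comp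
    (R₄.isHom.onLastTwo (kr s).aff)
  have h3 := (Crystal.IsHom.aff_snd (kr s)).tensor
    ((Crystal.IsHom.aff_snd (kr t)).tensor (Crystal.IsHom.aff_snd (kr u)))
  refine (Crystal.IsHom.eq_of_conn (hs.aff.tensor (ht.aff.tensor hu.aff))
    (hs.tensor (ht.tensor hu)) h1 h2 h3 (conn_highest s t u _)).2 (fun y hy => ?_) x rfl
  obtain ⟨⟨d, a⟩, ⟨e, b⟩, ⟨f, c⟩⟩ := y
  simp only [Prod.map, Prod.mk.injEq] at hy
  obtain ⟨rfl, rfl, rfl⟩ := hy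
  simp [onFirstTwo, onLastTwo, affMap, σ_highest, H_highest]

theorem isR_yang_baxter {v b c b₁ c₁ v₁ v₂ b₂ c₂ b₃ c₃ : KR n} {h₁ h₂ h₃ h₄ : ℤ}
    (H₁ : IsR v b h₁ b₁ v₁) (H₂ : IsR v₁ c h₂ c₁ v₂) (H₃ : IsR b₁ c₁ h₃ c₂ b₂)
    (H₄ : IsR b c h₄ c₃ b₃) :
    ∃ v₃ : KR n, v₃.1 = v.1 ∧ IsR v c₃ (h₂ + h₃ - h₄) c₂ v₃ ∧
      IsR v₃ b₃ (h₁ - h₃ + h₄) b₂ v₂ := by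
  obtain ⟨s, v⟩ := v
  obtain ⟨t, b⟩ := b
  obtain ⟨u, c⟩ := c
  obtain ⟨R₁, rfl, rfl, rfl⟩ := H₁
  obtain ⟨R₂, rfl, rfl, rfl⟩ := H₂
  obtain ⟨R₃, rfl, rfl, rfl⟩ := H₃
  obtain ⟨R₄, rfl, rfl, rfl⟩ := H₄
  have h := CombinatorialR.yang_baxter R₁ R₁ R₂ R₂ R₃ R₄ ((0, v), (0, b), (0, c))
  simp only [onFirstTwo, onLastTwo, affMap, Prod.mk.injEq] at h
  obtain ⟨⟨h1, h2⟩, ⟨h3, h4⟩, h5, h6⟩ := h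
  refine ⟨⟨s, (R₂.σ (v, (R₄.σ (b, c)).1)).2⟩, rfl, ⟨R₂, ?_, ?_, rfl⟩, R₁, ?_, ?_, ?_⟩
  · simp only
    omega
  · simp only [h2]
  · simp only
    omega
  · simp only [h4]
  · simp only [h6]

theorem isR_inv {b c c' b' : KR n} {h : ℤ} (H : IsR b c h c' b') : IsR c' b' h b c := by
  obtain ⟨s, b⟩ := b
  obtain ⟨t, c⟩ := c
  obtain ⟨R, rfl, rfl, rfl⟩ := H
  exact ⟨R.inv, by simp [CombinatorialR.inv], by simp [CombinatorialR.inv],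
    by simp [CombinatorialR.inv]⟩

end

/-! ### Correspondences between crystals and Weyl group operators -/

/-- The `k`-th power of a partial map. -/
def iter {A : Type} (F : A → Option A) (k : ℕ) (a : A) : Option A :=
  (fun x => x.bind F)^[k] (some a)

section iter

variable {A B : Type} {F : A → Option A} {G : B → Option B}

theorem iter_zero (a : A) : iter F 0 a = some a := rfl

theorem iter_succ (k : ℕ) (a : A) : iter F (k + 1) a = (F a).bind (iter F k) := by
  unfold iter
  rw [Function.iterate_succ_apply, Option.bind_some]
  cases F a with
  | none =>
    rw [Option.bind_none]
    exact Function.iterate_fixed (Option.bind_none F) k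
  | some a' => rfl

theorem iter_succ_eq_some {k : ℕ} {a b : A} :
    iter F (k + 1) a = some b ↔ ∃ a', F a = some a' ∧ iter F k a' = some b := by
  rw [iter_succ, Option.bind_eq_some_iff]

theorem iter_add (k m : ℕ) (a : A) : iter F (k + m) a = (iter F k a).bind (iter F m) := by
  induction k generalizing a with
  | zero => rw [Nat.zero_add, iter_zero, Option.bind_some]
  | succ k ih =>
    rw [Nat.succ_add, iter_succ, iter_succ, Option.bind_assoc]
    congr 1
    funext a'
    exact ih a'

theorem iter_map {g : A → B} (h : ∀ a, G (g a) = (F a).map g) (k : ℕ) (a : A) :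
    iter G k (g a) = (iter F k a).map g := by
  induction k generalizing a with
  | zero => rfl
  | succ k ih =>
    rw [iter_succ, iter_succ, h]
    cases F a with
    | none => rfl
    | some a' => exact ih a'

theorem iter_rel {r : A → B → Prop}
    (h : ∀ a b a', r a b → F a = some a' → ∃ b', G b = some b' ∧ r a' b') {k : ℕ} {a : A} {b : B}
    {a' : A} (hr : r a b) (ha : iter F k a = some a') : ∃ b', iter G k b = some b' ∧ r a' b' := by
  induction k generalizing a b with
  | zero =>
    rw [iter_zero, Option.some.injEq] at ha
    exact ⟨b, rfl, ha ▸ hr⟩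
  | succ k ih =>
    obtain ⟨a₁, h1, h2⟩ := iter_succ_eq_some.1 ha
    obtain ⟨b₁, h3, h4⟩ := h a b a₁ hr h1
    obtain ⟨b', h5, h6⟩ := ih h4 h2
    exact ⟨b', iter_succ_eq_some.2 ⟨b₁, h3, h5⟩, h6⟩

end iter

namespace Crystal

variable {I A B A' B' K : Type}

/-- Correspondences which are compatible with the crystal structures. -/
structure IsSim (C : Crystal I A) (D : Crystal I B) (r : A → B → Prop) : Prop where
  ε : ∀ i a b, r a b → D.ε i b = C.ε i a
  φ : ∀ i a b, r a b → D.φ i b = C.φ i a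
  e : ∀ i a b a', r a b → C.e i a = some a' → ∃ b', D.e i b = some b' ∧ r a' b'
  f : ∀ i a b a', r a b → C.f i a = some a' → ∃ b', D.f i b = some b' ∧ r a' b'

namespace IsSim

variable {C : Crystal I A} {D : Crystal I B} {C' : Crystal I A'} {D' : Crystal I B'}
  {F : Crystal I K}

theorem eq (C : Crystal I A) : C.IsSim C Eq := by
  constructor
  · rintro i a _ rfl; rfl
  · rintro i a _ rfl; rfl
  · rintro i a _ a' rfl h; exact ⟨a', h, rfl⟩
  · rintro i a _ a' rfl h; exact ⟨a', h, rfl⟩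

theorem comp {r : A → B → Prop} {r' : B → K → Prop} (h : C.IsSim D r) (h' : D.IsSim F r') :
    C.IsSim F (Relation.Comp r r') := by
  constructor
  · rintro i a c ⟨b, h1, h2⟩
    rw [h'.ε i b c h2, h.ε i a b h1]
  · rintro i a c ⟨b, h1, h2⟩
    rw [h'.φ i b c h2, h.φ i a b h1]
  · rintro i a c a' ⟨b, h1, h2⟩ ha
    obtain ⟨b', h3, h4⟩ := h.e i a b a' h1 ha
    obtain ⟨c', h5, h6⟩ := h'.e i b c b' h2 h3
    exact ⟨c', h5, b', h4, h6⟩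
  · rintro i a c a' ⟨b, h1, h2⟩ ha
    obtain ⟨b', h3, h4⟩ := h.f i a b a' h1 ha
    obtain ⟨c', h5, h6⟩ := h'.f i b c b' h2 h3
    exact ⟨c', h5, b', h4, h6⟩

theorem tensor {r : A → B → Prop} {r' : A' → B' → Prop} (h : C.IsSim D r) (h' : C'.IsSim D' r') :
    (C.tensor C').IsSim (D.tensor D') (fun x y => r x.1 y.1 ∧ r' x.2 y.2) := by
  constructor
  · rintro i a b ⟨h1, h2⟩
    simp only [Crystal.tensor, h.ε _ _ _ h1, h'.ε _ _ _ h2, h.φ _ _ _ h1]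
  · rintro i a b ⟨h1, h2⟩
    simp only [Crystal.tensor, h.φ _ _ _ h1, h'.φ _ _ _ h2, h'.ε _ _ _ h2]
  · rintro i a b a' ⟨h1, h2⟩ ha
    simp only [Crystal.tensor, h'.ε _ _ _ h2, h.φ _ _ _ h1] at ha ⊢
    split_ifs at ha ⊢
    · obtain ⟨c, hc, rfl⟩ := Option.map_eq_some_iff.1 ha
      obtain ⟨d, hd, h3⟩ := h.e _ _ _ _ h1 hc
      exact ⟨(d, b.2), by rw [hd]; rfl, h3, h2⟩
    · obtain ⟨c, hc, rfl⟩ := Option.map_eq_some_iff.1 ha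
      obtain ⟨d, hd, h3⟩ := h'.e _ _ _ _ h2 hc
      exact ⟨(b.1, d), by rw [hd]; rfl, h1, h3⟩
  · rintro i a b a' ⟨h1, h2⟩ ha
    simp only [Crystal.tensor, h'.ε _ _ _ h2, h.φ _ _ _ h1] at ha ⊢
    split_ifs at ha ⊢
    · obtain ⟨c, hc, rfl⟩ := Option.map_eq_some_iff.1 ha
      obtain ⟨d, hd, h3⟩ := h.f _ _ _ _ h1 hc
      exact ⟨(d, b.2), by rw [hd]; rfl, h3, h2⟩
    · obtain ⟨c, hc, rfl⟩ := Option.map_eq_some_iff.1 ha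
      obtain ⟨d, hd, h3⟩ := h'.f _ _ _ _ h2 hc
      exact ⟨(b.1, d), by rw [hd]; rfl, h1, h3⟩

theorem comap {r : A → B → Prop} (h : C.IsSim D r) {g : A' → A} {g' : B' → B}
    (hg : C'.IsHom C g) (hg' : D'.IsHom D g') : C'.IsSim D' (fun x y => r (g x) (g' y)) := by
  constructor
  · intro i a b hr
    rw [← hg'.ε, ← hg.ε, h.ε _ _ _ hr]
  · intro i a b hr
    rw [← hg'.φ, ← hg.φ, h.φ _ _ _ hr]
  · intro i a b a' hr ha
    have h1 := hg.e i a
    rw [ha, Option.map_some] at h1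
    obtain ⟨b', h2, h3⟩ := h.e _ _ _ _ hr h1
    rw [hg'.e] at h2
    obtain ⟨c, hc, rfl⟩ := Option.map_eq_some_iff.1 h2
    exact ⟨c, hc, h3⟩
  · intro i a b a' hr ha
    have h1 := hg.f i a
    rw [ha, Option.map_some] at h1
    obtain ⟨b', h2, h3⟩ := h.f _ _ _ _ hr h1
    rw [hg'.f] at h2
    obtain ⟨c, hc, rfl⟩ := Option.map_eq_some_iff.1 h2
    exact ⟨c, hc, h3⟩

end IsSim

section reflect

variable {C : Crystal I A} {D : Crystal I B} {i : I}

theorem reflect_eq (C : Crystal I A) (i : I) (a : A) : C.reflect i a =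
    if C.ε i a ≤ C.φ i a then iter (C.f i) (C.φ i a - C.ε i a) a
      else iter (C.e i) (C.ε i a - C.φ i a) a := rfl

theorem Regular.of_iter_f (hC : C.Regular) {k : ℕ} {a b : A} (h : iter (C.f i) k a = some b) :
    C.φ i a = C.φ i b + k ∧ C.ε i b = C.ε i a + k ∧ iter (C.e i) k b = some a := by
  induction k generalizing a with
  | zero =>
    rw [iter_zero, Option.some.injEq] at h
    subst h
    exact ⟨rfl, rfl, rfl⟩
  | succ k ih =>
    obtain ⟨a', h1, h2⟩ := iter_succ_eq_some.1 h
    obtain ⟨h3, h4, h5⟩ := ih h2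
    have h6 := (hC.e_iff i a' a).2 h1
    have h7 := hC.ε_of_e _ _ _ h6
    have h8 := hC.φ_of_e _ _ _ h6
    refine ⟨by omega, by omega, ?_⟩
    rw [iter_add, h5, Option.bind_some]
    exact iter_succ_eq_some.2 ⟨a, h6, rfl⟩

theorem Regular.of_iter_e (hC : C.Regular) {k : ℕ} {a b : A} (h : iter (C.e i) k a = some b) :
    C.ε i a = C.ε i b + k ∧ C.φ i b = C.φ i a + k ∧ iter (C.f i) k b = some a := by
  induction k generalizing a with
  | zero =>
    rw [iter_zero, Option.some.injEq] at h
    subst h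
    exact ⟨rfl, rfl, rfl⟩
  | succ k ih =>
    obtain ⟨a', h6, h2⟩ := iter_succ_eq_some.1 h
    obtain ⟨h3, h4, h5⟩ := ih h2
    have h7 := hC.ε_of_e _ _ _ h6
    have h8 := hC.φ_of_e _ _ _ h6
    refine ⟨by omega, by omega, ?_⟩
    rw [iter_add, h5, Option.bind_some]
    exact iter_succ_eq_some.2 ⟨a, (hC.e_iff i a a').1 h6, rfl⟩

theorem Regular.exists_iter_f (hC : C.Regular) {k : ℕ} {a : A} (h : k ≤ C.φ i a) :
    ∃ b, iter (C.f i) k a = some b := by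
  induction k generalizing a with
  | zero => exact ⟨a, rfl⟩
  | succ k ih =>
    obtain ⟨a', h1⟩ := hC.exists_f i a (by omega)
    have h2 := hC.φ_of_e _ _ _ ((hC.e_iff i a' a).2 h1)
    obtain ⟨b, hb⟩ := ih (a := a') (by omega)
    exact ⟨b, iter_succ_eq_some.2 ⟨a', h1, hb⟩⟩

theorem Regular.exists_iter_e (hC : C.Regular) {k : ℕ} {a : A} (h : k ≤ C.ε i a) :
    ∃ b, iter (C.e i) k a = some b := by
  induction k generalizing a with
  | zero => exact ⟨a, rfl⟩
  | succ k ih =>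
    obtain ⟨a', h1⟩ := hC.exists_e i a (by omega)
    have h2 := hC.ε_of_e _ _ _ h1
    obtain ⟨b, hb⟩ := ih (a := a') (by omega)
    exact ⟨b, iter_succ_eq_some.2 ⟨a', h1, hb⟩⟩

theorem IsHom.reflect {g : A → B} (hg : C.IsHom D g) (i : I) (a : A) :
    D.reflect i (g a) = (C.reflect i a).map g := by
  rw [reflect_eq, reflect_eq, hg.ε, hg.φ]
  split_ifs
  · exact iter_map (hg.f i) _ _
  · exact iter_map (hg.e i) _ _

/-- The Weyl group operators are involutions. -/
theorem Regular.reflect_symm (hC : C.Regular) {a b : A} (h : C.reflect i a = some b) :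
    C.reflect i b = some a := by
  rw [reflect_eq] at h
  split_ifs at h with h1
  · obtain ⟨h2, h3, h4⟩ := hC.of_iter_f h
    rw [reflect_eq]
    split_ifs with h5
    · have h6 : C.φ i a - C.ε i a = 0 := by omega
      rw [h6] at h4
      rw [show C.φ i b - C.ε i b = 0 by omega]
      exact h4
    · rw [show C.ε i b - C.φ i b = C.φ i a - C.ε i a by omega]
      exact h4
  · obtain ⟨h2, h3, h4⟩ := hC.of_iter_e h
    rw [reflect_eq, if_pos (by omega), show C.φ i b - C.ε i b = C.ε i a - C.φ i a by omega]
    exact h4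

theorem Regular.exists_reflect (hC : C.Regular) (i : I) (a : A) : ∃ b, C.reflect i a = some b := by
  rw [reflect_eq]
  split_ifs
  · exact hC.exists_iter_f (by omega)
  · exact hC.exists_iter_e (by omega)

theorem Regular.iter_tensor_f (hC : C.Regular) {a a' : A} {b b' : B} {k m : ℕ}
    (ha : iter (C.f i) k a = some a') (hb : iter (D.f i) m b = some b')
    (hk : k ≤ C.φ i a - D.ε i b) (hm : m = 0 ∨ C.φ i a ≤ D.ε i b + k) (hD : D.Regular) :
    iter ((C.tensor D).f i) (k + m) (a, b) = some (a', b') := by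
  induction k generalizing a with
  | zero =>
    rw [iter_zero, Option.some.injEq] at ha
    subst ha
    rw [Nat.zero_add]
    induction m generalizing b with
    | zero =>
      rw [iter_zero, Option.some.injEq] at hb
      rw [hb, iter_zero]
    | succ m ih =>
      obtain ⟨b₁, h1, h2⟩ := iter_succ_eq_some.1 hb
      have h3 := hD.ε_of_e _ _ _ ((hD.e_iff _ _ _).2 h1)
      refine iter_succ_eq_some.2 ⟨(a, b₁), ?_, ih h2 (by omega) (by omega)⟩
      simp only [Crystal.tensor, h1, Option.map_some, if_neg (show ¬ D.ε i b < C.φ i a by omega)]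
  | succ k ih =>
    obtain ⟨a₁, h1, h2⟩ := iter_succ_eq_some.1 ha
    have h3 := hC.φ_of_e _ _ _ ((hC.e_iff _ _ _).2 h1)
    rw [show k + 1 + m = k + m + 1 by omega]
    refine iter_succ_eq_some.2 ⟨(a₁, b), ?_, ih h2 (by omega) (by omega)⟩
    simp only [Crystal.tensor, h1, Option.map_some, if_pos (show D.ε i b < C.φ i a by omega)]

theorem Regular.iter_tensor_e (hC : C.Regular) {a a' : A} {b b' : B} {k m : ℕ}
    (ha : iter (C.e i) k a = some a') (hb : iter (D.e i) m b = some b')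
    (hm : m ≤ D.ε i b - C.φ i a) (hk : k = 0 ∨ D.ε i b ≤ C.φ i a + m) (hD : D.Regular) :
    iter ((C.tensor D).e i) (m + k) (a, b) = some (a', b') := by
  induction m generalizing b with
  | zero =>
    rw [iter_zero, Option.some.injEq] at hb
    subst hb
    rw [Nat.zero_add]
    induction k generalizing a with
    | zero =>
      rw [iter_zero, Option.some.injEq] at ha
      rw [ha, iter_zero]
    | succ k ih =>
      obtain ⟨a₁, h1, h2⟩ := iter_succ_eq_some.1 ha
      have h3 := hC.φ_of_e _ _ _ h1
      refine iter_succ_eq_some.2 ⟨(a₁, b), ?_, ih h2 (by omega) (by omega)⟩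
      simp only [Crystal.tensor, h1, Option.map_some, if_pos (show D.ε i b ≤ C.φ i a by omega)]
  | succ m ih =>
    obtain ⟨b₁, h1, h2⟩ := iter_succ_eq_some.1 hb
    have h3 := hD.ε_of_e _ _ _ h1
    rw [show m + 1 + k = m + k + 1 by omega]
    refine iter_succ_eq_some.2 ⟨(a, b₁), ?_, ih h2 (by omega) (by omega)⟩
    simp only [Crystal.tensor, h1, Option.map_some, if_neg (show ¬ D.ε i b ≤ C.φ i a by omega)]

/-- If `v ⊗ w` corresponds to `w' ⊗ v'`, where `v` and `v'` have the same position in their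
`i`-strings, then `w` and `w'` can be replaced by `S_i w` and `S_i w'`: a suitable power of `f_i`
or of `e_i` acts as the reflection on `w` and on `w'`, and by the same power on `v` and on `v'`. -/
theorem IsSim.reflect (hC : C.Regular) (hD : D.Regular) {r : A × B → B × A → Prop}
    (hr : (C.tensor D).IsSim (D.tensor C) r) {v v' : A} {w w' : B} (h : r (v, w) (w', v'))
    (hε : C.ε i v' = C.ε i v) (hφ : C.φ i v' = C.φ i v) :
    ∃ k u u' x x', (iter (C.f i) k v = some u ∧ iter (C.f i) k v' = some u' ∨
      iter (C.e i) k v = some u ∧ iter (C.e i) k v' = some u') ∧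
      D.reflect i w = some x ∧ D.reflect i w' = some x' ∧ r (u, x) (x', u') := by
  have h1 := hr.ε i _ _ h
  have h2 := hr.φ i _ _ h
  simp only [Crystal.tensor, hε, hφ] at h1 h2
  rcases le_or_gt (D.ε i w) (D.φ i w) with hm | hm
  · obtain ⟨u, hu⟩ := hC.exists_iter_f (i := i) (a := v) (k := C.φ i v - D.ε i w) (by omega)
    obtain ⟨u', hu'⟩ := hC.exists_iter_f (i := i) (a := v') (k := C.φ i v - D.ε i w) (by omega)
    obtain ⟨x, hx⟩ := hD.exists_iter_f (i := i) (a := w) (k := D.φ i w - D.ε i w) (by omega)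
    obtain ⟨x', hx'⟩ := hD.exists_iter_f (i := i) (a := w') (k := D.φ i w - D.ε i w) (by omega)
    have e1 := hC.iter_tensor_f hu hx le_rfl (by omega) hD
    have e2 := hD.iter_tensor_f hx' hu' (by omega) (by omega) hC
    obtain ⟨y, hy, hxy⟩ := iter_rel (hr.f i) h e1
    rw [add_comm, e2, Option.some.injEq] at hy
    subst hy
    refine ⟨_, u, u', x, x', Or.inl ⟨hu, hu'⟩, ?_, ?_, hxy⟩
    · rw [reflect_eq, if_pos hm, hx]
    · rw [reflect_eq, if_pos (by omega), show D.φ i w' - D.ε i w' = D.φ i w - D.ε i w by omega, hx']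
  · obtain ⟨u, hu⟩ := hC.exists_iter_e (i := i) (a := v) (k := C.ε i v - D.φ i w') (by omega)
    obtain ⟨u', hu'⟩ := hC.exists_iter_e (i := i) (a := v') (k := C.ε i v - D.φ i w') (by omega)
    obtain ⟨x, hx⟩ := hD.exists_iter_e (i := i) (a := w) (k := D.ε i w - D.φ i w) (by omega)
    obtain ⟨x', hx'⟩ := hD.exists_iter_e (i := i) (a := w') (k := D.ε i w - D.φ i w) (by omega)
    have e1 := hC.iter_tensor_e hu hx (by omega) (by omega) hD
    have e2 := hD.iter_tensor_e hx' hu' (by omega) (by omega) hC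
    obtain ⟨y, hy, hxy⟩ := iter_rel (hr.e i) h e1
    rw [add_comm, e2, Option.some.injEq] at hy
    subst hy
    refine ⟨_, u, u', x, x', Or.inr ⟨hu, hu'⟩, ?_, ?_, hxy⟩
    · rw [reflect_eq, if_neg (by omega), hx]
    · rw [reflect_eq, if_neg (by omega), show D.ε i w' - D.φ i w' = D.ε i w - D.φ i w by omega, hx']

end reflect

/-- The crystal of words of length `L`. -/
noncomputable def vec (C : Crystal I B) (L : ℕ) : Crystal I (Fin L → B) :=
  C.words.pullback List.ofFn

theorem length_of_listE {C : Crystal I B} {i : I} {w w' : List B} (h : C.listE i w = some w') :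
    w'.length = w.length := by
  induction w generalizing w' with
  | nil => simp [listE] at h
  | cons b w ih =>
    rw [listE] at h
    split_ifs at h
    · obtain ⟨b', -, rfl⟩ := Option.map_eq_some_iff.1 h
      rfl
    · obtain ⟨w₁, h1, rfl⟩ := Option.map_eq_some_iff.1 h
      simp [ih h1]

theorem exists_ofFn {L : ℕ} {w : List B} (h : w.length = L) :
    w ∈ Set.range (List.ofFn (n := L)) := by
  subst h
  exact ⟨w.get, List.ofFn_get w⟩

theorem Regular.vec {C : Crystal I B} (hC : C.Regular) (L : ℕ) : (C.vec L).Regular := by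
  refine hC.words.pullback List.ofFn_injective (fun i a b h => ?_) (fun i a b h => ?_)
  · exact exists_ofFn ((length_of_listE h).trans (by simp))
  · have h1 : C.listE i b = some (List.ofFn a) := (hC.words.e_iff _ _ _).2 h
    exact exists_ofFn ((length_of_listE h1).symm.trans (by simp))

theorem vec_cons (C : Crystal I B) (L : ℕ) :
    (C.tensor (C.vec L)).IsHom (C.vec (L + 1)) (Fin.consEquiv fun _ => B) := by
  have hl : ∀ (b : B) (w : Fin L → B),
      List.ofFn (Fin.cons b w : Fin (L + 1) → B) = b :: List.ofFn w := fun b w => by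
    simp [List.ofFn_succ]
  have hp : ∀ p : Fin (L + 1) → B, ∃ b w, p = Fin.cons b w := fun p =>
    ⟨p 0, Fin.tail p, (Fin.cons_self_tail p).symm⟩
  constructor
  · rintro i ⟨b, w⟩
    apply Option.ext
    intro p
    obtain ⟨b', w', rfl⟩ := hp p
    change pull List.ofFn (C.listE i) (Fin.cons b w) = _ ↔ _
    rw [pull_eq_some List.ofFn_injective, hl, hl, listE]
    by_cases h : C.listEps i (List.ofFn w) ≤ C.φ i b
    · have h1 : (C.tensor (C.vec L)).e i (b, w) = (C.e i b).map fun a => (a, w) := if_pos h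
      rw [if_pos h, h1, map_cons_left, List.ofFn_injective.eq_iff]
      cases C.e i b <;> simp [Fin.consEquiv, Fin.cons_inj]
    · have h1 : (C.tensor (C.vec L)).e i (b, w) = ((C.vec L).e i w).map fun a => (b, a) := if_neg h
      have h2 : (C.vec L).e i w = some w' ↔ C.listE i (List.ofFn w) = some (List.ofFn w') :=
        pull_eq_some List.ofFn_injective
      rw [if_neg h, h1, map_cons_right, ← h2]
      cases (C.vec L).e i w <;> simp [Fin.consEquiv, Fin.cons_inj, and_comm]
  · rintro i ⟨b, w⟩
    apply Option.ext
    intro p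
    obtain ⟨b', w', rfl⟩ := hp p
    change pull List.ofFn (C.listF i) (Fin.cons b w) = _ ↔ _
    rw [pull_eq_some List.ofFn_injective, hl, hl, listF]
    by_cases h : C.listEps i (List.ofFn w) < C.φ i b
    · have h1 : (C.tensor (C.vec L)).f i (b, w) = (C.f i b).map fun a => (a, w) := if_pos h
      rw [if_pos h, h1, map_cons_left, List.ofFn_injective.eq_iff]
      cases C.f i b <;> simp [Fin.consEquiv, Fin.cons_inj]
    · have h1 : (C.tensor (C.vec L)).f i (b, w) = ((C.vec L).f i w).map fun a => (b, a) := if_neg h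
      have h2 : (C.vec L).f i w = some w' ↔ C.listF i (List.ofFn w) = some (List.ofFn w') :=
        pull_eq_some List.ofFn_injective
      rw [if_neg h, h1, map_cons_right, ← h2]
      cases (C.vec L).f i w <;> simp [Fin.consEquiv, Fin.cons_inj, and_comm]
  · rintro i ⟨b, w⟩
    change C.listEps i (List.ofFn (Fin.cons b w)) = _
    rw [hl]
    rfl
  · rintro i ⟨b, w⟩
    change C.listPhi i (List.ofFn (Fin.cons b w)) = _
    rw [hl]
    rfl

end Crystal

/-! ### Time evolutions and Weyl group operators -/

theorem iter_deg {A : Type} {F : A → Option A} (d : A → ℤ) (c : ℤ)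
    (h : ∀ a a', F a = some a' → d a' = d a + c) {k : ℕ} {a b : A} (hk : iter F k a = some b) :
    d b = d a + k * c := by
  induction k generalizing a with
  | zero =>
    rw [iter_zero, Option.some.injEq] at hk
    simp [hk]
  | succ k ih =>
    obtain ⟨a', h1, h2⟩ := iter_succ_eq_some.1 hk
    rw [ih h2, h a a' h1]
    push_cast
    ring

namespace Crystal

theorem IsHom.aff {m : ℕ} {A B : Type} {C : Crystal (Fin (m + 1)) A} {D : Crystal (Fin (m + 1)) B}
    {g : A → B} (hg : C.IsHom D g) : C.aff.IsHom D.aff (Prod.map _root_.id g) where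
  e i a := by simp [Crystal.aff, hg.e, Option.map_map, Function.comp_def]
  f i a := by simp [Crystal.aff, hg.f, Option.map_map, Function.comp_def]
  ε i a := hg.ε i a.2
  φ i a := hg.φ i a.2

theorem vec_zero {I B : Type} (D : Crystal I B) (w : Fin 0 → B) (i : I) :
    (D.vec 0).e i w = none ∧ (D.vec 0).f i w = none := by
  constructor <;>
  · apply Option.ext
    intro w'
    refine (pull_eq_some List.ofFn_injective).trans ?_
    simp [Crystal.words, listE, listF]

theorem Regular.fst_vec_zero {I B : Type} {C : Crystal I B} (hC : C.Regular) :
    (C.tensor (C.vec 0)).IsHom C Prod.fst where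
  e i x := by
    have h : (C.tensor (C.vec 0)).e i x = (C.e i x.1).map fun a => (a, x.2) :=
      (by simp only [Crystal.tensor]; exact if_pos (Nat.zero_le _))
    rw [h, Option.map_map]
    simp [Function.comp_def]
  f i x := by
    by_cases h0 : C.φ i x.1 = 0
    · have h : (C.tensor (C.vec 0)).f i x = ((C.vec 0).f i x.2).map fun b => (x.1, b) :=
        if_neg (by rw [h0]; exact Nat.not_lt_zero _)
      rw [h, (vec_zero C x.2 i).2, hC.f_none.2 h0]
      rfl
    · have h : (C.tensor (C.vec 0)).f i x = (C.f i x.1).map fun a => (a, x.2) :=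
        if_pos (Nat.pos_of_ne_zero h0)
      rw [h, Option.map_map]
      simp [Function.comp_def]
  ε i x := by
    change C.ε i x.1 = C.ε i x.1 + (0 - C.φ i x.1)
    omega
  φ i x := by
    change C.φ i x.1 = 0 + (C.φ i x.1 - 0)
    omega

theorem Regular.snd_vec_zero {I B : Type} {C : Crystal I B} (hC : C.Regular) :
    ((C.vec 0).tensor C).IsHom C Prod.snd where
  e i x := by
    by_cases h0 : C.ε i x.2 = 0
    · have h : ((C.vec 0).tensor C).e i x = ((C.vec 0).e i x.1).map fun a => (a, x.2) :=
        if_pos (by rw [h0]; exact Nat.zero_le _)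
      rw [h, (vec_zero C x.1 i).1, hC.e_none.2 h0]
      rfl
    · have h : ((C.vec 0).tensor C).e i x = (C.e i x.2).map fun b => (x.1, b) :=
        if_neg (by change ¬ C.ε i x.2 ≤ 0; omega)
      rw [h, Option.map_map]
      simp [Function.comp_def]
  f i x := by
    have h : ((C.vec 0).tensor C).f i x = (C.f i x.2).map fun b => (x.1, b) :=
      (by simp only [Crystal.tensor]; exact if_neg (Nat.not_lt_zero _))
    rw [h, Option.map_map]
    simp [Function.comp_def]
  ε i x := by
    change C.ε i x.2 = 0 + (C.ε i x.2 - 0)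
    omega
  φ i x := by
    change C.φ i x.2 = C.φ i x.2 + (0 - C.ε i x.2)
    omega

theorem IsHom.vec {I A B : Type} {C : Crystal I A} {D : Crystal I B} {g : A → B}
    (hg : C.IsHom D g) (L : ℕ) : (C.vec L).IsHom (D.vec L) (fun w i => g (w i)) := by
  induction L with
  | zero =>
    refine ⟨fun i a => ?_, fun i a => ?_, fun i a => rfl, fun i a => rfl⟩
    · rw [(vec_zero C a i).1, (vec_zero D _ i).1, Option.map_none]
    · rw [(vec_zero C a i).2, (vec_zero D _ i).2, Option.map_none]
  | succ L ih =>
    have h := ((vec_cons D L).comp (hg.tensor ih)).comp (vec_cons C L).symm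
    convert h using 1
    funext w i
    refine Fin.cases ?_ (fun i => ?_) i <;> simp [Fin.consEquiv, Fin.tail]

theorem deg_of_listE {m : ℕ} {B : Type} {C : Crystal (Fin (m + 1)) B} {i : Fin (m + 1)}
    {w w' : List (ℤ × B)} (h : C.aff.listE i w = some w') :
    (w'.map Prod.fst).sum = (w.map Prod.fst).sum + if i = 0 then 1 else 0 := by
  induction w generalizing w' with
  | nil => simp [listE] at h
  | cons b w ih =>
    rw [listE] at h
    split_ifs at h
    · obtain ⟨b', hb, rfl⟩ := Option.map_eq_some_iff.1 h
      simp only [Crystal.aff, Option.map_eq_some_iff] at hb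
      obtain ⟨c, -, rfl⟩ := hb
      simp only [List.map_cons, List.sum_cons]
      ring
    · obtain ⟨w₁, h1, rfl⟩ := Option.map_eq_some_iff.1 h
      simp only [List.map_cons, List.sum_cons, ih h1]
      ring

/-- The reflections change the total degree according to the weight. -/
theorem Regular.deg_reflect {m L : ℕ} {B : Type} {C : Crystal (Fin (m + 1)) B} (hC : C.Regular)
    {i : Fin (m + 1)} {w w' : Fin L → ℤ × B} (h : (C.aff.vec L).reflect i w = some w') :
    ∑ j, (w' j).1 = ∑ j, (w j).1 -
      (if i = 0 then 1 else 0) * (((C.aff.vec L).φ i w : ℤ) - (C.aff.vec L).ε i w) := by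
  have he : ∀ w w' : Fin L → ℤ × B, (C.aff.vec L).e i w = some w' →
      ∑ j, (w' j).1 = ∑ j, (w j).1 + if i = 0 then 1 else 0 := by
    intro w w' h
    have h1 := deg_of_listE ((pull_eq_some List.ofFn_injective).1 h)
    simpa [List.map_ofFn, List.sum_ofFn] using h1
  have hf : ∀ w w' : Fin L → ℤ × B, (C.aff.vec L).f i w = some w' →
      ∑ j, (w' j).1 = ∑ j, (w j).1 + -(if i = 0 then 1 else 0) := by
    intro w w' h
    have := he _ _ (((hC.aff.vec L).e_iff i w' w).2 h)
    omega
  rw [reflect_eq] at h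
  split_ifs at h with h1
  · rw [iter_deg (fun w => ∑ j, (w j).1) _ hf h, Nat.cast_sub h1]
    ring
  · rw [iter_deg (fun w => ∑ j, (w j).1) _ he h, Nat.cast_sub (by omega)]
    ring

end Crystal

section

variable {n L : ℕ}

theorem krAll_mk (s : Shape n) : (kr s).IsHom (krAll n) (Sigma.mk s) :=
  ⟨fun _ _ => rfl, fun _ _ => rfl, fun _ _ => rfl, fun _ _ => rfl⟩

theorem krAll_e {i : Fin (n + 1)} {b b' : KR n} :
    (krAll n).e i b = some b' ↔ ∃ (s : Shape n) (T T' : Tab s),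
      (kr s).e i T = some T' ∧ b = ⟨s, T⟩ ∧ b' = ⟨s, T'⟩ := by
  constructor
  · intro h
    obtain ⟨T', h1, h2⟩ := Option.map_eq_some_iff.1 h
    exact ⟨_, _, T', h1, rfl, h2.symm⟩
  · rintro ⟨s, T, T', h, rfl, rfl⟩
    rw [(krAll_mk s).e, h, Option.map_some]

theorem krAll_f {i : Fin (n + 1)} {b b' : KR n} :
    (krAll n).f i b = some b' ↔ ∃ (s : Shape n) (T T' : Tab s),
      (kr s).f i T = some T' ∧ b = ⟨s, T⟩ ∧ b' = ⟨s, T'⟩ := by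
  constructor
  · intro h
    obtain ⟨T', h1, h2⟩ := Option.map_eq_some_iff.1 h
    exact ⟨_, _, T', h1, rfl, h2.symm⟩
  · rintro ⟨s, T, T', h, rfl, rfl⟩
    rw [(krAll_mk s).f, h, Option.map_some]

theorem krAll_regular (n : ℕ) : (krAll n).Regular where
  e_iff i b b' := by
    rw [krAll_e, krAll_f]
    constructor
    · rintro ⟨s, T, T', h, rfl, rfl⟩
      exact ⟨s, T', T, ((kr_regular s).e_iff _ _ _).1 h, rfl, rfl⟩
    · rintro ⟨s, T, T', h, rfl, rfl⟩
      exact ⟨s, T', T, ((kr_regular s).e_iff _ _ _).2 h, rfl, rfl⟩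
  ε_of_e i b b' h := by
    obtain ⟨s, T, T', h', rfl, rfl⟩ := krAll_e.1 h
    exact (kr_regular s).ε_of_e _ _ _ h'
  φ_of_e i b b' h := by
    obtain ⟨s, T, T', h', rfl, rfl⟩ := krAll_e.1 h
    exact (kr_regular s).φ_of_e _ _ _ h'
  exists_e i b h := by
    obtain ⟨T', h⟩ := (kr_regular b.1).exists_e i b.2 h
    exact ⟨_, krAll_e.2 ⟨_, _, T', h, rfl, rfl⟩⟩
  exists_f i b h := by
    obtain ⟨T', h⟩ := (kr_regular b.1).exists_f i b.2 h
    exact ⟨_, krAll_f.2 ⟨_, _, T', h, rfl, rfl⟩⟩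

/-- `y` is the image of `x` under a combinatorial R of the affinizations. -/
def AffR (x y : (ℤ × KR n) × (ℤ × KR n)) : Prop :=
  ∃ h, IsR x.1.2 x.2.2 h y.1.2 y.2.2 ∧ y.1.1 = x.2.1 + h ∧ y.2.1 = x.1.1 - h

/-- The map which forgets that all factors have fixed shapes. -/
def forgetShapes (s t : Shape n) :
    (ℤ × Tab s) × (ℤ × Tab t) → (ℤ × KR n) × (ℤ × KR n) :=
  Prod.map (Prod.map id (Sigma.mk s)) (Prod.map id (Sigma.mk t))

theorem forgetShapes_isHom (s t : Shape n) : ((kr s).aff.tensor (kr t).aff).IsHom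
    ((krAll n).aff.tensor (krAll n).aff) (forgetShapes s t) :=
  (krAll_mk s).aff.tensor (krAll_mk t).aff

theorem affR_iff {x y : (ℤ × KR n) × (ℤ × KR n)} : AffR x y ↔
    ∃ (s t : Shape n) (R : CombinatorialR s t) (z : (ℤ × Tab s) × (ℤ × Tab t)),
      x = forgetShapes s t z ∧ y = forgetShapes t s (affMap R.σ R.H z) := by
  constructor
  · rintro ⟨h, ⟨R, h1, h2, h3⟩, h4, h5⟩
    refine ⟨_, _, R, ((x.1.1, x.1.2.2), (x.2.1, x.2.2.2)), rfl, ?_⟩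
    refine Prod.ext (Prod.ext ?_ h2) (Prod.ext ?_ h3)
    · rw [h4, h1]; rfl
    · rw [h5, h1]; rfl
  · rintro ⟨s, t, R, z, rfl, rfl⟩
    exact ⟨_, ⟨R, rfl, rfl, rfl⟩, rfl, rfl⟩

theorem affR_isSim (n : ℕ) :
    ((krAll n).aff.tensor (krAll n).aff).IsSim ((krAll n).aff.tensor (krAll n).aff) AffR := by
  constructor
  · intro i x y h
    obtain ⟨s, t, R, z, rfl, rfl⟩ := affR_iff.1 h
    rw [(forgetShapes_isHom _ _).ε, (forgetShapes_isHom _ _).ε, R.map_ε]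
  · intro i x y h
    obtain ⟨s, t, R, z, rfl, rfl⟩ := affR_iff.1 h
    rw [(forgetShapes_isHom _ _).φ, (forgetShapes_isHom _ _).φ, R.map_φ]
  · intro i x y x' h hx
    obtain ⟨s, t, R, z, rfl, rfl⟩ := affR_iff.1 h
    rw [(forgetShapes_isHom _ _).e] at hx ⊢
    obtain ⟨z', hz, rfl⟩ := Option.map_eq_some_iff.1 hx
    rw [R.map_e, hz]
    exact ⟨_, rfl, affR_iff.2 ⟨s, t, R, z', rfl, rfl⟩⟩
  · intro i x y x' h hx
    obtain ⟨s, t, R, z, rfl, rfl⟩ := affR_iff.1 h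
    rw [(forgetShapes_isHom _ _).f] at hx ⊢
    obtain ⟨z', hz, rfl⟩ := Option.map_eq_some_iff.1 hx
    rw [R.map_f, hz]
    exact ⟨_, rfl, affR_iff.2 ⟨s, t, R, z', rfl, rfl⟩⟩

/-- `w' ⊗ v'` is obtained from `v ⊗ w` by successive application of combinatorial R. -/
def ChainR (L : ℕ) (x : (ℤ × KR n) × (Fin L → ℤ × KR n)) (y : (Fin L → ℤ × KR n) × (ℤ × KR n)) :
    Prop :=
  ∃ u : Fin (L + 1) → ℤ × KR n, u 0 = x.1 ∧ u (Fin.last L) = y.2 ∧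
    ∀ i : Fin L, AffR (u i.castSucc, x.2 i) (y.1 i, u i.succ)

theorem chainR_succ {x : (ℤ × KR n) × (Fin (L + 1) → ℤ × KR n)}
    {y : (Fin (L + 1) → ℤ × KR n) × (ℤ × KR n)} : ChainR (L + 1) x y ↔
    ∃ v, AffR (x.1, x.2 0) (y.1 0, v) ∧ ChainR L (v, Fin.tail x.2) (Fin.tail y.1, y.2) := by
  constructor
  · rintro ⟨u, h1, h2, h3⟩
    refine ⟨u 1, ?_, Fin.tail u, rfl, ?_, fun i => ?_⟩
    · have := h3 0
      rwa [Fin.castSucc_zero, h1] at this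
    · rw [← h2]; rfl
    · exact h3 i.succ
  · rintro ⟨v, h1, u, h2, h3, h4⟩
    refine ⟨Fin.cons x.1 u, rfl, ?_, fun i => ?_⟩
    · rw [← h3]; rfl
    · refine Fin.cases ?_ (fun i => ?_) i
      · simp only [Fin.castSucc_zero, Fin.cons_zero, Fin.cons_succ]
        rw [h2]; exact h1
      · rw [← Fin.succ_castSucc, Fin.cons_succ, Fin.cons_succ]
        exact h4 i

theorem chainR_isSim (n L : ℕ) : ((krAll n).aff.tensor ((krAll n).aff.vec L)).IsSim
    (((krAll n).aff.vec L).tensor (krAll n).aff) (ChainR L) := by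
  induction L with
  | zero =>
    have hC := (krAll_regular n).aff
    convert (Crystal.IsSim.eq (krAll n).aff).comap hC.fst_vec_zero hC.snd_vec_zero using 1
    funext x y
    apply propext
    constructor
    · rintro ⟨u, h1, h2, -⟩
      rw [← h1, ← h2]; rfl
    · intro h
      exact ⟨fun _ => x.1, rfl, h, fun i => i.elim0⟩
  | succ L ih =>
    have h1 := (Crystal.IsHom.assoc (krAll n).aff (krAll n).aff ((krAll n).aff.vec L)).symm.comp
      ((Crystal.IsHom.id (krAll n).aff).tensor (Crystal.vec_cons (krAll n).aff L).symm)
    have h2 := (Crystal.IsHom.assoc (krAll n).aff ((krAll n).aff.vec L) (krAll n).aff).comp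
      ((Crystal.vec_cons (krAll n).aff L).symm.tensor (Crystal.IsHom.id (krAll n).aff))
    have h3 := ((affR_isSim n).tensor (Crystal.IsSim.eq ((krAll n).aff.vec L))).comp
      (((Crystal.IsSim.eq (krAll n).aff).tensor ih).comap
        (Crystal.IsHom.assoc (krAll n).aff (krAll n).aff ((krAll n).aff.vec L))
        (Crystal.IsHom.id _))
    have h4 := h3.comap h1 h2
    convert h4 using 1
    funext x y
    apply propext
    rw [chainR_succ]
    constructor
    · rintro ⟨v, h5, h6⟩
      exact ⟨((y.1 0, v), Fin.tail x.2), ⟨h5, rfl⟩, rfl, h6⟩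
    · rintro ⟨⟨⟨b, v⟩, w⟩, ⟨h5, h6⟩, h7, h8⟩
      change Fin.tail x.2 = w at h6
      change b = y.1 0 at h7
      subst h6 h7
      exact ⟨v, h5, h8⟩

theorem chainR_of_evolves {s : Shape n} {p : State n L} {q : Fin L → ℤ × KR n}
    (h : Evolves s p q) : ∃ (T : Tab s) (d : ℤ),
      ChainR L ((0, ⟨s, T⟩), fun i => (0, p i)) (q, (d, ⟨s, T⟩)) := by
  obtain ⟨v, h1, h2⟩ := h
  refine ⟨v 0, -Fin.partialSum (fun i => (q i).1) (Fin.last L),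
    fun i => (-Fin.partialSum (fun i => (q i).1) i, ⟨s, v i⟩), by simp, by simp [h1], fun i => ?_⟩
  refine ⟨(q i).1, h2 i, by simp, ?_⟩
  simp only [Fin.partialSum_succ]
  ring

theorem isR_shape {b c c' b' : KR n} {h : ℤ} (H : IsR b c h c' b') : b'.1 = b.1 := by
  obtain ⟨R, -, -, rfl⟩ := H
  rfl

theorem evolves_of_chainR {s : Shape n} {v v' : ℤ × KR n} {w w' : Fin L → ℤ × KR n}
    (h : ChainR L (v, w) (w', v')) (hs : v.2.1 = s) (hv : v'.2 = v.2) :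
    Evolves s (fun i => (w i).2) (fun i => ((w' i).1 - (w i).1, (w' i).2)) := by
  obtain ⟨u, rfl, rfl, h3⟩ := h
  have h4 : ∀ i, (u i).2.1 = s := by
    intro i
    induction i using Fin.induction with
    | zero => exact hs
    | succ i ih =>
      obtain ⟨_, h, -⟩ := h3 i
      exact (isR_shape h).trans ih
  have h5 : ∀ i, ∃ T : Tab s, (u i).2 = ⟨s, T⟩ := by
    intro i
    have := h4 i
    subst this
    exact ⟨(u i).2.2, rfl⟩
  choose T hT using h5
  refine ⟨T, ?_, fun i => ?_⟩
  · have h6 := hv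
    simp only [hT, Sigma.mk.injEq, heq_eq_eq, true_and] at h6
    exact h6.symm
  · obtain ⟨h, h7, h8, h9⟩ := h3 i
    simp only [hT] at h7 h8
    have h10 : (w' i).1 - (w i).1 = h := by rw [h8]; ring
    simp only [h10]
    exact h7

/-- Reflections of states can be lifted to the affinizations. -/
theorem exists_reflect_aff {i : Fin (n + 1)} {p p' : State n L}
    (h : (states n L).reflect i p = some p') : ∃ w : Fin L → ℤ × KR n,
      ((krAll n).aff.vec L).reflect i (fun j => (0, p j)) = some w ∧ ∀ j, (w j).2 = p' j := by
  obtain ⟨w, hw⟩ := ((krAll_regular n).aff.vec L).exists_reflect i fun j => ((0 : ℤ), p j)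
  have h1 := ((Crystal.IsHom.aff_snd (krAll n)).vec L).reflect i fun j => ((0 : ℤ), p j)
  rw [hw, Option.map_some] at h1
  have h2 : some p' = _ := h.symm.trans h1
  rw [Option.some.injEq] at h2
  exact ⟨w, hw, fun j => (congrFun h2 j).symm⟩

/-- Time evolutions commute with the reflections. -/
theorem evolves_reflect {s : Shape n} {i : Fin (n + 1)} {p p' : State n L}
    {w q : Fin L → ℤ × KR n} (hw : ((krAll n).aff.vec L).reflect i (fun j => (0, p j)) = some w)
    (hp : ∀ j, (w j).2 = p' j) (h : Evolves s p q) : ∃ q' : Fin L → ℤ × KR n,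
      ((krAll n).aff.vec L).reflect i q = some q' ∧
      Evolves s p' (fun j => ((q' j).1 - (w j).1, (q' j).2)) ∧
      ∑ j, ((q' j).1 - (w j).1) = ∑ j, (q j).1 := by
  have hC := (krAll_regular n).aff
  have hV := hC.vec L
  obtain ⟨T, d, hT⟩ := chainR_of_evolves h
  obtain ⟨k, u, u', x, x', h1, h2, h3, h4⟩ :=
    (chainR_isSim n L).reflect (i := i) hC hV hT rfl rfl
  rw [hw, Option.some.injEq] at h2
  subst h2
  refine ⟨x', h3, ?_, ?_⟩
  · -- The carrier keeps its shape, and both powers act on its underlying tableau in the same way.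
    have key : ∀ F : ℤ × KR n → Option (ℤ × KR n), ∀ G : KR n → Option (KR n),
        (∀ a, G a.2 = (F a).map Prod.snd) → (∀ a a', G a = some a' → a'.1 = a.1) →
        iter F k ((0 : ℤ), (⟨s, T⟩ : KR n)) = some u → iter F k (d, (⟨s, T⟩ : KR n)) = some u' →
        u.2.1 = s ∧ u'.2 = u.2 := by
      intro F G hFG hG e1 e2
      have e3 := iter_map hFG k ((0 : ℤ), (⟨s, T⟩ : KR n))
      have e4 := iter_map hFG k (d, (⟨s, T⟩ : KR n))
      rw [e1, Option.map_some] at e3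
      rw [e2, Option.map_some, e3, Option.some.injEq] at e4
      obtain ⟨b, e5, e6⟩ := iter_rel (F := G) (G := G) (r := fun a b => b = a ∧ b.1 = s)
        (fun a b a' h e => ⟨a', by rw [h.1, e], rfl, by rw [hG a a' e, ← h.1, h.2]⟩) ⟨rfl, rfl⟩ e3
      exact ⟨by rw [← e6.1, e6.2], e4.symm⟩
    have hsnd := Crystal.IsHom.aff_snd (krAll n)
    have h5 : u.2.1 = s ∧ u'.2 = u.2 := by
      rcases h1 with ⟨e1, e2⟩ | ⟨e1, e2⟩
      · refine key _ _ (hsnd.f i) (fun a a' h => ?_) e1 e2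
        obtain ⟨s, T, T', -, rfl, rfl⟩ := krAll_f.1 h
        rfl
      · refine key _ _ (hsnd.e i) (fun a a' h => ?_) e1 e2
        obtain ⟨s, T, T', -, rfl, rfl⟩ := krAll_e.1 h
        rfl
    have h6 := evolves_of_chainR h4 h5.1 h5.2
    rwa [show (fun i => (w i).2) = p' from funext hp] at h6
  · have e1 := (krAll_regular n).deg_reflect hw
    have e2 := (krAll_regular n).deg_reflect h3
    have e3 := (chainR_isSim n L).ε i _ _ hT
    have e4 := (chainR_isSim n L).φ i _ _ hT
    simp only [Crystal.tensor, Crystal.aff] at e3 e4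
    have e5 : (((krAll n).aff.vec L).φ i q : ℤ) - ((krAll n).aff.vec L).ε i q =
        ((krAll n).aff.vec L).φ i (fun j => ((0 : ℤ), p j)) -
          ((krAll n).aff.vec L).ε i (fun j => ((0 : ℤ), p j)) := by
      simp only [Crystal.aff] at *
      omega
    rw [Finset.sum_sub_distrib, e1, e2, e5]
    simp

end

/-! ### Time evolutions and the generators of the extended affine Weyl groups -/

section

variable {n L : ℕ} {s : Shape n}

theorem perm_inv_apply {A : Type} (g : Equiv.Perm A) (a : A) : g⁻¹ (g a) = a :=
  g.symm_apply_apply a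

theorem perm_apply_inv {A : Type} (g : Equiv.Perm A) (a : A) : g (g⁻¹ a) = a :=
  g.apply_symm_apply a

theorem castSucc_finRotate {m : ℕ} (i : Fin (m + 1)) :
    (i.succ = Fin.last (m + 1) ∧ finRotate (m + 1) i = 0) ∨
      i.succ = (finRotate (m + 1) i).castSucc := by
  refine Fin.lastCases ?_ (fun i => ?_) i
  · exact Or.inl ⟨rfl, finRotate_last⟩
  · right
    rw [finRotate_apply, Fin.coeSucc_eq_succ, Fin.succ_castSucc]

/-- The carriers of a periodic chain, indexed cyclically. -/
theorem evolves_iff {p : State n L} {q : Fin L → ℤ × KR n} : Evolves s p q ↔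
    ∃ v : Fin L → Tab s, ∀ i, IsR ⟨s, v i⟩ (p i) (q i).1 (q i).2 ⟨s, v (finRotate L i)⟩ := by
  cases L with
  | zero => exact ⟨fun _ => ⟨fun i => i.elim0, fun i => i.elim0⟩,
      fun _ => ⟨fun _ => Tab.highest s, rfl, fun i => i.elim0⟩⟩
  | succ m =>
    constructor
    · rintro ⟨u, h1, h2⟩
      refine ⟨fun i => u i.castSucc, fun i => ?_⟩
      have h3 := h2 i
      rcases castSucc_finRotate i with ⟨h4, h5⟩ | h4
      · rw [h4, ← h1] at h3
        simp only [h5, Fin.castSucc_zero]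
        exact h3
      · rw [h4] at h3
        exact h3
    · rintro ⟨v, h2⟩
      have h0 : (Fin.snoc v (v 0) : Fin (m + 2) → Tab s) 0 = v 0 :=
        Fin.snoc_castSucc (α := fun _ => Tab s) (v 0) v 0
      refine ⟨Fin.snoc v (v 0), by rw [h0, Fin.snoc_last], fun i => ?_⟩
      have h3 := h2 i
      rw [Fin.snoc_castSucc]
      rcases castSucc_finRotate i with ⟨h4, h5⟩ | h4
      · rw [h4, Fin.snoc_last, ← h5]
        exact h3
      · rw [h4, Fin.snoc_castSucc]
        exact h3

/-- The operator `g` on states lifts injectively to the possible results of the time evolution, and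
these lifts preserve the total degree. -/
def Lifts (s : Shape n) (g : Equiv.Perm (State n L)) : Prop :=
  ∀ p, ∃ F : (Fin L → ℤ × KR n) → Fin L → ℤ × KR n, Function.Injective F ∧ ∀ q, Evolves s p q →
    Evolves s (g p) (F q) ∧ (fun i => (F q i).2) = g (fun i => (q i).2) ∧
      ∑ i, (F q i).1 = ∑ i, (q i).1

/-- The operator `g` commutes with the time evolution and preserves the conserved quantity. -/
def Commutes (s : Shape n) (g : Equiv.Perm (State n L)) : Prop :=
  ∀ p, (T s p).map g = T s (g p) ∧ E s (g p) = E s p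

theorem evolution_eq_some {p : State n L} {q : Fin L → ℤ × KR n} (h : Evolves s p q)
    (h' : ∀ q', Evolves s p q' → q' = q) : evolution s p = some q := by
  have hex : ∃! q, Evolves s p q := ⟨q, h, h'⟩
  rw [evolution, dif_pos hex, h' _ hex.choose_spec.1]

theorem commutes_of_lifts {g : Equiv.Perm (State n L)} (hg : Lifts s g) (hg' : Lifts s g⁻¹) :
    Commutes s g := by
  have key : ∀ g : Equiv.Perm (State n L), Lifts s g → Lifts s g⁻¹ → ∀ p q, Evolves s p q →
      (∀ q', Evolves s p q' → q' = q) → ∃ r, Evolves s (g p) r ∧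
        (∀ r', Evolves s (g p) r' → r' = r) ∧ (fun i => (r i).2) = g (fun i => (q i).2) ∧
        ∑ i, (r i).1 = ∑ i, (q i).1 := by
    intro g hg hg' p q hq hq'
    obtain ⟨F, -, hF⟩ := hg p
    obtain ⟨G, hG, hG'⟩ := hg' (g p)
    obtain ⟨h1, h2, h3⟩ := hF q hq
    refine ⟨F q, h1, fun r hr => hG ?_, h2, h3⟩
    have e1 := (hG' r hr).1
    have e2 := (hG' _ h1).1
    rw [perm_inv_apply] at e1 e2
    rw [hq' _ e1, hq' _ e2]
  intro p
  by_cases h : ∃! q, Evolves s p q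
  · obtain ⟨q, hq, hq'⟩ := h
    obtain ⟨r, hr, hr', h1, h2⟩ := key g hg hg' p q hq hq'
    rw [T, T, E, E, evolution_eq_some hq hq', evolution_eq_some hr hr']
    simp only [Option.map_some, h1, h2, and_self]
  · have h' : ¬ ∃! q, Evolves s (g p) q := by
      rintro ⟨q, hq, hq'⟩
      obtain ⟨r, hr, hr', -⟩ := key g⁻¹ hg' (by rwa [inv_inv]) (g p) q hq hq'
      rw [perm_inv_apply] at hr hr'
      exact h ⟨r, hr, hr'⟩
    rw [T, T, E, E, evolution, evolution, dif_neg h, dif_neg h']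
    exact ⟨rfl, rfl⟩

namespace Commutes

variable {g g' : Equiv.Perm (State n L)}

theorem one : Commutes s (1 : Equiv.Perm (State n L)) := fun p => ⟨by simp, rfl⟩

theorem mul (hg : Commutes s g) (hg' : Commutes s g') : Commutes s (g * g') := fun p => by
  obtain ⟨h1, h2⟩ := hg (g' p)
  obtain ⟨h3, h4⟩ := hg' p
  rw [Equiv.Perm.mul_apply, ← h1, ← h3, h2, h4, Option.map_map]
  exact ⟨rfl, rfl⟩

theorem inv (hg : Commutes s g) : Commutes s g⁻¹ := fun p => by
  obtain ⟨h1, h2⟩ := hg (g⁻¹ p)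
  rw [perm_apply_inv] at h1 h2
  refine ⟨?_, h2.symm⟩
  rw [← h1, Option.map_map]
  simp

end Commutes

theorem lifts_comp {ρ : Equiv.Perm (Fin L)} (hρ : ∀ i, ρ (finRotate L i) = finRotate L (ρ i))
    {g : Equiv.Perm (State n L)} (hg : ∀ p, g p = p ∘ ρ) : Lifts s g := by
  intro p
  refine ⟨fun q => q ∘ ρ, ρ.surjective.injective_comp_right, fun q hq => ⟨?_, ?_, ?_⟩⟩
  · obtain ⟨v, hv⟩ := evolves_iff.1 hq
    refine evolves_iff.2 ⟨v ∘ ρ, fun i => ?_⟩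
    rw [hg]
    simp only [Function.comp_apply, hρ]
    exact hv (ρ i)
  · rw [hg]
    rfl
  · exact Equiv.sum_comp ρ fun i => (q i).1

theorem commutes_cyclicShift : Commutes s (cyclicShift n L) :=
  commutes_of_lifts (lifts_comp (ρ := (finRotate L).symm)
    (fun i => by rw [Equiv.symm_apply_apply, Equiv.apply_symm_apply]) fun _ => rfl)
    (lifts_comp (ρ := finRotate L) (fun _ => rfl) fun _ => rfl)

theorem commutes_of_isWeylOperator {i : Fin (n + 1)} {g : Equiv.Perm (State n L)}
    (hg : IsWeylOperator i g) : Commutes s g := by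
  have hA := (krAll_regular n).aff.vec L
  have key : ∀ g : Equiv.Perm (State n L), IsWeylOperator i g → Lifts s g := by
    intro g hg p
    obtain ⟨w, hw, hwp⟩ := exists_reflect_aff (hg p)
    choose S hS using hA.exists_reflect i
    refine ⟨fun q j => ((S q j).1 - (w j).1, (S q j).2), fun q q' h => ?_, fun q hq => ?_⟩
    · have h1 : S q = S q' := by
        funext j
        have := congrFun h j
        simp only [Prod.mk.injEq, sub_left_inj] at this
        exact Prod.ext this.1 this.2
      have h2 := hA.reflect_symm (hS q)
      rw [h1, hA.reflect_symm (hS q'), Option.some.injEq] at h2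
      exact h2.symm
    · obtain ⟨q', h1, h2, h3⟩ := evolves_reflect hw hwp hq
      rw [hS q, Option.some.injEq] at h1
      subst h1
      refine ⟨h2, ?_, h3⟩
      have h4 := ((Crystal.IsHom.aff_snd (krAll n)).vec L).reflect i q
      rw [hS q, Option.map_some] at h4
      have h5 := (hg fun j => (q j).2).symm.trans h4
      rw [Option.some.injEq] at h5
      exact h5.symm
  refine commutes_of_lifts (key g hg) (key g⁻¹ fun p => ?_)
  have h := hg (g⁻¹ p)
  rw [perm_apply_inv] at h
  exact ((krAll_regular n).vec L).reflect_symm h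

theorem isR_size_last {b c c' b' : KR n} {h : ℤ} (H : IsR b c h c' b') :
    c'.2.size n + b'.2.size n = b.2.size n + c.2.size n := by
  obtain ⟨R, -, rfl, rfl⟩ := H
  exact R.size_last_add b.2 c.2

/-- The letters `n` are only moved between the factors. -/
theorem sum_size_last {p : State n L} {q : Fin L → ℤ × KR n} (h : Evolves s p q) :
    ∑ i, ((q i).2.2.size n : ℤ) = ∑ i, ((p i).2.size n : ℤ) := by
  obtain ⟨v, hv⟩ := evolves_iff.1 h
  have h1 := Equiv.sum_comp (finRotate L) fun i => ((v i).size n : ℤ)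
  have h2 : ∑ i, (((q i).2.2.size n : ℤ) + (v (finRotate L i)).size n) =
      ∑ i, (((v i).size n : ℤ) + (p i).2.size n) :=
    Finset.sum_congr rfl fun i _ => by exact_mod_cast isR_size_last (hv i)
  rw [Finset.sum_add_distrib, Finset.sum_add_distrib, h1] at h2
  linarith

theorem evolves_prState_iff {p : State n L} {q : Fin L → ℤ × KR n} :
    Evolves s (prState n L p) (fun i => ((q i).1, ⟨_, Tab.pr _ (q i).2.2⟩)) ↔
      Evolves s p (fun i => ((q i).1 + (p i).2.size n - (q i).2.2.size n, (q i).2)) := by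
  rw [evolves_iff, evolves_iff]
  constructor
  · rintro ⟨v, hv⟩
    refine ⟨fun i => (Tab.pr s).symm (v i), fun i => ?_⟩
    refine isR_pr_iff.1 ?_
    simp only [Equiv.apply_symm_apply]
    exact hv i
  · rintro ⟨v, hv⟩
    exact ⟨fun i => Tab.pr s (v i), fun i => isR_pr_iff.2 (hv i)⟩

theorem commutes_prState : Commutes s (prState n L) := by
  apply commutes_of_lifts
  · intro p
    refine ⟨fun q i => ((q i).1 - (p i).2.size n + (q i).2.2.size n,
      ⟨_, Tab.pr _ (q i).2.2⟩), fun q q' h => ?_, fun q hq => ⟨?_, rfl, ?_⟩⟩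
    · have h1 : (fun i => (q i).2) = fun i => (q' i).2 :=
        (prState n L).injective (funext fun i => congrArg Prod.snd (congrFun h i))
      funext i
      have h2 := congrArg Prod.fst (congrFun h i)
      have h3 := congrFun h1 i
      simp only at h2 h3
      rw [h3] at h2
      exact Prod.ext (by linarith) h3
    · refine (evolves_prState_iff (q := fun i => ((q i).1 - (p i).2.size n + (q i).2.2.size n,
        (q i).2))).2 ?_
      convert hq using 1
      funext i
      exact Prod.ext (by simp only; ring) rfl
    · have := sum_size_last hq
      simp only [Finset.sum_add_distrib, Finset.sum_sub_distrib]
      linarith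
  · intro p
    obtain ⟨p, rfl⟩ := (prState n L).surjective p
    refine ⟨fun q i => ((q i).1 + (p i).2.size n - ((Tab.pr _).symm (q i).2.2).size n,
      ⟨_, (Tab.pr _).symm (q i).2.2⟩), fun q q' h => ?_, fun q hq => ?_⟩
    · have h1 : (fun i => (q i).2) = fun i => (q' i).2 :=
        (prState n L).symm.injective (funext fun i => congrArg Prod.snd (congrFun h i))
      funext i
      have h2 := congrArg Prod.fst (congrFun h i)
      have h3 := congrFun h1 i
      simp only at h2 h3
      rw [h3] at h2
      exact Prod.ext (by linarith) h3
    · rw [perm_inv_apply]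
      have h1 : Evolves s p (fun i => ((q i).1 + (p i).2.size n -
          ((Tab.pr _).symm (q i).2.2).size n, ⟨_, (Tab.pr _).symm (q i).2.2⟩)) := by
        refine (evolves_prState_iff (q := fun i => ((q i).1,
          ⟨_, (Tab.pr _).symm (q i).2.2⟩))).1 ?_
        simp only [Equiv.apply_symm_apply]
        exact hq
      refine ⟨h1, rfl, ?_⟩
      have := sum_size_last h1
      simp only [Finset.sum_add_distrib, Finset.sum_sub_distrib] at this ⊢
      linarith

theorem IsExchange.inv {j k : Fin L} {g : Equiv.Perm (State n L)} (h : IsExchange j k g) :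
    IsExchange j k g⁻¹ := by
  refine ⟨h.1, fun p => ?_⟩
  obtain ⟨⟨d, h1⟩, h2⟩ := h.2 (g⁻¹ p)
  rw [perm_apply_inv] at h1 h2
  exact ⟨⟨d, isR_inv h1⟩, fun i hj hk => (h2 i hj hk).symm⟩

/-- By the Yang-Baxter equation, the time evolution commutes with the exchange of neighbours; only
the carrier between the two neighbours changes. -/
theorem IsExchange.lifts {j k : Fin L} {g : Equiv.Perm (State n L)} (h : IsExchange j k g) :
    Lifts s g := by
  have hjk : finRotate L j = k := by
    obtain ⟨m, rfl⟩ : ∃ m, L = m + 1 := ⟨L - 1, by have := j.2; omega⟩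
    have h1 := h.1
    have h2 := k.2
    rw [finRotate_apply]
    apply Fin.ext
    rw [Fin.val_add_one_of_lt (by rw [Fin.lt_def, Fin.val_last]; omega), h1]
  have hne : j ≠ k := fun hh => by
    have := h.1
    rw [hh] at this
    omega
  choose d hd using fun p => (h.2 p).1
  have hg := fun p => (h.2 p).2
  intro p
  -- The new degrees at `j` and `k` have the same sum as the old ones.
  let dj : (Fin L → ℤ × KR n) → ℤ := fun q => (q k).1 + d (fun i => (q i).2) - d p
  let dk : (Fin L → ℤ × KR n) → ℤ := fun q => (q j).1 - d (fun i => (q i).2) + d p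
  refine ⟨fun q i => (if i = j then dj q else if i = k then dk q else (q i).1,
    g (fun i => (q i).2) i), fun q q' hq => ?_, fun q hq => ⟨?_, rfl, ?_⟩⟩
  · have h1 : (fun i => (q i).2) = fun i => (q' i).2 :=
      g.injective (funext fun i => congrArg Prod.snd (congrFun hq i))
    have h2 := fun i => congrArg Prod.fst (congrFun hq i)
    have h3 := h2 j
    have h4 := h2 k
    simp only [if_pos, if_neg hne.symm, dj, dk, h1] at h3 h4
    funext i
    refine Prod.ext ?_ (congrFun h1 i)
    by_cases hj : i = j
    · subst hj; linarith
    · by_cases hk : i = k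
      · subst hk; linarith
      · have := h2 i
        simpa only [if_neg hj, if_neg hk] using this
  · obtain ⟨v, hv⟩ := evolves_iff.1 hq
    have h1 := hv j
    rw [hjk] at h1
    obtain ⟨⟨s', v₃⟩, rfl, h3, h4⟩ := isR_yang_baxter h1 (hv k) (hd fun i => (q i).2) (hd p)
    refine evolves_iff.2 ⟨Function.update v k v₃, fun i => ?_⟩
    beta_reduce
    by_cases hj : i = j
    · subst hj
      rw [hjk, Function.update_of_ne hne, Function.update_self, if_pos rfl]
      exact h3
    · have hik : finRotate L i ≠ k := fun hh => hj ((finRotate L).injective (hh.trans hjk.symm))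
      rw [Function.update_of_ne hik, if_neg hj]
      by_cases hk : i = k
      · subst hk
        rw [Function.update_self, if_pos rfl]
        exact h4
      · rw [Function.update_of_ne hk, if_neg hk, hg p i hj hk, hg (fun i => (q i).2) i hj hk]
        exact hv i
  · have e1 : ∀ f : Fin L → ℤ, ∑ i, f i = f j + f k + ∑ i ∈ Finset.univ \ {j, k}, f i := by
      intro f
      rw [← Finset.sum_sdiff (Finset.subset_univ {j, k}), Finset.sum_pair hne]
      ring
    rw [e1, e1 fun i => (q i).1]
    beta_reduce
    rw [if_pos rfl, if_neg hne.symm, if_pos rfl]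
    have e2 : ∑ i ∈ Finset.univ \ {j, k}, (if i = j then dj q else if i = k then dk q
        else (q i).1) = ∑ i ∈ Finset.univ \ {j, k}, (q i).1 := by
      refine Finset.sum_congr rfl fun i hi => ?_
      simp only [Finset.mem_sdiff, Finset.mem_univ, true_and, Finset.mem_insert,
        Finset.mem_singleton, not_or] at hi
      rw [if_neg hi.1, if_neg hi.2]
    rw [e2]
    simp only [dj, dk]
    ring

theorem IsExchange.commutes {j k : Fin L} {g : Equiv.Perm (State n L)} (h : IsExchange j k g) :
    Commutes s g :=
  commutes_of_lifts h.lifts h.inv.lifts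

theorem commutes_of_mem_affineWeyl {w : Equiv.Perm (State n L)} (hw : w ∈ affineWeyl n L) :
    Commutes s w := by
  induction hw using Subgroup.closure_induction with
  | mem g hg =>
    rcases hg with hg | ⟨i, hg⟩
    · rw [Set.mem_singleton_iff.1 hg]
      exact commutes_prState
    · exact commutes_of_isWeylOperator hg
  | one => exact Commutes.one
  | mul _ _ _ _ h h' => exact h.mul h'
  | inv _ _ h => exact h.inv

theorem commutes_of_mem_exchangeWeyl {w : Equiv.Perm (State n L)} (hw : w ∈ exchangeWeyl n L) :
    Commutes s w := by
  induction hw using Subgroup.closure_induction with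
  | mem g hg =>
    rcases hg with (hg | ⟨j, k, hg⟩) | ⟨g₁, j, k, -, hg₁, rfl⟩
    · rw [Set.mem_singleton_iff.1 hg]
      exact commutes_cyclicShift
    · exact hg.commutes
    · exact (commutes_cyclicShift.inv.mul hg₁.commutes).mul commutes_cyclicShift
  | one => exact Commutes.one
  | mul _ _ _ _ h h' => exact h.mul h'
  | inv _ _ h => exact h.inv

end

end PeriodicAutomaton

open PeriodicAutomaton in
theorem theorem2p2 (n L : ℕ) (s : Shape n) (p : State n L) (hp : T s p ≠ none) :
    (∀ w ∈ affineWeyl n L, (T s p).map w = T s (w p) ∧ E s (w p) = E s p) ∧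
    (∀ w ∈ affineWeyl n L, ∀ w' ∈ exchangeWeyl n L,
      (T s p).map (w * w') = T s ((w * w') p) ∧ E s ((w * w') p) = E s p) :=
  ⟨fun _ hw => commutes_of_mem_affineWeyl hw p, fun _ hw _ hw' =>
    ((commutes_of_mem_affineWeyl hw).mul (commutes_of_mem_exchangeWeyl hw')) p⟩
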